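/- For a finite set $X$ of $n$ points in the Euclidean plane and an integer $t\ge 0$, let $\mathrm{opt}(X,t)$ denote the minimum area of a closed rectangle of arbitrary orientation (degenerate rectangles, i.e. segments and points, being allowed) that encloses at least $n-t$ points of $X$. There are a randomized algorithm and an absolute constant $C$ such that the following holds for all integers $n\ge 1$ and $0\le t\le n/2$, every real $\epsilon>0$, and every set $X\subset\mathbb{R}^2$ of $n$ points no three of which are collinear. Given $n$, $t$, $\epsilon$ and the coordinates of the points of $X$ in an arbitrary order, the algorithm returns, with probability at least $1-3/n$, a rectangle of area at most $\mathrm{opt}(X,t)$ such that the number $m$ of points of $X$ that it encloses satisfies $$(n-t)(1-\epsilon)\;\le\; m\;\le\; n-t+1 .$$ Whatever its random choices, the algorithm halts within time $$C\left(\Big(\frac{\log n}{\epsilon^2}\Big)^4\Big(\frac tn+\epsilon\Big)^3+n\right),$$ and in particular within time $C\,n+\mathrm{poly}(\log n,t,1/\epsilon)$ for a fixed polynomial $\mathrm{poly}$. Here time is the number of unit-cost operations of a randomized real RAM: a random access machine with arithmetic operations and comparisons on real numbers ($+,-,\times,/$, no rounding and no roots), addition, subtraction and comparison of natural numbers, indirect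 addressing, and the drawing of a uniformly random element of $\{0,\dots,k\}$ for a computed natural number $k$. -/

import Mathlib

/-! ### Rectangles, enclosed points and the optimal area -/

/-- The Euclidean plane. -/
abbrev Plane : Type := EuclideanSpace ℝ (Fin 2)

/-- A closed rectangle of arbitrary orientation, given by one vertex and the two (orthogonal) edge
vectors issuing from it. Rectangles that degenerate to a segment or a point are allowed: otherwise
the minimum area would not be attained when one has to enclose only one or two points. -/
structure Rectangle where
  /-- a vertex -/
  vertex : Plane
  /-- first edge vector -/
  edge₁ : Plane
  /-- second edge vector -/
  edge₂ : Plane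
  orthogonal : inner ℝ edge₁ edge₂ = 0

/-- The region covered by a rectangle, including its boundary. -/
def Rectangle.region (R : Rectangle) : Set Plane :=
  {q | ∃ a ∈ Set.Icc (0 : ℝ) 1, ∃ b ∈ Set.Icc (0 : ℝ) 1, q = R.vertex + a • R.edge₁ + b • R.edge₂}

/-- The area of a rectangle: the product of its side lengths. -/
noncomputable def Rectangle.area (R : Rectangle) : ℝ := ‖R.edge₁‖ * ‖R.edge₂‖

/-- The number of points of `X` that `R` encloses. -/
noncomputable def Rectangle.enclosed (R : Rectangle) (X : Finset Plane) : ℕ :=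
  ((X : Set Plane) ∩ R.region).ncard

/-- The minimum area of a rectangle that encloses at least `|X| - t` points of `X`. -/
noncomputable def optArea (X : Finset Plane) (t : ℕ) : ℝ :=
  sInf {A : ℝ | ∃ R : Rectangle, X.card ≤ R.enclosed X + t ∧ A = R.area}

/-- No three distinct points of `X` lie on a common line. -/
def NoThreeCollinear (X : Finset Plane) : Prop :=
  ∀ a ∈ X, ∀ b ∈ X, ∀ c ∈ X, a ≠ b → a ≠ c → b ≠ c → ¬ Collinear ℝ ({a, b, c} : Set Plane)

/-! ### Randomized real RAM

Programs of a structured language over a random access memory whose cells hold natural numbers or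
real numbers, with unit-cost arithmetic (`+`, `-` on natural numbers, `+`, `-`, `*`, `/` on reals),
comparisons, indirect addressing, and uniformly random natural numbers. The only constants are
natural numbers; there is no rounding of reals and no root or transcendental function. -/

namespace RealRAM

/-- Memory: arrays of natural numbers and of reals. The names of the arrays are natural numbers; a
program addresses only the finitely many arrays whose names occur in it; a scalar variable is cell `0` of an array. -/
@[ext] structure State where
  /-- `nat a i` is cell `i` of the array of natural numbers with name `a` -/
  nat : ℕ → ℕ → ℕ
  /-- `real a i` is cell `i` of the array of reals with name `a` -/
  real : ℕ → ℕ → ℝ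

/-- Write `v` into cell `i` of the array `a` of natural numbers. -/
def State.setNat (σ : State) (a i v : ℕ) : State :=
  { σ with nat := Function.update σ.nat a (Function.update (σ.nat a) i v) }

/-- Write `v` into cell `i` of the array `a` of reals. -/
noncomputable def State.setReal (σ : State) (a i : ℕ) (v : ℝ) : State :=
  { σ with real := Function.update σ.real a (Function.update (σ.real a) i v) }

/-- Expressions with natural number values. -/
inductive NatExp : Type
  | const (k : ℕ) : NatExp
  | read (a : ℕ) (i : NatExp) : NatExp
  | add (e f : NatExp) : NatExp
  | sub (e f : NatExp) : NatExp

/-- Value of an expression (subtraction is truncated at `0`). -/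
def NatExp.eval (σ : State) : NatExp → ℕ
  | .const k => k
  | .read a i => σ.nat a (i.eval σ)
  | .add e f => e.eval σ + f.eval σ
  | .sub e f => e.eval σ - f.eval σ

/-- Cost of evaluating an expression: one unit per operation. -/
def NatExp.cost : NatExp → ℕ
  | .const _ => 1
  | .read _ i => 1 + i.cost
  | .add e f => 1 + e.cost + f.cost
  | .sub e f => 1 + e.cost + f.cost

/-- Expressions with real values. -/
inductive RealExp : Type
  | ofNat (e : NatExp) : RealExp
  | read (a : ℕ) (i : NatExp) : RealExp
  | add (e f : RealExp) : RealExp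
  | sub (e f : RealExp) : RealExp
  | mul (e f : RealExp) : RealExp
  | div (e f : RealExp) : RealExp

/-- Value of an expression (a division by `0` returns `0`). -/
noncomputable def RealExp.eval (σ : State) : RealExp → ℝ
  | .ofNat e => (e.eval σ : ℝ)
  | .read a i => σ.real a (i.eval σ)
  | .add e f => e.eval σ + f.eval σ
  | .sub e f => e.eval σ - f.eval σ
  | .mul e f => e.eval σ * f.eval σ
  | .div e f => e.eval σ / f.eval σ

/-- Cost of evaluating an expression: one unit per operation. -/
def RealExp.cost : RealExp → ℕ
  | .ofNat e => 1 + e.cost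
  | .read _ i => 1 + i.cost
  | .add e f => 1 + e.cost + f.cost
  | .sub e f => 1 + e.cost + f.cost
  | .mul e f => 1 + e.cost + f.cost
  | .div e f => 1 + e.cost + f.cost

/-- Tests. -/
inductive Test : Type
  | natLt (e f : NatExp) : Test
  | realLt (e f : RealExp) : Test
  | not (b : Test) : Test
  | and (b c : Test) : Test

/-- Truth of a test. -/
def Test.Holds (σ : State) : Test → Prop
  | .natLt e f => e.eval σ < f.eval σ
  | .realLt e f => e.eval σ < f.eval σ
  | .not b => ¬ b.Holds σ
  | .and b c => b.Holds σ ∧ c.Holds σ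

/-- Cost of evaluating a test: one unit per operation. -/
def Test.cost : Test → ℕ
  | .natLt e f => 1 + e.cost + f.cost
  | .realLt e f => 1 + e.cost + f.cost
  | .not b => 1 + b.cost
  | .and b c => 1 + b.cost + c.cost

/-- Programs. -/
inductive Program : Type
  /-- do nothing -/
  | skip : Program
  /-- `a[i] := e` for an array of natural numbers -/
  | setNat (a : ℕ) (i e : NatExp) : Program
  /-- `a[i] := e` for an array of reals -/
  | setReal (a : ℕ) (i : NatExp) (e : RealExp) : Program
  /-- `a[i] :=` a fresh uniformly random element of `{0, …, e}` -/
  | draw (a : ℕ) (i e : NatExp) : Program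
  /-- first `P`, then `Q` -/
  | seq (P Q : Program) : Program
  /-- if `b` then `P` else `Q` -/
  | ite (b : Test) (P Q : Program) : Program
  /-- while `b` do `P` -/
  | loop (b : Test) (P : Program) : Program

/-- `Runs P σ T μ`: started in the memory state `σ`, the program `P` halts within `T` time units
whatever the outcome of its random draws, and its final memory state has the law `μ`. -/
inductive Runs : Program → State → ℕ → PMF State → Prop
  | skip (σ : State) : Runs .skip σ 1 (PMF.pure σ)
  | setNat (a : ℕ) (i e : NatExp) (σ : State) :
      Runs (.setNat a i e) σ (1 + i.cost + e.cost) (PMF.pure (σ.setNat a (i.eval σ) (e.eval σ)))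
  | setReal (a : ℕ) (i : NatExp) (e : RealExp) (σ : State) :
      Runs (.setReal a i e) σ (1 + i.cost + e.cost) (PMF.pure (σ.setReal a (i.eval σ) (e.eval σ)))
  | draw (a : ℕ) (i e : NatExp) (σ : State) :
      Runs (.draw a i e) σ (1 + i.cost + e.cost)
        ((PMF.uniformOfFintype (Fin (e.eval σ + 1))).map
          fun k : Fin (e.eval σ + 1) => σ.setNat a (i.eval σ) (k : ℕ))
  | seq {P Q : Program} {σ : State} {T T' : ℕ} {μ : PMF State} {ν : State → PMF State}
      (first : Runs P σ T μ) (second : ∀ τ ∈ μ.support, Runs Q τ T' (ν τ)) :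
      Runs (.seq P Q) σ (T + T') (μ.bind ν)
  | ite_true {b : Test} {P Q : Program} {σ : State} {T : ℕ} {μ : PMF State}
      (test : b.Holds σ) (branch : Runs P σ T μ) :
      Runs (.ite b P Q) σ (1 + b.cost + T) μ
  | ite_false {b : Test} {P Q : Program} {σ : State} {T : ℕ} {μ : PMF State}
      (test : ¬ b.Holds σ) (branch : Runs Q σ T μ) :
      Runs (.ite b P Q) σ (1 + b.cost + T) μ
  | loop_false {b : Test} {P : Program} {σ : State} (test : ¬ b.Holds σ) :
      Runs (.loop b P) σ (1 + b.cost) (PMF.pure σ)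
  | loop_true {b : Test} {P : Program} {σ : State} {T T' : ℕ} {μ : PMF State}
      {ν : State → PMF State} (test : b.Holds σ) (body : Runs P σ T μ)
      (again : ∀ τ ∈ μ.support, Runs (.loop b P) τ T' (ν τ)) :
      Runs (.loop b P) σ (1 + b.cost + T + T') (μ.bind ν)
  | mono {P : Program} {σ : State} {T T' : ℕ} {μ : PMF State}
      (run : Runs P σ T μ) (le : T ≤ T') : Runs P σ T' μ

/-- The memory state in which a program receives its input: the numbers `n` and `t` in the arrays
`0` and `1` of natural numbers, the real number `ε` in the real array `0`, the coordinates of the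
`n` points in the real arrays `1` and `2`; all other cells are `0`. -/
noncomputable def input (n t : ℕ) (ε : ℝ) (p : Fin n → Plane) : State where
  nat a i := if a = 0 ∧ i = 0 then n else if a = 1 ∧ i = 0 then t else 0
  real a i :=
    if a = 0 ∧ i = 0 then ε
    else if h : i < n then
      if a = 1 then p ⟨i, h⟩ 0 else if a = 2 then p ⟨i, h⟩ 1 else 0
    else 0

/-- The memory state `σ` holds the rectangle `R` as output: the coordinates of its vertex and its
two edge vectors are the first six cells of the real array `3`. -/
def Outputs (σ : State) (R : Rectangle) : Prop :=
  σ.real 3 0 = R.vertex 0 ∧ σ.real 3 1 = R.vertex 1 ∧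
  σ.real 3 2 = R.edge₁ 0 ∧ σ.real 3 3 = R.edge₁ 1 ∧
  σ.real 3 4 = R.edge₂ 0 ∧ σ.real 3 5 = R.edge₂ 1

end RealRAM

/-!
Draw a sample of `s ≈ log n / ε ^ 2` of the points, with replacement, and let the first
`k ≈ log n / ε` of them form a net. A rectangle is pinned by five points `e 0, …, e 4` if one side
lies on the line through `e 0` and `e 1`, the two adjacent sides pass through `e 2` and `e 3`, and
the opposite side passes through `e 4`. The algorithm returns the smallest rectangle pinned by net
points among those that contain a fraction of at least `1 - t / n - ε / 3` of the sample. Square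
roots are not needed, because the vector from `e 0` to `e 1` is used without normalization.

*Area.* Let `R` be an optimal rectangle, and `Y` the set of the points in it. The smallest rectangle
around the net points in `Y` can be chosen with two of these points on one side
(`exists_pinned_area_le`): for a minimum over all directions with only one point on each side, a
small rotation would reduce the area. Hence it is pinned by net points, and its area is at most that
of `R`. If the net meets each set `Y \ B`, `B` a pinned box, that has at least `ε n / 6` elements,
then this rectangle misses fewer than `ε n / 6` points of `Y`, and it passes the test if the sample
estimates the contents of all pinned boxes up to `ε n / 6`. There are at most `n ^ 5` pinned
boxes, so that by Chernoff's bound both hold with high probability (`card_not_typical_le`).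

*Number of points.* The test gives the lower bound. The upper bound follows from the area: a
rectangle with `n - t + 2` points could be narrowed until it loses the points on one side, of which
there are at most two in general position, and its area would then be smaller than the optimum
(`enclosed_le_of_area_le`).

*Time.* With high probability, at most `r ≈ k (t / n + ε)` points of the net are outside of `R`. So
a point `e 2`, `e 3` or `e 4` needs to be considered only if fewer than `r` net points lie beyond
the side through it. This leaves `k ^ 2 r ^ 3` rectangles, with a test of cost `s` for each, and
`k ^ 2 r ^ 2` computations of ranks in the net, each for `k` points at cost `k`
(`computes_search`). With `l = log n` and `τ = t / n + ε` the total is of order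
`l ^ 6 τ ^ 3 / ε ^ 7`. If `l ^ 2 ε ≤ 1`, this is at most `l ^ 4 τ ^ 3 / ε ^ 8`, and otherwise it
is at most a power of `l`, hence `O(n)` (`log_pow_div_le`).

If `n < 4` or `ε ≥ 1`, the algorithm returns a single point: for `n ≤ 3` nothing is claimed, and for
`ε ≥ 1` the lower bound on the number of points is not positive.
-/

namespace RealRAM

/-! ### Deterministic runs -/

/-- Started in `σ`, the program `P` halts within `T` time units in one definite state, and that
state satisfies `Q`. -/
def Computes (P : Program) (σ : State) (T : ℕ) (Q : State → Prop) : Prop :=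
  ∃ τ, Runs P σ T (PMF.pure τ) ∧ Q τ

theorem Runs.seq_pure {P Q : Program} {σ τ : State} {T T' : ℕ} {μ : PMF State}
    (hP : Runs P σ T (PMF.pure τ)) (hQ : Runs Q τ T' μ) : Runs (.seq P Q) σ (T + T') μ := by
  have h := Runs.seq (ν := fun _ => μ) hP (fun τ' hτ' => by
    rw [PMF.mem_support_pure_iff] at hτ'
    exact hτ' ▸ hQ)
  rwa [PMF.pure_bind] at h

namespace Computes

theorem mono {P : Program} {σ : State} {T T' : ℕ} {Q Q' : State → Prop}
    (h : Computes P σ T Q) (hT : T ≤ T') (hQ : ∀ τ, Q τ → Q' τ) : Computes P σ T' Q' := by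
  obtain ⟨τ, hr, hq⟩ := h
  exact ⟨τ, hr.mono hT, hQ τ hq⟩

theorem skip {σ : State} {Q : State → Prop} (h : Q σ) : Computes .skip σ 1 Q :=
  ⟨σ, .skip σ, h⟩

theorem setNat {a : ℕ} {i e : NatExp} {σ : State} {Q : State → Prop}
    (h : Q (σ.setNat a (i.eval σ) (e.eval σ))) :
    Computes (.setNat a i e) σ (1 + i.cost + e.cost) Q :=
  ⟨_, .setNat a i e σ, h⟩

theorem setReal {a : ℕ} {i : NatExp} {e : RealExp} {σ : State} {Q : State → Prop}
    (h : Q (σ.setReal a (i.eval σ) (e.eval σ))) :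
    Computes (.setReal a i e) σ (1 + i.cost + e.cost) Q :=
  ⟨_, .setReal a i e σ, h⟩

theorem seq {P P' : Program} {σ : State} {T T' : ℕ} {Q Q' : State → Prop}
    (h : Computes P σ T Q) (h' : ∀ τ, Q τ → Computes P' τ T' Q') :
    Computes (.seq P P') σ (T + T') Q' := by
  obtain ⟨τ, hr, hq⟩ := h
  obtain ⟨τ', hr', hq'⟩ := h' τ hq
  exact ⟨τ', hr.seq_pure hr', hq'⟩

theorem ite {b : Test} {P P' : Program} {σ : State} {T : ℕ} {Q : State → Prop}
    (h : b.Holds σ → Computes P σ T Q) (h' : ¬ b.Holds σ → Computes P' σ T Q) :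
    Computes (.ite b P P') σ (1 + b.cost + T) Q := by
  by_cases hb : b.Holds σ
  · obtain ⟨τ, hr, hq⟩ := h hb
    exact ⟨τ, .ite_true hb hr, hq⟩
  · obtain ⟨τ, hr, hq⟩ := h' hb
    exact ⟨τ, .ite_false hb hr, hq⟩

/-- A loop whose body is executed exactly `N` times, the `m`-th time at cost `c m`; `I m` is the
invariant after `m` rounds. -/
theorem loop {b : Test} {P : Program} {N : ℕ} {c : ℕ → ℕ} {I : ℕ → State → Prop}
    (body : ∀ m < N, ∀ σ, I m σ → b.Holds σ ∧ Computes P σ (c m) (I (m + 1)))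
    (halt : ∀ σ, I N σ → ¬ b.Holds σ) {σ : State} (h : I 0 σ) :
    Computes (.loop b P) σ ((∑ m ∈ Finset.range N, (1 + b.cost + c m)) + (1 + b.cost)) (I N) := by
  suffices H : ∀ d m, m + d = N → ∀ σ, I m σ →
      Computes (.loop b P) σ ((∑ l ∈ Finset.range d, (1 + b.cost + c (m + l))) + (1 + b.cost))
        (I N) by
    simpa using H N 0 (by simp) σ h
  intro d
  induction d with
  | zero =>
    intro m hm σ hI
    obtain rfl : m = N := by omega
    exact ⟨σ, by simpa using Runs.loop_false (halt σ hI), hI⟩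
  | succ d ih =>
    intro m hm σ hI
    obtain ⟨hb, τ, hr, hτ⟩ := body m (by omega) σ hI
    obtain ⟨τ', hr', hτ'⟩ := ih (m + 1) (by omega) τ hτ
    refine ⟨τ', ?_, hτ'⟩
    have h := Runs.loop_true (ν := fun _ => PMF.pure τ') hb hr (fun ρ hρ => by
      rw [PMF.mem_support_pure_iff] at hρ
      exact hρ ▸ hr')
    rw [PMF.pure_bind] at h
    refine h.mono (le_of_eq ?_)
    rw [Finset.sum_range_succ']
    simp only [add_zero, Nat.add_right_comm _ 1, ← add_assoc]
    ring

end Computes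

/-! ### Reading and writing the memory -/

section Memory

variable (σ : State) (a b i j v : ℕ) (x : ℝ)

theorem State.setNat_nat :
    (σ.setNat a i v).nat b j = if b = a ∧ j = i then v else σ.nat b j := by
  simp only [State.setNat, Function.update_apply]
  split_ifs <;> simp_all

@[simp] theorem State.setReal_nat : (σ.setReal a i x).nat = σ.nat := rfl

theorem State.setReal_real :
    (σ.setReal a i x).real b j = if b = a ∧ j = i then x else σ.real b j := by
  simp only [State.setReal, Function.update_apply]
  split_ifs <;> simp_all

variable {a b} in
theorem State.setNat_nat_of_ne (h : b ≠ a) : (σ.setNat a i v).nat b = σ.nat b := by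
  ext; simp [State.setNat_nat, h]

variable {a b} in
theorem State.setReal_real_of_ne (h : b ≠ a) : (σ.setReal a i x).real b = σ.real b := by
  ext; simp [State.setReal_real, h]

/-- The scalar variable of natural number type with name `a`. -/
abbrev NatExp.var (a : ℕ) : NatExp := .read a (.const 0)

/-- The scalar variable of real type with name `a`. -/
abbrev RealExp.var (a : ℕ) : RealExp := .read a (.const 0)

/-- Disjunction of tests. -/
def Test.or (b c : Test) : Test := .not (.and (.not b) (.not c))

@[simp] theorem Test.holds_or (σ : State) (b c : Test) :
    (b.or c).Holds σ ↔ b.Holds σ ∨ c.Holds σ := by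
  simp only [Test.or, Test.Holds]; tauto

end Memory

/-- `a := a + 1` for a scalar variable `a`. -/
def increment (a : ℕ) : Program := .setNat a (.const 0) (.add (.var a) (.const 1))

theorem computes_increment {a : ℕ} {σ : State} {Q : State → Prop}
    (h : Q (σ.setNat a 0 (σ.nat a 0 + 1))) : Computes (increment a) σ 6 Q :=
  Computes.setNat h

/-- `for q = 0, …, N - 1 do body`, where `N` is the value of the scalar variable `bound`. -/
def forLoop (q bound : ℕ) (body : Program) : Program :=
  .seq (.setNat q (.const 0) (.const 0))
    (.loop (.natLt (.var q) (.var bound)) (.seq body (increment q)))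

theorem computes_forLoop {q bound : ℕ} {body : Program} {N : ℕ} {c : ℕ → ℕ}
    {I : ℕ → State → Prop} {σ : State} (hq : bound ≠ q) (hσ : σ.nat bound 0 = N)
    (init : I 0 (σ.setNat q 0 0))
    (step : ∀ m < N, ∀ τ, τ.nat q 0 = m → I m τ → Computes body τ (c m)
      fun τ' => τ'.nat q 0 = m ∧ τ'.nat bound 0 = τ.nat bound 0 ∧
        I (m + 1) (τ'.setNat q 0 (m + 1))) :
    Computes (forLoop q bound body) σ ((∑ m ∈ Finset.range N, (12 + c m)) + 9)
      fun τ => τ.nat bound 0 = N ∧ I N τ := by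
  have key := Computes.loop (b := .natLt (.var q) (.var bound)) (P := .seq body (increment q))
    (N := N) (c := fun m => c m + 6)
    (I := fun m τ => τ.nat q 0 = m ∧ τ.nat bound 0 = N ∧ I m τ)
    (fun m hm τ ⟨h1, h2, h3⟩ => by
      refine ⟨by simpa [Test.Holds, NatExp.eval, h1, h2] using hm, ?_⟩
      refine (step m hm τ h1 h3).seq fun τ' ⟨h1', h2', h3'⟩ => computes_increment ?_
      refine ⟨by simp [State.setNat_nat, h1'], ?_, by simpa [h1'] using h3'⟩
      rw [State.setNat_nat_of_ne _ _ _ hq, h2', h2])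
    (fun τ ⟨h1, h2, _⟩ => by simp [Test.Holds, NatExp.eval, h1, h2])
    (σ := σ.setNat q 0 0)
    ⟨by simp [State.setNat_nat], by rw [State.setNat_nat_of_ne _ _ _ hq, hσ], init⟩
  have h0 := Computes.setNat (σ := σ) (a := q) (i := .const 0) (e := .const 0)
    (Q := fun τ => τ = σ.setNat q 0 0) rfl
  refine (h0.seq fun τ hτ => hτ ▸ key).mono ?_ fun τ h => h.2
  have : ∀ m, 1 + 5 + (c m + 6) = 12 + c m := fun m => by ring
  simp only [NatExp.cost, Test.cost]
  norm_num [this]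
  omega

end RealRAM

/-! ### Rectangles pinned by five points -/

/-- The inner product of `q` with the vector from `i` to `j`. -/
def along (i j q : Plane) : ℝ := q 0 * (j 0 - i 0) + q 1 * (j 1 - i 1)

/-- The inner product of `q` with the vector from `i` to `j` turned by a right angle. -/
def across (i j q : Plane) : ℝ := q 1 * (j 0 - i 0) - q 0 * (j 1 - i 1)

/-- The square of the distance of two points. -/
def distSq (i j : Plane) : ℝ := (j 0 - i 0) ^ 2 + (j 1 - i 1) ^ 2

theorem distSq_pos {i j : Plane} (h : i ≠ j) : 0 < distSq i j := by
  by_contra hc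
  apply h
  unfold distSq at hc
  ext m
  fin_cases m
  · show i 0 = j 0
    nlinarith [sq_nonneg (j 0 - i 0), sq_nonneg (j 1 - i 1)]
  · show i 1 = j 1
    nlinarith [sq_nonneg (j 0 - i 0), sq_nonneg (j 1 - i 1)]

/-- The region of the rectangle with one side on the line through `e 0` and `e 1`, the adjacent
sides through `e 2` and `e 3`, and the opposite side through `e 4`. If `e 0 = e 1`, this is the
whole plane. -/
def pinnedBox (e : Fin 5 → Plane) : Set Plane :=
  {q | along (e 0) (e 1) (e 2) ≤ along (e 0) (e 1) q ∧
    along (e 0) (e 1) q ≤ along (e 0) (e 1) (e 3) ∧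
    across (e 0) (e 1) (e 0) ≤ across (e 0) (e 1) q ∧
    across (e 0) (e 1) q ≤ across (e 0) (e 1) (e 4)}

/-- The width of `pinnedBox e`, in units of the length of the vector from `e 0` to `e 1`. -/
noncomputable def pinnedWidth (e : Fin 5 → Plane) : ℝ :=
  (along (e 0) (e 1) (e 3) - along (e 0) (e 1) (e 2)) / distSq (e 0) (e 1)

/-- The height of `pinnedBox e`, in units of the length of the vector from `e 0` to `e 1`. -/
noncomputable def pinnedHeight (e : Fin 5 → Plane) : ℝ :=
  (across (e 0) (e 1) (e 4) - across (e 0) (e 1) (e 0)) / distSq (e 0) (e 1)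

/-- The area of `pinnedBox e`. -/
noncomputable def pinnedArea (e : Fin 5 → Plane) : ℝ :=
  pinnedWidth e * pinnedHeight e * distSq (e 0) (e 1)

/-- The rectangle with region `pinnedBox e`. -/
noncomputable def pinnedRectangle (e : Fin 5 → Plane) : Rectangle where
  vertex := !₂[(along (e 0) (e 1) (e 2) * (e 1 0 - e 0 0) -
      across (e 0) (e 1) (e 0) * (e 1 1 - e 0 1)) / distSq (e 0) (e 1),
    (along (e 0) (e 1) (e 2) * (e 1 1 - e 0 1) +
      across (e 0) (e 1) (e 0) * (e 1 0 - e 0 0)) / distSq (e 0) (e 1)]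
  edge₁ := !₂[pinnedWidth e * (e 1 0 - e 0 0), pinnedWidth e * (e 1 1 - e 0 1)]
  edge₂ := !₂[pinnedHeight e * (e 0 1 - e 1 1), pinnedHeight e * (e 1 0 - e 0 0)]
  orthogonal := by
    simp [PiLp.inner_apply, Fin.sum_univ_two]
    ring

theorem norm_smul_eq (c x y : ℝ) : ‖(!₂[c * x, c * y] : Plane)‖ = |c| * √(x ^ 2 + y ^ 2) := by
  rw [EuclideanSpace.norm_eq, ← Real.sqrt_sq_eq_abs, ← Real.sqrt_mul (sq_nonneg c)]
  congr 1
  simp [Fin.sum_univ_two]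
  ring

section Pinned

variable {e : Fin 5 → Plane}

theorem pinnedRectangle_area (hD : 0 < distSq (e 0) (e 1))
    (hw : along (e 0) (e 1) (e 2) ≤ along (e 0) (e 1) (e 3))
    (hh : across (e 0) (e 1) (e 0) ≤ across (e 0) (e 1) (e 4)) :
    (pinnedRectangle e).area = pinnedArea e := by
  have h1 : 0 ≤ pinnedWidth e := div_nonneg (by linarith) hD.le
  have h2 : 0 ≤ pinnedHeight e := div_nonneg (by linarith) hD.le
  rw [Rectangle.area, pinnedRectangle, norm_smul_eq, norm_smul_eq, abs_of_nonneg h1,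
    abs_of_nonneg h2, add_comm ((e 0 1 - e 1 1) ^ 2), ← neg_sub (e 1 1), neg_sq, ← distSq,
    pinnedArea]
  linear_combination (pinnedWidth e * pinnedHeight e) * Real.mul_self_sqrt hD.le

theorem pinnedRectangle_region (hD : 0 < distSq (e 0) (e 1))
    (hw : along (e 0) (e 1) (e 2) ≤ along (e 0) (e 1) (e 3))
    (hh : across (e 0) (e 1) (e 0) ≤ across (e 0) (e 1) (e 4)) :
    (pinnedRectangle e).region = pinnedBox e := by
  have hD' := hD.ne'
  set D := distSq (e 0) (e 1) with hDdef
  set w := pinnedWidth e with hwdef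
  set h := pinnedHeight e with hhdef
  have hw' : along (e 0) (e 1) (e 3) = along (e 0) (e 1) (e 2) + w * D := by
    rw [hwdef, pinnedWidth, ← hDdef]; field_simp; ring
  have hh' : across (e 0) (e 1) (e 4) = across (e 0) (e 1) (e 0) + h * D := by
    rw [hhdef, pinnedHeight, ← hDdef]; field_simp; ring
  have hw0 : 0 ≤ w := div_nonneg (by linarith) hD.le
  have hh0 : 0 ≤ h := div_nonneg (by linarith) hD.le
  -- a coordinate in `[l, l + v D]` is `l + a v D` with `a` in the unit interval, also if `v = 0`
  have unit : ∀ {l x v : ℝ}, 0 ≤ v → l ≤ x → x ≤ l + v * D →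
      ∃ a ∈ Set.Icc (0 : ℝ) 1, x = l + a * v * D := by
    intro l x v hv h1 h2
    rcases hv.eq_or_lt with rfl | hv
    · exact ⟨0, by simp, by linarith⟩
    · refine ⟨(x - l) / (v * D), ⟨by apply div_nonneg <;> nlinarith, ?_⟩, by field_simp; ring⟩
      rw [div_le_one (by positivity)]; linarith
  ext q
  constructor
  · rintro ⟨a, ⟨ha0, ha1⟩, b, ⟨hb0, hb1⟩, rfl⟩
    have h1 : along (e 0) (e 1) ((pinnedRectangle e).vertex + a • (pinnedRectangle e).edge₁ +
        b • (pinnedRectangle e).edge₂) = along (e 0) (e 1) (e 2) + a * w * D := by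
      conv_lhs => rw [along]
      simp only [pinnedRectangle, PiLp.add_apply, PiLp.smul_apply, smul_eq_mul, ← hwdef, ← hhdef,
        ← hDdef]
      simp
      field_simp
      rw [hDdef, distSq]
      ring
    have h2 : across (e 0) (e 1) ((pinnedRectangle e).vertex + a • (pinnedRectangle e).edge₁ +
        b • (pinnedRectangle e).edge₂) = across (e 0) (e 1) (e 0) + b * h * D := by
      conv_lhs => rw [across]
      simp only [pinnedRectangle, PiLp.add_apply, PiLp.smul_apply, smul_eq_mul, ← hwdef, ← hhdef,
        ← hDdef]
      simp
      field_simp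
      rw [hDdef, distSq]
      ring
    have hwD : 0 ≤ w * D := by positivity
    have hhD : 0 ≤ h * D := by positivity
    refine ⟨?_, ?_, ?_, ?_⟩
    · rw [h1]; nlinarith
    · rw [h1, hw']; nlinarith
    · rw [h2]; nlinarith
    · rw [h2, hh']; nlinarith
  · rintro ⟨h1, h2, h3, h4⟩
    obtain ⟨a, ha, hax⟩ := unit hw0 h1 (hw' ▸ h2)
    obtain ⟨b, hb, hbx⟩ := unit hh0 h3 (hh' ▸ h4)
    refine ⟨a, ha, b, hb, ?_⟩
    have e1 : q 0 = (along (e 0) (e 1) q * (e 1 0 - e 0 0) -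
        across (e 0) (e 1) q * (e 1 1 - e 0 1)) / D := by
      rw [eq_div_iff hD', along, across, hDdef, distSq]; ring
    have e2 : q 1 = (along (e 0) (e 1) q * (e 1 1 - e 0 1) +
        across (e 0) (e 1) q * (e 1 0 - e 0 0)) / D := by
      rw [eq_div_iff hD', along, across, hDdef, distSq]; ring
    ext m
    fin_cases m
    · change q 0 = _
      rw [e1, hax, hbx]
      simp [pinnedRectangle, ← hwdef, ← hhdef, ← hDdef]
      field_simp
      ring
    · change q 1 = _
      rw [e2, hax, hbx]
      simp [pinnedRectangle, ← hwdef, ← hhdef, ← hDdef]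
      field_simp
      ring

/-- A pinned box with a point in it is the region of a rectangle: its sides are in order. -/
theorem pinnedRectangle_of_mem (hD : 0 < distSq (e 0) (e 1)) {q : Plane} (hq : q ∈ pinnedBox e) :
    (pinnedRectangle e).area = pinnedArea e ∧ (pinnedRectangle e).region = pinnedBox e :=
  ⟨pinnedRectangle_area hD (hq.1.trans hq.2.1) (hq.2.2.1.trans hq.2.2.2),
    pinnedRectangle_region hD (hq.1.trans hq.2.1) (hq.2.2.1.trans hq.2.2.2)⟩

end Pinned

/-! ### A minimum rectangle has two points on one side -/

/-- The linear functional with coefficients `d`. -/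
def lin (d : ℝ × ℝ) (q : Plane) : ℝ := d.1 * q 0 + d.2 * q 1

/-- The vector `d` turned by a right angle. -/
def perp (d : ℝ × ℝ) : ℝ × ℝ := (-d.2, d.1)

/-- The support function of a finite set of points. -/
noncomputable def support (Z : Finset Plane) (hZ : Z.Nonempty) (d : ℝ × ℝ) : ℝ :=
  Z.sup' hZ (lin d)

/-- The extent of a finite set of points in direction `d`, times the length of `d`. -/
noncomputable def extent (Z : Finset Plane) (hZ : Z.Nonempty) (d : ℝ × ℝ) : ℝ :=
  support Z hZ d + support Z hZ (-d)

section Extent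

variable {Z : Finset Plane} {hZ : Z.Nonempty}

theorem lin_neg (d : ℝ × ℝ) (q : Plane) : lin (-d) q = -lin d q := by
  simp [lin]; ring

theorem lin_le_support {z : Plane} (hz : z ∈ Z) (d : ℝ × ℝ) : lin d z ≤ support Z hZ d :=
  Finset.le_sup' (lin d) hz

theorem exists_support_eq (d : ℝ × ℝ) : ∃ z ∈ Z, support Z hZ d = lin d z :=
  Finset.exists_mem_eq_sup' hZ (lin d)

theorem support_le {d : ℝ × ℝ} {c : ℝ} (h : ∀ z ∈ Z, lin d z ≤ c) : support Z hZ d ≤ c :=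
  Finset.sup'_le hZ _ h

theorem sub_le_extent {y z : Plane} (hy : y ∈ Z) (hz : z ∈ Z) (d : ℝ × ℝ) :
    lin d y - lin d z ≤ extent Z hZ d := by
  have h1 := lin_le_support (hZ := hZ) hy d
  have h2 := lin_le_support (hZ := hZ) hz (-d)
  rw [lin_neg] at h2
  unfold extent
  linarith

theorem extent_le {d : ℝ × ℝ} {c : ℝ} (h : ∀ y ∈ Z, ∀ z ∈ Z, lin d y - lin d z ≤ c) :
    extent Z hZ d ≤ c := by
  obtain ⟨y, hy, hy'⟩ := exists_support_eq (hZ := hZ) d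
  obtain ⟨z, hz, hz'⟩ := exists_support_eq (hZ := hZ) (-d)
  rw [extent, hy', hz', lin_neg]
  linarith [h y hy z hz]

theorem extent_nonneg (d : ℝ × ℝ) : 0 ≤ extent Z hZ d := by
  obtain ⟨z, hz⟩ := hZ
  simpa using sub_le_extent (hZ := ⟨z, hz⟩) hz hz d

theorem extent_neg (d : ℝ × ℝ) : extent Z hZ (-d) = extent Z hZ d := by
  rw [extent, extent, neg_neg, add_comm]

theorem extent_smul {c : ℝ} (hc : 0 ≤ c) (d : ℝ × ℝ) :
    extent Z hZ (c • d) = c * extent Z hZ d := by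
  have hl : ∀ q, lin (c • d) q = c * lin d q := fun q => by simp [lin]; ring
  have hs : ∀ y ∈ Z, ∀ z ∈ Z, lin (c • d) y - lin (c • d) z ≤ c * extent Z hZ d := by
    intro y hy z hz
    rw [hl, hl, ← mul_sub]
    exact mul_le_mul_of_nonneg_left (sub_le_extent hy hz d) hc
  refine le_antisymm (extent_le hs) ?_
  obtain ⟨y, hy, hy'⟩ := exists_support_eq (hZ := hZ) d
  obtain ⟨z, hz, hz'⟩ := exists_support_eq (hZ := hZ) (-d)
  have := sub_le_extent (hZ := hZ) hy hz (c • d)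
  rw [hl, hl] at this
  rw [extent, hy', hz', lin_neg]
  linarith

theorem continuous_lin (q : Plane) : Continuous fun d => lin d q := by
  unfold lin; fun_prop

theorem continuous_support : Continuous (support Z hZ) := by
  unfold support
  exact Continuous.finset_sup'_apply hZ fun q _ => continuous_lin q

theorem continuous_extent : Continuous (extent Z hZ) :=
  continuous_support.add (continuous_support.comp continuous_neg)

/-- If only one point is extreme in direction `d`, it is also extreme in all nearby directions. -/
theorem eventually_support_eq {d : ℝ × ℝ} {P : Plane} (hP : P ∈ Z)
    (h : ∀ z ∈ Z, z ≠ P → lin d z < lin d P) :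
    ∀ᶠ v in nhds d, support Z hZ v = lin v P := by
  have : ∀ᶠ v in nhds d, ∀ z ∈ Z, lin v z ≤ lin v P := by
    rw [Filter.eventually_all_finset]
    intro z hz
    by_cases hzP : z = P
    · exact Filter.Eventually.of_forall fun v => by rw [hzP]
    · filter_upwards [(continuous_lin z).continuousAt.eventually_lt
        (continuous_lin P).continuousAt (h z hz hzP)] with v hv using hv.le
  filter_upwards [this] with v hv
  exact le_antisymm (support_le hv) (lin_le_support hP v)

end Extent

theorem not_eventually_area_le {w h a b : ℝ} (hw : 0 < w) (hh : 0 < h) :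
    ¬ ∀ᶠ s in nhds (0 : ℝ), w * h * (1 + s ^ 2) ≤ (w + s * a) * (h - s * b) := by
  intro H
  -- the first-order condition at the minimum `s = 0`
  have hc : a * h - w * b = 0 := by
    have hmin : IsLocalMin (fun s : ℝ => s * (a * h - w * b) - s ^ 2 * (a * b + w * h)) 0 := by
      filter_upwards [H] with s hs
      norm_num
      nlinarith
    have hd : HasDerivAt (fun s : ℝ => s * (a * h - w * b) - s ^ 2 * (a * b + w * h))
        (a * h - w * b) 0 := by
      have h1 := (hasDerivAt_id (0 : ℝ)).mul_const (a * h - w * b)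
      have h2 := (hasDerivAt_pow 2 (0 : ℝ)).mul_const (a * b + w * h)
      simpa using h1.fun_sub h2
    exact hmin.hasDerivAt_eq_zero hd
  obtain ⟨s, hs, hs0⟩ := (H.filter_mono nhdsWithin_le_nhds |>.and
    (self_mem_nhdsWithin : {(0 : ℝ)}ᶜ ∈ nhdsWithin 0 {0}ᶜ)).exists
  have hs2 : 0 < s ^ 2 := by
    have : s ≠ 0 := hs0
    positivity
  have hk : a * b + w * h ≤ 0 := by
    by_contra hk
    push Not at hk
    have h1 : s ^ 2 * (a * b + w * h) ≤ s * (a * h - w * b) := by linarith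
    rw [hc] at h1
    linarith [mul_pos hs2 hk]
  have : w * (a * b + w * h) = h * (a ^ 2 + w ^ 2) := by linear_combination -a * hc
  nlinarith [mul_pos hh (by positivity : 0 < a ^ 2 + w ^ 2), mul_nonneg hw.le (neg_nonneg.2 hk)]

section Flush

variable {Z : Finset Plane} {hZ : Z.Nonempty}

/-- Two points that are both extreme in some direction pin a rectangle around `Z` with a side
perpendicular to that direction. -/
theorem exists_pinned_of_tie {d : ℝ × ℝ} (hd : d.1 ^ 2 + d.2 ^ 2 = 1) {i j : Plane} (hi : i ∈ Z)
    (hj : j ∈ Z) (hij : i ≠ j) (hmin : ∀ z ∈ Z, lin d i ≤ lin d z) (htie : lin d i = lin d j) :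
    ∃ e : Fin 5 → Plane, (∀ m, e m ∈ Z) ∧ e 0 ≠ e 1 ∧ ↑Z ⊆ pinnedBox e ∧
      pinnedArea e ≤ extent Z hZ d * extent Z hZ (perp d) := by
  -- the vector from `i` to `j` is `ρ` times `perp d`; exchanging `i` and `j` makes `ρ` negative
  wlog hρ : lin (perp d) j - lin (perp d) i ≤ 0 generalizing i j
  · exact this hj hi hij.symm (htie ▸ hmin) htie.symm (by linarith)
  set ρ := lin (perp d) j - lin (perp d) i with hρdef
  simp only [lin, perp] at hρdef htie
  have hx : j 0 - i 0 = -ρ * d.2 := by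
    rw [hρdef]; linear_combination (-(j 0 - i 0)) * hd - d.1 * htie
  have hy : j 1 - i 1 = ρ * d.1 := by
    rw [hρdef]; linear_combination (-(j 1 - i 1)) * hd - d.2 * htie
  have hacross : ∀ q, across i j q = -ρ * lin d q := fun q => by
    rw [across, hx, hy, lin]; ring
  have halong : ∀ q, along i j q = ρ * lin (perp d) q := fun q => by
    rw [along, hx, hy, lin, perp]; ring
  have hD : distSq i j = ρ ^ 2 := by
    rw [distSq, hx, hy]; linear_combination ρ ^ 2 * hd
  have hD0 := distSq_pos hij
  have hρ0 : ρ ≠ 0 := by rintro h; simp [hD, h] at hD0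
  obtain ⟨a, ha, ha'⟩ := Finset.exists_min_image Z (along i j) hZ
  obtain ⟨b, hb, hb'⟩ := Finset.exists_max_image Z (along i j) hZ
  obtain ⟨c, hc, hc'⟩ := Finset.exists_max_image Z (across i j) hZ
  refine ⟨![i, j, a, b, c], ?_, hij, ?_, ?_⟩
  · intro m; fin_cases m <;> assumption
  · intro z hz
    refine ⟨ha' z hz, hb' z hz, ?_, hc' z hz⟩
    change across i j i ≤ across i j z
    rw [hacross, hacross]
    exact mul_le_mul_of_nonneg_left (hmin z hz) (by linarith)
  · have hA : pinnedArea ![i, j, a, b, c] =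
        (lin d c - lin d i) * (lin (perp d) a - lin (perp d) b) := by
      simp only [pinnedArea, pinnedWidth, pinnedHeight, Matrix.cons_val]
      rw [halong, halong, hacross, hacross, hD]
      field_simp
      ring
    rw [hA]
    refine mul_le_mul (sub_le_extent hc hi d) (sub_le_extent ha hb _) ?_ (extent_nonneg d)
    have := ha' b hb
    rw [halong, halong] at this
    nlinarith [lt_of_le_of_ne hρ hρ0]

/-- A rectangle is at least as large as the bounding box with the same orientation of the points
in it. -/
theorem exists_extent_le {R : Rectangle} (hR : ↑Z ⊆ R.region) :
    ∃ d : ℝ × ℝ, d.1 ^ 2 + d.2 ^ 2 = 1 ∧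
      extent Z hZ d * extent Z hZ (perp d) ≤ R.area := by
  obtain ⟨V, E, F, hEF⟩ := R
  have hEF' : E 0 * F 0 + E 1 * F 1 = 0 := by
    simpa [PiLp.inner_apply, Fin.sum_univ_two, mul_comm] using hEF
  have hsq : ∀ G : Plane, ‖G‖ ^ 2 = G 0 ^ 2 + G 1 ^ 2 := fun G => by
    rw [EuclideanSpace.norm_sq_eq, Fin.sum_univ_two]; simp
  -- a unit vector `d` such that the edges are `l d` and `m perp d`
  obtain ⟨d, l, m, hd, hE0, hE1, hF0, hF1⟩ : ∃ (d : ℝ × ℝ) (l m : ℝ), d.1 ^ 2 + d.2 ^ 2 = 1 ∧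
      E 0 = l * d.1 ∧ E 1 = l * d.2 ∧ F 0 = m * (-d.2) ∧ F 1 = m * d.1 := by
    by_cases hE : E = 0
    · subst hE
      by_cases hF : F = 0
      · subst hF
        exact ⟨(1, 0), 0, 0, by norm_num, by simp, by simp, by simp, by simp⟩
      · have hn := norm_ne_zero_iff.2 hF
        refine ⟨(F 1 / ‖F‖, -(F 0) / ‖F‖), 0, ‖F‖, ?_, by simp, by simp, ?_, ?_⟩
        · have := hsq F
          field_simp
          linarith
        · field_simp
        · field_simp
    · have hn := norm_ne_zero_iff.2 hE
      have := hsq E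
      refine ⟨(E 0 / ‖E‖, E 1 / ‖E‖), ‖E‖, (E 0 * F 1 - E 1 * F 0) / ‖E‖, ?_, ?_, ?_, ?_, ?_⟩
      · field_simp
        linarith
      · field_simp
      · field_simp
      · field_simp
        linear_combination F 0 * this + E 0 * hEF'
      · field_simp
        linear_combination F 1 * this + E 1 * hEF'
  have hnE : ‖E‖ = |l| := by
    rw [← abs_of_nonneg (norm_nonneg E), ← sq_eq_sq_iff_abs_eq_abs, hsq, hE0, hE1]
    linear_combination l ^ 2 * hd
  have hnF : ‖F‖ = |m| := by
    rw [← abs_of_nonneg (norm_nonneg F), ← sq_eq_sq_iff_abs_eq_abs, hsq, hF0, hF1]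
    linear_combination m ^ 2 * hd
  have unit : ∀ {a b c : ℝ}, a ∈ Set.Icc (0 : ℝ) 1 → b ∈ Set.Icc (0 : ℝ) 1 →
      (a - b) * c ≤ |c| := by
    rintro a b c ⟨ha0, ha1⟩ ⟨hb0, hb1⟩
    calc (a - b) * c ≤ |(a - b) * c| := le_abs_self _
      _ = |a - b| * |c| := abs_mul _ _
      _ ≤ 1 * |c| := by gcongr; rw [abs_le]; constructor <;> linarith
      _ = |c| := one_mul _
  refine ⟨d, hd, ?_⟩
  rw [Rectangle.area, hnE, hnF]
  refine mul_le_mul ?_ ?_ (extent_nonneg _) (abs_nonneg _)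
  · refine extent_le fun y hy z hz => ?_
    obtain ⟨a, ha, b, hb, rfl⟩ := hR hy
    obtain ⟨a', ha', b', hb', rfl⟩ := hR hz
    refine le_trans (le_of_eq ?_) (unit (c := l) ha ha')
    simp only [lin, PiLp.add_apply, PiLp.smul_apply, smul_eq_mul, hE0, hE1, hF0, hF1]
    linear_combination l * (a - a') * hd
  · refine extent_le fun y hy z hz => ?_
    obtain ⟨a, ha, b, hb, rfl⟩ := hR hy
    obtain ⟨a', ha', b', hb', rfl⟩ := hR hz
    refine le_trans (le_of_eq ?_) (unit (c := m) hb hb')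
    simp only [lin, perp, PiLp.add_apply, PiLp.smul_apply, smul_eq_mul, hE0, hE1, hF0, hF1]
    linear_combination m * (b - b') * hd

/-- If only one point were extreme in each of the four directions given by the sides of a bounding
box of minimum area, then rotating the box a little would reduce its area. -/
theorem exists_tie_of_minimal (hZ' : Z.Nontrivial) {d : ℝ × ℝ} (hd : d.1 ^ 2 + d.2 ^ 2 = 1)
    (hmin : ∀ v : ℝ × ℝ, v.1 ^ 2 + v.2 ^ 2 = 1 →
      extent Z hZ d * extent Z hZ (perp d) ≤ extent Z hZ v * extent Z hZ (perp v)) :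
    ∃ v ∈ ({d, -d, perp d, -perp d} : Set (ℝ × ℝ)), ∃ i ∈ Z, ∃ j ∈ Z, i ≠ j ∧
      (∀ z ∈ Z, lin v i ≤ lin v z) ∧ lin v i = lin v j := by
  by_contra hno
  have key : ∀ v ∈ ({d, -d, perp d, -perp d} : Set (ℝ × ℝ)), ∃ P ∈ Z,
      ∀ z ∈ Z, z ≠ P → lin v P < lin v z := by
    intro v hv
    obtain ⟨P, hP, hP'⟩ := Finset.exists_min_image Z (lin v) hZ
    refine ⟨P, hP, fun z hz hzP => lt_of_le_of_ne (hP' z hz) fun h => hno ?_⟩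
    exact ⟨v, hv, P, hP, z, hz, hzP.symm, hP', h⟩
  -- the points `P, Q` and `S, T` are extreme in the directions `d, -d` and `perp d, -perp d`
  obtain ⟨Q, hQ, hQ'⟩ := key d (by simp)
  obtain ⟨P, hP, hP'⟩ := key (-d) (by simp)
  obtain ⟨T, hT, hT'⟩ := key (perp d) (by simp)
  obtain ⟨S, hS, hS'⟩ := key (-perp d) (by simp)
  have pos : ∀ {v P Q}, (∀ z ∈ Z, z ≠ Q → lin v Q < lin v z) →
      (∀ z ∈ Z, z ≠ P → lin (-v) P < lin (-v) z) → 0 < lin v P - lin v Q := by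
    intro v P Q h1 h2
    simp only [lin_neg, neg_lt_neg_iff] at h2
    obtain ⟨y, hy, z, hz, hyz⟩ := hZ'
    obtain ⟨x, hx, hxQ⟩ : ∃ x ∈ Z, x ≠ Q := by
      by_cases h : y = Q
      · exact ⟨z, hz, fun h' => hyz (h.trans h'.symm)⟩
      · exact ⟨y, hy, h⟩
    have h3 := h1 x hx hxQ
    by_cases hxP : x = P
    · rw [← hxP]; linarith
    · linarith [h2 x hx hxP]
  have hw := pos hQ' hP'
  have hh := pos hT' hS'
  set c : ℝ → ℝ × ℝ := fun s => d + s • perp d with hcdef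
  have hc0 : c 0 = d := by simp [hcdef]
  have hcc : Continuous c := by simp only [hcdef]; fun_prop
  have hpc : Continuous fun s => perp (c s) := by
    simp only [hcdef, perp]
    fun_prop
  have ev : ∀ {v : ℝ → ℝ × ℝ} {P Q}, Continuous v → P ∈ Z → Q ∈ Z →
      (∀ z ∈ Z, z ≠ Q → lin (v 0) Q < lin (v 0) z) →
      (∀ z ∈ Z, z ≠ P → lin (-v 0) P < lin (-v 0) z) →
      ∀ᶠ s in nhds 0, extent Z hZ (v s) = lin (v s) P - lin (v s) Q := by
    intro v P Q hv hP hQ h1 h2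
    have e1 := eventually_support_eq (hZ := hZ) (d := v 0) hP fun z hz hzP => by
      have := h2 z hz hzP
      rwa [lin_neg, lin_neg, neg_lt_neg_iff] at this
    have e2 := eventually_support_eq (hZ := hZ) (d := -v 0) hQ fun z hz hzQ => by
      rw [lin_neg, lin_neg, neg_lt_neg_iff]
      exact h1 z hz hzQ
    filter_upwards [hv.continuousAt.eventually e1, hv.neg.continuousAt.eventually e2] with s h3 h4
    rw [extent, h3, show support Z hZ (-v s) = lin (-v s) Q from h4, lin_neg]
    ring
  have ev1 := ev hcc hP hQ (by rwa [hc0]) (by rwa [hc0])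
  have ev2 := ev hpc hS hT (by rwa [hc0]) (by rwa [hc0])
  have hd1 : extent Z hZ d = lin d P - lin d Q := by simpa [hc0] using ev1.self_of_nhds
  have hd2 : extent Z hZ (perp d) = lin (perp d) S - lin (perp d) T := by
    simpa [hc0] using ev2.self_of_nhds
  refine not_eventually_area_le hw hh (a := lin (perp d) P - lin (perp d) Q)
    (b := lin d S - lin d T) ?_
  filter_upwards [ev1, ev2] with s h1 h2
  have hn : (c s).1 ^ 2 + (c s).2 ^ 2 = 1 + s ^ 2 := by
    simp [hcdef, perp]
    linear_combination (1 + s ^ 2) * hd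
  have hpos : 0 < 1 + s ^ 2 := by positivity
  have hr : (√(1 + s ^ 2))⁻¹ ^ 2 * (1 + s ^ 2) = 1 := by
    rw [inv_pow, Real.sq_sqrt hpos.le, inv_mul_cancel₀ hpos.ne']
  have hperp : perp ((√(1 + s ^ 2))⁻¹ • c s) = (√(1 + s ^ 2))⁻¹ • perp (c s) := by
    simp [perp]
  have h3 := hmin ((√(1 + s ^ 2))⁻¹ • c s) (by
    simp only [Prod.smul_fst, Prod.smul_snd, smul_eq_mul]
    linear_combination (√(1 + s ^ 2))⁻¹ ^ 2 * hn + hr)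
  rw [hperp, extent_smul (by positivity), extent_smul (by positivity), hd1, hd2, h1, h2] at h3
  have h4 := mul_le_mul_of_nonneg_right h3 hpos.le
  refine h4.trans (le_of_eq ?_)
  have e1 : ∀ X, lin (c s) X = lin d X + s * lin (perp d) X := fun X => by
    simp [hcdef, lin, perp]; ring
  have e2 : ∀ X, lin (perp (c s)) X = lin (perp d) X - s * lin d X := fun X => by
    simp [hcdef, lin, perp]; ring
  simp only [e1, e2]
  linear_combination ((lin d P - lin d Q + s * (lin (perp d) P - lin (perp d) Q)) *
    (lin (perp d) S - lin (perp d) T - s * (lin d S - lin d T))) * hr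

/-- Among the rectangles that contain at least two given points, the smallest one can be chosen
pinned by five of the points. -/
theorem exists_pinned_area_le (hZ : Z.Nontrivial) {R : Rectangle} (hR : ↑Z ⊆ R.region) :
    ∃ e : Fin 5 → Plane, (∀ m, e m ∈ Z) ∧ e 0 ≠ e 1 ∧ ↑Z ⊆ pinnedBox e ∧
      pinnedArea e ≤ R.area := by
  obtain ⟨v, hv, hvR⟩ := exists_extent_le (hZ := hZ.nonempty) hR
  have hcpt : IsCompact {d : ℝ × ℝ | d.1 ^ 2 + d.2 ^ 2 = 1} := by
    refine (isCompact_Icc (a := ((-1, -1) : ℝ × ℝ)) (b := (1, 1))).of_isClosed_subset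
      (isClosed_eq (by fun_prop) (by fun_prop)) ?_
    rintro ⟨x, y⟩ (h : x ^ 2 + y ^ 2 = 1)
    refine ⟨⟨?_, ?_⟩, ?_, ?_⟩ <;> simp only <;> nlinarith [sq_nonneg x, sq_nonneg y]
  have hperp : Continuous perp := by unfold perp; fun_prop
  obtain ⟨d, hd, hmin⟩ := hcpt.exists_isMinOn ⟨v, hv⟩
    (f := fun d => extent Z hZ.nonempty d * extent Z hZ.nonempty (perp d))
    (continuous_extent.mul (continuous_extent.comp hperp)).continuousOn
  have hdR := (hmin hv).trans hvR
  have hpp : perp (perp d) = -d := rfl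
  have hpn : perp (-d) = -perp d := rfl
  have hd' : d.1 ^ 2 + d.2 ^ 2 = 1 := hd
  simp only at hdR
  obtain ⟨w, hw, i, hi, j, hj, hij, h1, h2⟩ := exists_tie_of_minimal hZ hd hmin
  have hw1 : w.1 ^ 2 + w.2 ^ 2 = 1 := by
    rcases hw with rfl | rfl | rfl | rfl
    · exact hd'
    · simpa using hd'
    · simpa [perp, add_comm] using hd'
    · simpa [perp, add_comm] using hd'
  obtain ⟨e, he1, he2, he3, he4⟩ := exists_pinned_of_tie (hZ := hZ.nonempty) hw1 hi hj hij h1 h2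
  refine ⟨e, he1, he2, he3, he4.trans (le_trans (le_of_eq ?_) hdR)⟩
  have hpnp : perp (-perp d) = d := by simp [perp]
  rcases hw with rfl | rfl | rfl | rfl
  · rfl
  · rw [hpn, extent_neg, extent_neg]
  · rw [hpp, extent_neg, mul_comm]
  · rw [hpnp, extent_neg, mul_comm]

end Flush

/-! ### The optimal area -/

theorem Rectangle.area_nonneg (R : Rectangle) : 0 ≤ R.area :=
  mul_nonneg (norm_nonneg _) (norm_nonneg _)

theorem optArea_nonneg (X : Finset Plane) (t : ℕ) : 0 ≤ optArea X t := by
  refine Real.sInf_nonneg ?_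
  rintro _ ⟨R, -, rfl⟩
  exact R.area_nonneg

theorem optArea_le {X : Finset Plane} {t : ℕ} {R : Rectangle} (h : X.card ≤ R.enclosed X + t) :
    optArea X t ≤ R.area := by
  refine csInf_le ⟨0, ?_⟩ ⟨R, h, rfl⟩
  rintro _ ⟨R, -, rfl⟩
  exact R.area_nonneg

theorem Rectangle.exists_coe_subset_region (s : Finset Plane) :
    ∃ R : Rectangle, ↑s ⊆ R.region := by
  obtain ⟨r, hr, hr'⟩ : ∃ r : ℝ, 0 < r ∧ ∀ z ∈ s, ∀ m, |z m| ≤ r := by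
    obtain ⟨r, hr⟩ := (s.finite_toSet.isBounded).exists_norm_le
    refine ⟨max r 1, by positivity, fun z hz m => ?_⟩
    have h1 : ‖z m‖ ≤ ‖z‖ := PiLp.norm_apply_le z m
    rw [Real.norm_eq_abs] at h1
    exact (h1.trans (hr z hz)).trans (le_max_left _ _)
  refine ⟨⟨!₂[-r, -r], !₂[2 * r, 0], !₂[0, 2 * r], by
    simp [PiLp.inner_apply, Fin.sum_univ_two]⟩, fun z hz => ?_⟩
  have h0 := abs_le.1 (hr' z hz 0)
  have h1 := abs_le.1 (hr' z hz 1)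
  refine ⟨(z 0 + r) / (2 * r), ⟨by apply div_nonneg <;> linarith, ?_⟩,
    (z 1 + r) / (2 * r), ⟨by apply div_nonneg <;> linarith, ?_⟩, ?_⟩
  · rw [div_le_one (by linarith)]; linarith
  · rw [div_le_one (by linarith)]; linarith
  · ext m
    fin_cases m
    · change z 0 = _
      simp; field_simp; ring
    · change z 1 = _
      simp; field_simp; ring

/-- The minimum area is attained: only the finitely many rectangles pinned by points of `X`
compete. -/
theorem exists_area_le_optArea {X : Finset Plane} {t : ℕ} (h : t + 2 ≤ X.card) :
    ∃ R : Rectangle, X.card ≤ R.enclosed X + t ∧ R.area ≤ optArea X t := by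
  classical
  have pin : ∀ R : Rectangle, X.card ≤ R.enclosed X + t →
      ∃ e ∈ Fintype.piFinset fun _ : Fin 5 => X,
        X.card ≤ (pinnedRectangle e).enclosed X + t ∧ (pinnedRectangle e).area ≤ R.area := by
    intro R hR
    have hfin : ((X : Set Plane) ∩ R.region).Finite := X.finite_toSet.inter_of_left _
    have hcard : hfin.toFinset.card = R.enclosed X := (Set.ncard_eq_toFinset_card _ hfin).symm
    have hnt : hfin.toFinset.Nontrivial := by
      rw [← Finset.one_lt_card_iff_nontrivial]; omega
    obtain ⟨e, he, hne, hbox, harea⟩ := exists_pinned_area_le (R := R) hnt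
      fun z hz => by simp at hz; exact hz.2
    have hm := pinnedRectangle_of_mem (distSq_pos hne) (hbox (he 0))
    have heX : ∀ m, e m ∈ X := fun m => by
      have := he m
      simp at this
      exact this.1
    refine ⟨e, by simpa using heX, hR.trans ?_, hm.1 ▸ harea⟩
    gcongr
    unfold Rectangle.enclosed
    refine Set.ncard_le_ncard (fun z hz => ⟨hz.1, ?_⟩) (X.finite_toSet.inter_of_left _)
    rw [hm.2]
    exact hbox (by simpa using hz)
  obtain ⟨R₀, hR₀⟩ := Rectangle.exists_coe_subset_region X
  have hR₀' : X.card ≤ R₀.enclosed X + t := by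
    rw [Rectangle.enclosed, Set.inter_eq_left.2 hR₀, Set.ncard_coe_finset]
    omega
  obtain ⟨e₀, he₀, he₀', -⟩ := pin R₀ hR₀'
  obtain ⟨e, he, hmin⟩ := Finset.exists_min_image
    ((Fintype.piFinset fun _ : Fin 5 => X).filter fun e =>
      X.card ≤ (pinnedRectangle e).enclosed X + t)
    (fun e => (pinnedRectangle e).area) ⟨e₀, by simp only [Finset.mem_filter]; exact ⟨he₀, he₀'⟩⟩
  rw [Finset.mem_filter] at he
  refine ⟨pinnedRectangle e, he.2, le_csInf ⟨_, R₀, hR₀', rfl⟩ ?_⟩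
  rintro _ ⟨R, hR, rfl⟩
  obtain ⟨e', he', h1, h2⟩ := pin R hR
  exact (hmin e' (by simp only [Finset.mem_filter]; exact ⟨he', h1⟩)).trans h2

theorem NoThreeCollinear.card_le_two {X Y : Finset Plane} (hX : NoThreeCollinear X) (hY : Y ⊆ X)
    (h : Collinear ℝ (Y : Set Plane)) : Y.card ≤ 2 := by
  by_contra! hc
  obtain ⟨a, b, c, ha, hb, hc, hab, hac, hbc⟩ := Finset.two_lt_card_iff.1 hc
  refine hX a (hY ha) b (hY hb) c (hY hc) hab hac hbc (h.subset ?_)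
  rintro _ (rfl | rfl | rfl) <;> assumption

/-- In general position, a rectangle of at most the optimal area encloses at most `|X| - t + 1`
points: a side carries at most two points, and moving it inwards to free these two makes the area
smaller. -/
theorem enclosed_le_of_area_le {X : Finset Plane} {t : ℕ} (hX : NoThreeCollinear X)
    (ht : t < X.card) {R : Rectangle} (hR : R.area ≤ optArea X t) :
    R.enclosed X + t ≤ X.card + 1 := by
  classical
  by_contra! hc
  have hfin : ((X : Set Plane) ∩ R.region).Finite := X.finite_toSet.inter_of_left _
  set Y := hfin.toFinset with hY
  have hcard : Y.card = R.enclosed X := (Set.ncard_eq_toFinset_card _ hfin).symm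
  have hYX : Y ⊆ X := fun z hz => by simp [hY] at hz; exact hz.1
  have hYR : ∀ z ∈ Y, ∃ a b : ℝ, a ∈ Set.Icc (0 : ℝ) 1 ∧ b ∈ Set.Icc (0 : ℝ) 1 ∧
      z = R.vertex + a • R.edge₁ + b • R.edge₂ := fun z hz => by
    simp only [hY, Set.Finite.mem_toFinset] at hz
    obtain ⟨-, a, ha, b, hb, h⟩ := hz
    exact ⟨a, b, ha, hb, h⟩
  choose! α β hα hβ hz using hYR
  -- at most two points lie on a line parallel to the second edge
  have line : ∀ s : Finset Plane, s ⊆ Y → ∀ x, (∀ z ∈ s, α z = x ∨ R.edge₁ = 0) → s.card ≤ 2 := by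
    intro s hs x hx
    refine hX.card_le_two (hs.trans hYX) ?_
    rw [collinear_iff_exists_forall_eq_smul_vadd]
    refine ⟨R.vertex + x • R.edge₁, R.edge₂, fun z hzs => ⟨β z, ?_⟩⟩
    conv_lhs => rw [hz z (hs hzs)]
    rw [vadd_eq_add, add_comm (β z • _)]
    rcases hx z hzs with h | h
    · rw [h]
    · rw [h]; simp
  have hE : R.edge₁ ≠ 0 := fun h => by
    have := line Y subset_rfl 0 fun z _ => Or.inr h
    omega
  have hF : R.edge₂ ≠ 0 := fun h => by
    have : Y.card ≤ 2 := by
      refine hX.card_le_two hYX ?_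
      rw [collinear_iff_exists_forall_eq_smul_vadd]
      refine ⟨R.vertex, R.edge₁, fun z hzs => ⟨α z, ?_⟩⟩
      conv_lhs => rw [hz z hzs]
      rw [h, smul_zero, add_zero, vadd_eq_add, add_comm]
    omega
  obtain ⟨z₁, hz₁, hmax⟩ := Finset.exists_max_image Y α (Finset.card_pos.1 (by omega))
  have hle := line (Y.filter fun z => α z = α z₁) (Finset.filter_subset _ _) (α z₁)
    fun z hz => Or.inl (Finset.mem_filter.1 hz).2
  set Y' := Y.filter fun z => ¬ α z = α z₁ with hY'
  have hsum : (Y.filter fun z => α z = α z₁).card + Y'.card = Y.card :=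
    Finset.card_filter_add_card_filter_not _
  obtain ⟨z₂, hz₂, hmax'⟩ := Finset.exists_max_image Y' α (Finset.card_pos.1 (by omega))
  rw [hY', Finset.mem_filter] at hz₂
  have hlt : α z₂ < 1 := (lt_of_le_of_ne (hmax z₂ hz₂.1) hz₂.2).trans_le (hα z₁ hz₁).2
  let R' : Rectangle := ⟨R.vertex, α z₂ • R.edge₁, R.edge₂, by
    rw [real_inner_smul_left, R.orthogonal, mul_zero]⟩
  have henc : Y'.card ≤ R'.enclosed X := by
    rw [Rectangle.enclosed, ← Set.ncard_coe_finset]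
    refine Set.ncard_le_ncard (fun z hz' => ?_) (X.finite_toSet.inter_of_left _)
    have hzY : z ∈ Y := (Finset.mem_filter.1 hz').1
    refine ⟨hYX hzY, α z / α z₂, ⟨div_nonneg (hα z hzY).1 (hα z₂ hz₂.1).1,
      div_le_one_of_le₀ (hmax' z hz') (hα z₂ hz₂.1).1⟩, β z, hβ z hzY, ?_⟩
    conv_lhs => rw [hz z hzY]
    simp only [R', smul_smul]
    congr 3
    by_cases h0 : α z₂ = 0
    · have := hmax' z hz'
      rw [h0] at this ⊢
      rw [le_antisymm this (hα z hzY).1]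
      simp
    · field_simp
  have hopt := hR.trans (optArea_le (X := X) (t := t) (R := R') (by omega))
  have h1 : 0 < ‖R.edge₁‖ * ‖R.edge₂‖ := mul_pos (norm_pos_iff.2 hE) (norm_pos_iff.2 hF)
  simp only [Rectangle.area, R', norm_smul, Real.norm_eq_abs, abs_of_nonneg (hα z₂ hz₂.1).1]
    at hopt
  nlinarith

/-! ### Samples with replacement -/

section Sampling

variable {n s : ℕ}

open Finset in
/-- Chernoff's bound for the number of samples `f` of size `s` for which a statistic of the
positions in `K` is large. -/
theorem card_le_exp_mul (K : Finset (Fin s)) {h : Fin n → ℝ} {γ : ℝ} (β : ℝ)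
    (hh : ∑ j, Real.exp (h j) ≤ n * Real.exp γ) :
    ((univ.filter fun f : Fin s → Fin n => β ≤ ∑ i ∈ K, h (f i)).card : ℝ) ≤
      Real.exp (γ * K.card - β) * (n : ℝ) ^ s := by
  have h1 : ((univ.filter fun f : Fin s → Fin n => β ≤ ∑ i ∈ K, h (f i)).card : ℝ) * Real.exp β ≤
      ∑ f : Fin s → Fin n, ∏ i, if i ∈ K then Real.exp (h (f i)) else 1 := by
    rw [← nsmul_eq_mul, ← sum_const]
    refine (sum_le_sum fun f hf => ?_).trans (sum_le_sum_of_subset_of_nonneg (filter_subset _ _)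
      fun f _ _ => prod_nonneg fun i _ => by split_ifs <;> positivity)
    rw [prod_ite_mem, univ_inter, ← Real.exp_sum]
    exact Real.exp_le_exp.2 (mem_filter.1 hf).2
  have h2 : ∑ f : Fin s → Fin n, ∏ i, (if i ∈ K then Real.exp (h (f i)) else 1) ≤
      Real.exp (γ * K.card) * (n : ℝ) ^ s := by
    rw [← Fintype.piFinset_univ, ← prod_univ_sum (fun _ : Fin s => univ)
      (fun i j => if i ∈ K then Real.exp (h j) else 1)]
    calc ∏ i : Fin s, ∑ j : Fin n, (if i ∈ K then Real.exp (h j) else 1)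
        ≤ ∏ i : Fin s, (n * if i ∈ K then Real.exp γ else 1) := by
          refine prod_le_prod (fun i _ => sum_nonneg fun j _ => by split_ifs <;> positivity)
            fun i _ => ?_
          split_ifs
          · exact hh
          · simp
      _ = Real.exp (γ * K.card) * (n : ℝ) ^ s := by
          rw [prod_mul_distrib, prod_ite_mem, univ_inter, prod_const, prod_const,
            ← Real.exp_nat_mul, card_univ, Fintype.card_fin]
          ring_nf
  rw [Real.exp_sub, div_mul_eq_mul_div, le_div_iff₀ (Real.exp_pos β)]
  exact h1.trans h2

open Finset in
theorem sum_ite_mem_eq (K : Finset (Fin s)) (A : Finset (Fin n)) (f : Fin s → Fin n) (c : ℝ) :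
    ∑ i ∈ K, (if f i ∈ A then c else 0) = (K.filter fun i => f i ∈ A).card * c := by
  rw [sum_ite, sum_const, sum_const_zero, add_zero, nsmul_eq_mul]

open Finset in
/-- Few samples miss a large set. -/
theorem card_miss_le (K : Finset (Fin s)) {A : Finset (Fin n)} {δ : ℝ} (hA : δ * n ≤ A.card) :
    ((univ.filter fun f : Fin s → Fin n => ∀ i ∈ K, f i ∉ A).card : ℝ) ≤
      Real.exp (-(δ * K.card / 2)) * (n : ℝ) ^ s := by
  have h := card_le_exp_mul (n := n) K (h := fun j => if j ∈ Aᶜ then Real.log 2 else 0)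
    (γ := Real.log 2 - δ / 2) (K.card * Real.log 2) (by
      have h1 : ∀ j : Fin n, Real.exp (if j ∈ Aᶜ then Real.log 2 else 0) =
          2 - if j ∈ A then 1 else 0 := by
        intro j
        by_cases hj : j ∈ A
        · simp [hj]; norm_num
        · simp [hj, Real.exp_log]
      simp only [h1, sum_sub_distrib, sum_const, sum_ite_mem, univ_inter, card_univ,
        Fintype.card_fin, nsmul_eq_mul, mul_one]
      rw [sub_eq_add_neg (Real.log 2), Real.exp_add, Real.exp_log two_pos]
      have h2 := Real.add_one_le_exp (-(δ / 2))
      have : (n : ℝ) * (2 * (-(δ / 2) + 1)) ≤ n * (2 * Real.exp (-(δ / 2))) := by gcongr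
      linarith)
  refine le_trans ?_ (h.trans (le_of_eq ?_))
  · gcongr with f
    intro hf
    rw [sum_ite_mem_eq, filter_true_of_mem fun i hi => by simpa using hf i hi]
  · ring_nf

open Finset in
/-- Few samples hit a small set often. -/
theorem card_often_le (K : Finset (Fin s)) {A : Finset (Fin n)} {ρ δ : ℝ} (hδ : 0 ≤ δ)
    (hρ : 0 ≤ ρ) (hA : A.card ≤ ρ * n) :
    ((univ.filter fun f : Fin s → Fin n =>
      4 * K.card * (ρ + δ) ≤ (K.filter fun i => f i ∈ A).card).card : ℝ) ≤
      Real.exp (-(δ * K.card / 2)) * (n : ℝ) ^ s := by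
  have hlog : 1 / 2 < Real.log 2 := by linarith [Real.log_two_gt_d9]
  have h := card_le_exp_mul (n := n) K (h := fun j => if j ∈ A then Real.log 2 else 0)
    (γ := ρ) (4 * K.card * (ρ + δ) * Real.log 2) (by
      have h1 : ∀ j : Fin n, Real.exp (if j ∈ A then Real.log 2 else 0) =
          1 + if j ∈ A then 1 else 0 := by
        intro j
        by_cases hj : j ∈ A
        · simp [hj, Real.exp_log]; norm_num
        · simp [hj]
      simp only [h1, sum_add_distrib, sum_const, sum_ite_mem, univ_inter, card_univ,
        Fintype.card_fin, nsmul_eq_mul, mul_one]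
      have : (n : ℝ) * (ρ + 1) ≤ n * Real.exp ρ := by gcongr; exact Real.add_one_le_exp ρ
      linarith)
  refine le_trans ?_ (h.trans ?_)
  · refine Nat.cast_le.2 (card_le_card fun f hf => ?_)
    rw [mem_filter] at hf ⊢
    rw [sum_ite_mem_eq]
    exact ⟨hf.1, mul_le_mul_of_nonneg_right hf.2 (by linarith)⟩
  · gcongr
    have h2 : 0 ≤ (K.card : ℝ) * (ρ + δ) := by positivity
    have h3 : 0 ≤ (K.card : ℝ) * δ := by positivity
    have h4 : 0 ≤ (K.card : ℝ) * ρ := by positivity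
    nlinarith

open Finset in
/-- For few samples, the frequency of a set deviates much from its density. -/
theorem card_deviate_le (hn : 0 < n) (A : Finset (Fin n)) {δ : ℝ} (hδ : 0 ≤ δ) (hδ' : δ ≤ 1) :
    ((univ.filter fun f : Fin s → Fin n =>
      δ * n * s ≤ |((univ.filter fun i => f i ∈ A).card : ℝ) * n - A.card * s|).card : ℝ) ≤
      2 * Real.exp (-(δ ^ 2 * s / 4)) * (n : ℝ) ^ s := by
  have hn' : (0 : ℝ) < n := by exact_mod_cast hn
  set d : ℝ := A.card / n with hd
  have hdn : d * n = A.card := by rw [hd]; field_simp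
  have hd0 : 0 ≤ d := by positivity
  have hd1 : d ≤ 1 := by
    rw [hd, div_le_one hn']
    exact_mod_cast (card_le_univ A).trans_eq (Fintype.card_fin n)
  -- the bound for both tails: `c = δ / 2` and `c = - δ / 2`
  have tail : ∀ c : ℝ, |c| = δ / 2 → ((univ.filter fun f : Fin s → Fin n =>
      δ ^ 2 / 2 * s ≤ ∑ i, c * ((if f i ∈ A then 1 else 0) - d)).card : ℝ) ≤
      Real.exp (-(δ ^ 2 * s / 4)) * (n : ℝ) ^ s := by
    intro c hc
    have hc2 : c ^ 2 = δ ^ 2 / 4 := by rw [← sq_abs, hc]; ring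
    have h := card_le_exp_mul (n := n) (univ : Finset (Fin s))
      (h := fun j => c * ((if j ∈ A then 1 else 0) - d)) (γ := δ ^ 2 / 4) (δ ^ 2 / 2 * s) (by
        have h1 : ∀ j : Fin n, Real.exp (c * ((if j ∈ A then 1 else 0) - d)) ≤
            1 + c ^ 2 + c * ((if j ∈ A then 1 else 0) - d) := by
          intro j
          have hx : |(if j ∈ A then 1 else 0) - d| ≤ 1 := by
            rw [abs_le]; split_ifs <;> constructor <;> linarith
          have hcx : |c * ((if j ∈ A then 1 else 0) - d)| ≤ 1 := by
            rw [abs_mul, hc]; nlinarith [abs_nonneg ((if j ∈ A then 1 else 0) - d)]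
          have h2 := (abs_le.1 (Real.abs_exp_sub_one_sub_id_le hcx)).2
          have h3 : ((if j ∈ A then 1 else 0) - d) ^ 2 ≤ 1 := by
            rw [← sq_abs]; nlinarith [abs_nonneg ((if j ∈ A then 1 else 0) - d)]
          nlinarith [sq_nonneg c]
        refine (sum_le_sum fun j _ => h1 j).trans ?_
        rw [sum_add_distrib, ← mul_sum, sum_sub_distrib]
        simp only [sum_const, sum_ite_mem, univ_inter, card_univ, Fintype.card_fin, nsmul_eq_mul,
          mul_one]
        have : (n : ℝ) * (δ ^ 2 / 4 + 1) ≤ n * Real.exp (δ ^ 2 / 4) := by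
          gcongr; exact Real.add_one_le_exp _
        rw [hc2]
        linear_combination this - c * hdn)
    refine h.trans (le_of_eq ?_)
    rw [card_univ, Fintype.card_fin]
    ring_nf
  have hsum : ∀ (f : Fin s → Fin n) (c : ℝ), ∑ i, c * ((if f i ∈ A then 1 else 0) - d) =
      c * ((univ.filter fun i => f i ∈ A).card - s * d) := fun f c => by
    rw [← mul_sum, sum_sub_distrib, sum_ite_mem_eq]
    simp
  have hsub : (univ.filter fun f : Fin s → Fin n =>
      δ * n * s ≤ |((univ.filter fun i => f i ∈ A).card : ℝ) * n - A.card * s|) ⊆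
      (univ.filter fun f : Fin s → Fin n =>
        δ ^ 2 / 2 * s ≤ ∑ i, δ / 2 * ((if f i ∈ A then 1 else 0) - d)) ∪
      (univ.filter fun f : Fin s → Fin n =>
        δ ^ 2 / 2 * s ≤ ∑ i, -(δ / 2) * ((if f i ∈ A then 1 else 0) - d)) := by
    intro f hf
    rw [mem_union, mem_filter, mem_filter, hsum, hsum]
    have h1 := (mem_filter.1 hf).2
    have h2 : ((univ.filter fun i => f i ∈ A).card : ℝ) * n - A.card * s =
        ((univ.filter fun i => f i ∈ A).card - s * d) * n := by rw [← hdn]; ring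
    rw [h2, abs_mul, abs_of_pos hn', mul_right_comm, mul_le_mul_iff_left₀ hn'] at h1
    rcases le_abs.1 h1 with h | h
    · exact Or.inl ⟨mem_univ _, by nlinarith⟩
    · exact Or.inr ⟨mem_univ _, by nlinarith⟩
  have h1 : ((univ.filter fun f : Fin s → Fin n =>
      δ * n * s ≤ |((univ.filter fun i => f i ∈ A).card : ℝ) * n - A.card * s|).card : ℝ) ≤ _ :=
    (Nat.cast_le.2 ((card_le_card hsub).trans (card_union_le _ _))).trans_eq (Nat.cast_add _ _)
  have h2 := tail (δ / 2) (abs_of_nonneg (by linarith))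
  have h3 := tail (-(δ / 2)) (by rw [abs_neg, abs_of_nonneg (by linarith)])
  linarith

open Finset Classical in
/-- A sample `f` of the points `p` that represents well the points with indices in `Y`: the
positions in `K` form a net, and all positions together estimate the content of every pinned box. -/
structure Typical (p : Fin n → Plane) (Y : Finset (Fin n)) (K : Finset (Fin s)) (ρ δ : ℝ)
    (f : Fin s → Fin n) : Prop where
  /-- the net hits every set of the form `Y` minus a pinned box with more than `δ n` points -/
  hits : ∀ e : Fin 5 → Fin n, (∀ i ∈ K, f i ∈ Y → p (f i) ∈ pinnedBox (p ∘ e)) →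
    ((Y.filter fun q => p q ∉ pinnedBox (p ∘ e)).card : ℝ) < δ * n
  /-- the net contains several points of `Y` -/
  several : ∀ q, ∃ i ∈ K, f i ∈ Y ∧ f i ≠ q
  /-- few points of the net lie outside of `Y` -/
  few : ((K.filter fun i => f i ∉ Y).card : ℝ) < 4 * K.card * (ρ + δ)
  /-- the sample estimates the number of points in each pinned box -/
  estimates : ∀ e : Fin 5 → Fin n,
    |((univ.filter fun i => p (f i) ∈ pinnedBox (p ∘ e)).card : ℝ) * n -
      (univ.filter fun q => p q ∈ pinnedBox (p ∘ e)).card * s| < δ * n * s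

open Finset Classical in
/-- Most samples are typical. -/
theorem card_not_typical_le (hn : 2 ≤ n) (p : Fin n → Plane) {Y : Finset (Fin n)}
    {K : Finset (Fin s)} {ρ δ : ℝ} (hδ : 0 ≤ δ) (hδ' : δ ≤ 1) (hρ : 0 ≤ ρ)
    (hY : (Yᶜ.card : ℝ) ≤ ρ * n) (hY' : ∀ q, δ * n ≤ (Y.erase q).card)
    (hK : 14 * Real.log n ≤ δ * K.card) (hs : 28 * Real.log n ≤ δ ^ 2 * s) :
    ((univ.filter fun f : Fin s → Fin n => ¬ Typical p Y K ρ δ f).card : ℝ) ≤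
      3 / n * (n : ℝ) ^ s := by
  have hn' : (2 : ℝ) ≤ n := by exact_mod_cast hn
  have hN : (0 : ℝ) < n := by linarith
  set η : ℝ := ((n : ℝ) ^ 7)⁻¹ with hη
  have hexp : Real.exp (-(7 * Real.log n)) = η := by
    rw [Real.exp_neg, hη]
    congr 1
    rw [show (7 : ℝ) = ((7 : ℕ) : ℝ) by norm_num, Real.exp_nat_mul, Real.exp_log hN]
  have hK' : Real.exp (-(δ * K.card / 2)) ≤ η := by
    rw [← hexp]; exact Real.exp_le_exp.2 (by linarith)
  have hs' : Real.exp (-(δ ^ 2 * s / 4)) ≤ η := by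
    rw [← hexp]; exact Real.exp_le_exp.2 (by linarith)
  set N : ℝ := (n : ℝ) ^ s with hNdef
  have hN0 : 0 ≤ N := by positivity
  set E := (univ : Finset (Fin 5 → Fin n)).filter fun e =>
    δ * n ≤ (Y.filter fun q => p q ∉ pinnedBox (p ∘ e)).card with hE
  set B₁ := E.biUnion fun e => univ.filter fun f : Fin s → Fin n =>
    ∀ i ∈ K, f i ∉ Y.filter fun q => p q ∉ pinnedBox (p ∘ e) with hB₁
  set B₂ := (univ : Finset (Fin n)).biUnion fun q => univ.filter fun f : Fin s → Fin n =>
    ∀ i ∈ K, f i ∉ Y.erase q with hB₂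
  set B₃ := univ.filter fun f : Fin s → Fin n =>
    4 * K.card * (ρ + δ) ≤ (K.filter fun i => f i ∈ Yᶜ).card with hB₃
  set B₄ := (univ : Finset (Fin 5 → Fin n)).biUnion fun e => univ.filter fun f : Fin s → Fin n =>
    δ * n * s ≤ |((univ.filter fun i =>
      f i ∈ univ.filter fun q => p q ∈ pinnedBox (p ∘ e)).card : ℝ) * n -
      (univ.filter fun q => p q ∈ pinnedBox (p ∘ e)).card * s| with hB₄
  have cardE : Fintype.card (Fin 5 → Fin n) = n ^ 5 := by simp
  have union : ∀ {ι : Type} (S : Finset ι) (F : ι → Finset (Fin s → Fin n)) (c : ℝ),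
      (∀ x ∈ S, ((F x).card : ℝ) ≤ c) → ((S.biUnion F).card : ℝ) ≤ S.card * c := by
    intro ι S F c hF
    calc ((S.biUnion F).card : ℝ) ≤ ∑ x ∈ S, ((F x).card : ℝ) := by exact_mod_cast card_biUnion_le
      _ ≤ S.card * c := by rw [← nsmul_eq_mul]; exact sum_le_card_nsmul _ _ _ hF
  have c₁ : (B₁.card : ℝ) ≤ (n : ℝ) ^ 5 * (η * N) := by
    refine (union E _ (η * N) fun e he => (card_miss_le K (mem_filter.1 he).2).trans ?_).trans ?_
    · gcongr
    · gcongr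
      exact_mod_cast (card_le_univ E).trans_eq cardE
  have c₂ : (B₂.card : ℝ) ≤ n * (η * N) := by
    refine (union univ _ (η * N) fun q _ => (card_miss_le K (hY' q)).trans ?_).trans_eq ?_
    · gcongr
    · rw [card_univ, Fintype.card_fin]
  have c₃ : (B₃.card : ℝ) ≤ η * N := by
    refine (card_often_le K hδ hρ hY).trans ?_
    gcongr
  have c₄ : (B₄.card : ℝ) ≤ (n : ℝ) ^ 5 * (2 * η * N) := by
    refine (union univ _ (2 * η * N) fun e _ =>
      (card_deviate_le (by omega) _ hδ hδ').trans ?_).trans_eq ?_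
    · gcongr
    · rw [card_univ, cardE]; push_cast; ring
  have hsub : (univ.filter fun f : Fin s → Fin n => ¬ Typical p Y K ρ δ f) ⊆
      B₁ ∪ B₂ ∪ B₃ ∪ B₄ := by
    intro f hf
    by_contra hc
    simp only [mem_union, not_or] at hc
    obtain ⟨⟨⟨h₁, h₂⟩, h₃⟩, h₄⟩ := hc
    refine (mem_filter.1 hf).2 ⟨?_, ?_, ?_, ?_⟩
    · intro e he
      by_contra! hlt
      refine h₁ (mem_biUnion.2 ⟨e, mem_filter.2 ⟨mem_univ _, hlt⟩, mem_filter.2 ⟨mem_univ _, ?_⟩⟩)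
      intro i hi hif
      exact (mem_filter.1 hif).2 (he i hi (mem_filter.1 hif).1)
    · intro q
      by_contra! hq
      refine h₂ (mem_biUnion.2 ⟨q, mem_univ _, mem_filter.2 ⟨mem_univ _, ?_⟩⟩)
      intro i hi hif
      exact (mem_erase.1 hif).1 (hq i hi (mem_erase.1 hif).2)
    · by_contra! h
      refine h₃ (mem_filter.2 ⟨mem_univ _, ?_⟩)
      simpa only [mem_compl] using h
    · intro e
      by_contra! h
      refine h₄ (mem_biUnion.2 ⟨e, mem_univ _, mem_filter.2 ⟨mem_univ _, ?_⟩⟩)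
      simpa only [mem_filter, mem_univ, true_and] using h
  have hcard : ((univ.filter fun f : Fin s → Fin n => ¬ Typical p Y K ρ δ f).card : ℝ) ≤
      B₁.card + B₂.card + B₃.card + B₄.card := by
    exact_mod_cast (card_le_card hsub).trans ((card_union_le _ _).trans (add_le_add_left
      ((card_union_le _ _).trans (add_le_add_left (card_union_le _ _) _)) _))
  have hη0 : 0 ≤ η * N := by positivity
  have hη5 : (n : ℝ) ^ 5 * η = ((n : ℝ) ^ 2)⁻¹ := by rw [hη]; field_simp
  have hpow : (n : ℝ) + 1 ≤ 2 * (n : ℝ) ^ 5 := by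
    have : (n : ℝ) ≤ n ^ 5 := le_self_pow₀ (by linarith) (by norm_num)
    linarith
  calc ((univ.filter fun f : Fin s → Fin n => ¬ Typical p Y K ρ δ f).card : ℝ)
      ≤ (3 * (n : ℝ) ^ 5 + (n + 1)) * (η * N) := by linarith
    _ ≤ (5 * (n : ℝ) ^ 5) * (η * N) := by gcongr; linarith
    _ = 5 / n * (1 / n * N) := by
      linear_combination 5 * N * hη5
    _ ≤ 3 * (1 / n * N) := by
      gcongr
      rw [div_le_iff₀ hN]
      linarith
    _ = 3 / n * N := by ring

end Sampling

/-! ### Ranks -/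

open Finset Classical in
/-- The number of positions `m < N` that come before `a` when the positions are sorted by `key`,
ties being broken by the position. -/
noncomputable def rank (N : ℕ) (key : ℕ → ℝ) (a : ℕ) : ℕ :=
  ((range N).filter fun m => key m < key a ∨ ¬ key a < key m ∧ m < a).card

open Finset Classical in
theorem rank_lt_rank {N : ℕ} {key : ℕ → ℝ} {a b : ℕ} (ha : a < N)
    (h : key a < key b ∨ ¬ key b < key a ∧ a < b) : rank N key a < rank N key b := by
  refine card_lt_card ((ssubset_iff_of_subset ?_).2 ⟨a, ?_, ?_⟩)
  · intro m hm
    rw [mem_filter] at hm ⊢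
    refine ⟨hm.1, ?_⟩
    simp only [not_lt] at *
    rcases hm.2 with h1 | ⟨h1, h2⟩ <;> rcases h with h3 | ⟨h3, h4⟩
    · exact Or.inl (h1.trans h3)
    · exact Or.inl (h1.trans_le h3)
    · exact Or.inl (h1.trans_lt h3)
    · exact Or.inr ⟨h1.trans h3, h2.trans h4⟩
  · exact mem_filter.2 ⟨mem_range.2 ha, h⟩
  · simp

open Finset Classical in
theorem card_rank_lt_le (N : ℕ) (key : ℕ → ℝ) (r : ℕ) :
    ((range N).filter fun a => rank N key a < r).card ≤ r := by
  conv_rhs => rw [← card_range r]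
  refine card_le_card_of_injOn (rank N key) (fun a ha => by simpa using (mem_filter.1 ha).2) ?_
  intro a ha b hb hab
  have ha' : a < N := mem_range.1 (mem_filter.1 ha).1
  have hb' : b < N := mem_range.1 (mem_filter.1 hb).1
  by_contra hne
  rcases lt_trichotomy (key a) (key b) with h | h | h
  · exact (rank_lt_rank ha' (Or.inl h)).ne hab
  · rcases lt_or_gt_of_ne hne with h' | h'
    · exact (rank_lt_rank ha' (Or.inr ⟨h.not_gt, h'⟩)).ne hab
    · exact (rank_lt_rank hb' (Or.inr ⟨h.not_lt, h'⟩)).ne' hab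
  · exact (rank_lt_rank hb' (Or.inl h)).ne' hab

open Finset Classical in
/-- The first element of `Z` is preceded only by positions outside of `Z`. -/
theorem exists_rank_le {N : ℕ} (key : ℕ → ℝ) {Z : Finset ℕ} (hZ : Z.Nonempty) :
    ∃ a ∈ Z, (∀ z ∈ Z, key a ≤ key z) ∧ rank N key a ≤ ((range N).filter fun m => m ∉ Z).card := by
  obtain ⟨a, ha, hmin⟩ := exists_min_image Z (fun m => toLex (key m, m)) hZ
  simp only [Prod.Lex.toLex_le_toLex] at hmin
  refine ⟨a, ha, fun z hz => ?_, card_le_card fun m hm => ?_⟩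
  · rcases hmin z hz with h | h
    · exact h.le
    · exact h.1.le
  · rw [mem_filter] at hm ⊢
    refine ⟨hm.1, fun hmZ => ?_⟩
    rcases hmin m hmZ with h | ⟨h, h'⟩ <;> rcases hm.2 with h1 | ⟨h1, h2⟩
    · exact h.not_gt h1
    · exact h1 h
    · exact h1.ne' h
    · omega

namespace RealRAM

/-! ### Frames, counting and guarded loops -/

/-- `τ` arises from `σ` without a change to the arrays of natural numbers with names below `q` and
the input arrays of reals. -/
def Frame (q : ℕ) (σ τ : State) : Prop :=
  (∀ a < q, τ.nat a = σ.nat a) ∧ ∀ a < 3, τ.real a = σ.real a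

/-- `τ` arises from `σ` by a change of the two scalar variables used for counting. -/
def SameButCounters (σ τ : State) : Prop :=
  (∀ a, a ≠ 15 → a ≠ 16 → τ.nat a = σ.nat a) ∧ τ.real = σ.real

namespace Frame

variable {q q' : ℕ} {σ τ ρ : State}

theorem refl (q : ℕ) (σ : State) : Frame q σ σ := ⟨fun _ _ => rfl, fun _ _ => rfl⟩

theorem trans (h : Frame q σ τ) (h' : Frame q τ ρ) : Frame q σ ρ :=
  ⟨fun a ha => (h'.1 a ha).trans (h.1 a ha), fun a ha => (h'.2 a ha).trans (h.2 a ha)⟩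

theorem anti (h : Frame q σ τ) (hq : q' ≤ q) : Frame q' σ τ :=
  ⟨fun a ha => h.1 a (ha.trans_le hq), h.2⟩

theorem setNat {a : ℕ} (ha : q ≤ a) (σ : State) (i v : ℕ) : Frame q σ (σ.setNat a i v) :=
  ⟨fun b hb => σ.setNat_nat_of_ne i v (by omega), fun _ _ => rfl⟩

theorem setReal {a : ℕ} (ha : 3 ≤ a) (σ : State) (i : ℕ) (v : ℝ) : Frame q σ (σ.setReal a i v) :=
  ⟨fun _ _ => rfl, fun b hb => σ.setReal_real_of_ne i v (by omega)⟩

end Frame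

theorem SameButCounters.refl (σ : State) : SameButCounters σ σ := ⟨fun _ _ _ => rfl, rfl⟩

theorem SameButCounters.setNat {σ τ : State} (h : SameButCounters σ τ) {a : ℕ}
    (ha : a = 15 ∨ a = 16) (i v : ℕ) : SameButCounters σ (τ.setNat a i v) :=
  ⟨fun b h1 h2 => (τ.setNat_nat_of_ne i v (by omega)).trans (h.1 b h1 h2), h.2⟩

theorem SameButCounters.frame {σ τ : State} (h : SameButCounters σ τ) {q : ℕ} (hq : q ≤ 15) :
    Frame q σ τ :=
  ⟨fun a ha => h.1 a (by omega) (by omega), fun a _ => by rw [h.2]⟩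

/-- Counts in the scalar variable `15` for how many values of the scalar variable `16` below the
value of `bound` the test succeeds. -/
def countProgram (bound : ℕ) (test : Test) : Program :=
  .seq (.setNat 15 (.const 0) (.const 0)) (forLoop 16 bound (.ite test (increment 15) .skip))

open Finset in
theorem computes_countProgram {bound : ℕ} {test : Test} {σ : State} {N : ℕ} {p : ℕ → Prop}
    [DecidablePred p] (hb : bound < 15) (hσ : σ.nat bound 0 = N)
    (h : ∀ m < N, ∀ τ, SameButCounters σ τ → τ.nat 16 0 = m → (test.Holds τ ↔ p m)) :
    Computes (countProgram bound test) σ (N * (19 + test.cost) + 12) fun τ =>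
      SameButCounters σ τ ∧ τ.nat 15 0 = ((range N).filter p).card := by
  have h0 := Computes.setNat (σ := σ) (a := 15) (i := .const 0) (e := .const 0)
    (Q := fun τ => τ = σ.setNat 15 0 0) rfl
  have key := computes_forLoop (q := 16) (bound := bound) (body := .ite test (increment 15) .skip)
    (N := N) (c := fun _ => 1 + test.cost + 6) (σ := σ.setNat 15 0 0)
    (I := fun m τ => SameButCounters σ τ ∧ τ.nat 15 0 = ((range m).filter p).card)
    (by omega) ?_ ?_ ?_
  · refine (h0.seq fun τ hτ => hτ ▸ key).mono ?_ fun τ h => h.2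
    rw [sum_const, card_range, smul_eq_mul]
    simp only [NatExp.cost]
    linarith
  · rw [State.setNat_nat_of_ne _ _ _ (by omega), hσ]
  · exact ⟨((SameButCounters.refl σ).setNat (by simp) _ _).setNat (by simp) _ _,
      by simp [State.setNat_nat]⟩
  · intro m hm τ hτm ⟨hs, hc⟩
    have hb' : τ.nat bound 0 = σ.nat bound 0 := by rw [hs.1 _ (by omega) (by omega)]
    refine Computes.ite (fun ht => ?_) fun ht => ?_
    · refine computes_increment ⟨?_, ?_, (hs.setNat (by simp) _ _).setNat (by simp) _ _, ?_⟩
      · simpa [State.setNat_nat] using hτm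
      · rw [State.setNat_nat_of_ne _ _ _ (by omega)]
      · rw [range_add_one, filter_insert, if_pos ((h m hm τ hs hτm).1 ht),
          card_insert_of_notMem (by simp)]
        simp [State.setNat_nat, hc]
    · refine (Computes.skip ⟨hτm, rfl, hs.setNat (by simp) _ _, ?_⟩).mono (by omega) fun _ h => h
      rw [range_add_one, filter_insert, if_neg (mt (h m hm τ hs hτm).2 ht)]
      simp [State.setNat_nat, hc]

/-- For every value of the scalar variable `q` below the value of the scalar variable `4` for which
the test succeeds after `pre`, run `inner`. -/
def guardedLoop (q : ℕ) (pre : Program) (test : Test) (inner : Program) : Program :=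
  forLoop q 4 (.seq pre (.ite test inner .skip))

open Finset in
/-- If `inner` turns an assertion `Inv P` into `Inv (P ∪ S m)` in the round `m`, then the loop
collects the sets `S m` of all rounds in which the guard succeeds, and only these rounds pay for
`inner`. -/
theorem computes_guardedLoop {α : Type*} {Inv : Set α → State → Prop} {q : ℕ} {pre inner : Program}
    {test : Test} {σ : State} {N r : ℕ} {guard : ℕ → Prop} [DecidablePred guard]
    {S : ℕ → Set α} {cpre cin : ℕ}
    (hInv : ∀ P σ τ, τ.nat 20 0 = σ.nat 20 0 → τ.real = σ.real → Inv P σ → Inv P τ)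
    (hq : 4 < q) (hq' : q < 15) (hN : σ.nat 4 0 = N)
    (hr : ((range N).filter guard).card ≤ r)
    (hpre : ∀ m < N, ∀ τ, Frame q σ τ → τ.nat q 0 = m → Computes pre τ cpre fun τ' =>
      SameButCounters τ τ' ∧ (test.Holds τ' ↔ guard m))
    (hin : ∀ m < N, guard m → ∀ P τ, Frame q σ τ → τ.nat q 0 = m → Inv P τ →
      Computes inner τ cin fun τ' => Frame (q + 1) τ τ' ∧ Inv (P ∪ S m) τ')
    {P : Set α} (h : Inv P σ) :
    Computes (guardedLoop q pre test inner) σ (N * (14 + cpre + test.cost) + r * cin + 9) fun τ =>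
      Frame q σ τ ∧ Inv (P ∪ {e | ∃ m < N, guard m ∧ e ∈ S m}) τ := by
  have hset : ∀ P τ v, Inv P τ → Inv P (τ.setNat q 0 v) := fun P τ v =>
    hInv _ _ _ (by rw [State.setNat_nat_of_ne _ _ _ (by omega)]) rfl
  have key := computes_forLoop (q := q) (bound := 4) (body := .seq pre (.ite test inner .skip))
    (N := N) (c := fun m => cpre + (1 + test.cost + if guard m then cin else 1)) (σ := σ)
    (I := fun m τ => Frame q σ τ ∧ Inv (P ∪ {e | ∃ l < m, guard l ∧ e ∈ S l}) τ) hq.ne hN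
    ⟨Frame.setNat le_rfl _ _ _, by simpa using hset _ _ _ h⟩
    (fun m hm τ hτm ⟨hF, hI⟩ => by
      refine (hpre m hm τ hF hτm).seq fun τ' ⟨hs, ht⟩ => ?_
      have hF' : Frame q σ τ' := hF.trans (hs.frame hq'.le)
      have hτm' : τ'.nat q 0 = m := by rw [hs.1 q (by omega) (by omega), hτm]
      have hI' := hInv _ _ _ (by rw [hs.1 20 (by omega) (by omega)]) hs.2 hI
      have h4 : τ'.nat 4 0 = τ.nat 4 0 := by rw [hs.1 4 (by omega) (by omega)]
      refine Computes.ite (fun hb => ?_) fun hb => ?_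
      · have hg := ht.1 hb
        rw [if_pos hg]
        refine (hin m hm hg _ τ' hF' hτm' hI').mono le_rfl fun τ'' ⟨hF'', hI''⟩ => ?_
        refine ⟨by rw [hF''.1 q (by omega), hτm'], by rw [hF''.1 4 (by omega), h4],
          hF'.trans ((hF''.anti (by omega)).trans (Frame.setNat le_rfl _ _ _)), ?_⟩
        have hset' : P ∪ {e | ∃ l < m + 1, guard l ∧ e ∈ S l} =
            P ∪ {e | ∃ l < m, guard l ∧ e ∈ S l} ∪ S m := by
          ext e
          simp only [Set.mem_union, Set.mem_ofPred_eq, Nat.lt_succ_iff_lt_or_eq]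
          constructor
          · rintro (h | ⟨l, hl | rfl, h⟩)
            · exact Or.inl (Or.inl h)
            · exact Or.inl (Or.inr ⟨l, hl, h⟩)
            · exact Or.inr h.2
          · rintro ((h | ⟨l, hl, h⟩) | h)
            · exact Or.inl h
            · exact Or.inr ⟨l, Or.inl hl, h⟩
            · exact Or.inr ⟨m, Or.inr rfl, hg, h⟩
        rw [hset']
        exact hset _ _ _ hI''
      · have hg := mt ht.2 hb
        rw [if_neg hg]
        refine Computes.skip ⟨hτm', h4, hF'.trans (Frame.setNat le_rfl _ _ _), ?_⟩
        have hset' : {e | ∃ l < m + 1, guard l ∧ e ∈ S l} = {e | ∃ l < m, guard l ∧ e ∈ S l} := by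
          ext e
          simp only [Set.mem_ofPred_eq, Nat.lt_succ_iff_lt_or_eq]
          constructor
          · rintro ⟨l, hl | rfl, h⟩
            · exact ⟨l, hl, h⟩
            · exact absurd h.1 hg
          · rintro ⟨l, hl, h⟩
            exact ⟨l, Or.inl hl, h⟩
        rw [hset']
        exact hset _ _ _ hI')
  refine key.mono ?_ fun τ h => h.2
  have h1 : ∀ m, 12 + (cpre + (1 + test.cost + if guard m then cin else 1)) ≤
      (14 + cpre + test.cost) + if guard m then cin else 0 := fun m => by split_ifs <;> omega
  calc (∑ m ∈ range N, (12 + (cpre + (1 + test.cost + if guard m then cin else 1)))) + 9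
      ≤ (∑ m ∈ range N, ((14 + cpre + test.cost) + if guard m then cin else 0)) + 9 :=
        Nat.add_le_add_right (sum_le_sum fun m _ => h1 m) _
    _ = N * (14 + cpre + test.cost) + ((range N).filter guard).card * cin + 9 := by
        rw [sum_add_distrib, sum_const, card_range, smul_eq_mul, ← sum_filter, sum_const,
          smul_eq_mul]
    _ ≤ _ := by gcongr

end RealRAM

namespace RealRAM

/-! ### The search among the rectangles pinned by the net -/

/-- The data on which the search works: the parameters `n`, `t`, `ε`, the size `k` of the net, the
size `s` of the sample, the bound `r` on the ranks, and the points of the sample, the first `k` of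
which form the net. -/
structure Data where
  n : ℕ
  t : ℕ
  k : ℕ
  s : ℕ
  r : ℕ
  ε : ℝ
  point : ℕ → Plane

/-- The memory state holds the given data: `n`, `t`, `k`, `s`, `r` in the scalars `0`, `1`, `4`,
`5`, `6`, and the indices of the sample points in the array `7`. -/
structure Data.Stored (E : Data) (σ : State) : Prop where
  n : σ.nat 0 0 = E.n
  t : σ.nat 1 0 = E.t
  k : σ.nat 4 0 = E.k
  s : σ.nat 5 0 = E.s
  r : σ.nat 6 0 = E.r
  ε : σ.real 0 0 = E.ε
  fst : ∀ m < E.s, σ.real 1 (σ.nat 7 m) = E.point m 0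
  snd : ∀ m < E.s, σ.real 2 (σ.nat 7 m) = E.point m 1

theorem Data.Stored.frame {E : Data} {σ τ : State} (h : E.Stored σ) {q : ℕ} (hq : 8 ≤ q)
    (hF : Frame q σ τ) : E.Stored τ where
  n := by rw [hF.1 _ (by omega), h.n]
  t := by rw [hF.1 _ (by omega), h.t]
  k := by rw [hF.1 _ (by omega), h.k]
  s := by rw [hF.1 _ (by omega), h.s]
  r := by rw [hF.1 _ (by omega), h.r]
  ε := by rw [hF.2 _ (by omega), h.ε]
  fst m hm := by rw [hF.1 _ (by omega), hF.2 _ (by omega), h.fst m hm]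
  snd m hm := by rw [hF.1 _ (by omega), hF.2 _ (by omega), h.snd m hm]

/-- First coordinate of the sample point whose position is the value of the scalar `q`. -/
def fstExp (q : ℕ) : RealExp := .read 1 (.read 7 (.var q))

/-- Second coordinate of the sample point whose position is the value of the scalar `q`. -/
def sndExp (q : ℕ) : RealExp := .read 2 (.read 7 (.var q))

/-- First coordinate of the vector between the sample points given by the scalars `10` and `11`. -/
def dirFst : RealExp := .sub (fstExp 11) (fstExp 10)

/-- Second coordinate of the vector between the sample points given by the scalars `10` and
`11`. -/
def dirSnd : RealExp := .sub (sndExp 11) (sndExp 10)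

/-- The program text for `along`. -/
def alongExp (q : ℕ) : RealExp := .add (.mul (fstExp q) dirFst) (.mul (sndExp q) dirSnd)

/-- The program text for `across`. -/
def acrossExp (q : ℕ) : RealExp := .sub (.mul (sndExp q) dirFst) (.mul (fstExp q) dirSnd)

/-- The program text for `distSq`. -/
def distSqExp : RealExp := .add (.mul dirFst dirFst) (.mul dirSnd dirSnd)

/-- The program text for `pinnedWidth`. -/
def widthExp : RealExp := .div (.sub (alongExp 13) (alongExp 12)) distSqExp

/-- The program text for `pinnedHeight`. -/
def heightExp : RealExp := .div (.sub (acrossExp 14) (acrossExp 10)) distSqExp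

/-- The program text for `pinnedArea`. -/
def areaExp : RealExp := .mul (.mul widthExp heightExp) distSqExp

/-- The position of the sample point given by the scalar `q`, in the memory state `σ`, is `m`. -/
def Pointer (E : Data) (σ : State) (q m : ℕ) : Prop := σ.nat q 0 = m ∧ m < E.s

section Eval

variable {E : Data} {σ : State} (h : E.Stored σ)

include h

theorem fstExp_eval {q m : ℕ} (hq : Pointer E σ q m) : (fstExp q).eval σ = E.point m 0 := by
  simp only [fstExp, RealExp.eval, NatExp.eval, hq.1, h.fst m hq.2]

theorem sndExp_eval {q m : ℕ} (hq : Pointer E σ q m) : (sndExp q).eval σ = E.point m 1 := by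
  simp only [sndExp, RealExp.eval, NatExp.eval, hq.1, h.snd m hq.2]

variable {i j : ℕ} (hi : Pointer E σ 10 i) (hj : Pointer E σ 11 j)

include hi hj

theorem alongExp_eval {q m : ℕ} (hq : Pointer E σ q m) :
    (alongExp q).eval σ = along (E.point i) (E.point j) (E.point m) := by
  simp only [alongExp, dirFst, dirSnd, RealExp.eval, fstExp_eval h hi, fstExp_eval h hj,
    fstExp_eval h hq, sndExp_eval h hi, sndExp_eval h hj, sndExp_eval h hq, along]

theorem acrossExp_eval {q m : ℕ} (hq : Pointer E σ q m) :
    (acrossExp q).eval σ = across (E.point i) (E.point j) (E.point m) := by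
  simp only [acrossExp, dirFst, dirSnd, RealExp.eval, fstExp_eval h hi, fstExp_eval h hj,
    fstExp_eval h hq, sndExp_eval h hi, sndExp_eval h hj, sndExp_eval h hq, across]

theorem distSqExp_eval : distSqExp.eval σ = distSq (E.point i) (E.point j) := by
  simp only [distSqExp, dirFst, dirSnd, RealExp.eval, fstExp_eval h hi, fstExp_eval h hj,
    sndExp_eval h hi, sndExp_eval h hj, distSq]
  ring

end Eval

/-- The program text for the negative of an expression. -/
def negExp (e : RealExp) : RealExp := .sub (.ofNat (.const 0)) e

@[simp] theorem negExp_eval (e : RealExp) (σ : State) : (negExp e).eval σ = -e.eval σ := by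
  simp [negExp, RealExp.eval, NatExp.eval]

/-- Computes the `rank` of the net position held in the scalar `q` with respect to the sorting key
`key`. -/
def rankProgram (key : ℕ → RealExp) (q : ℕ) : Program :=
  countProgram 4 (.or (.realLt (key 16) (key q))
    (.and (.not (.realLt (key q) (key 16))) (.natLt (.var 16) (.var q))))

theorem computes_rankProgram {E : Data} {σ : State} (h : E.Stored σ) (hks : E.k ≤ E.s)
    {key : ℕ → RealExp} {f : ℕ → ℝ} {q a c : ℕ} (hq : q < 15) (ha : Pointer E σ q a)
    (hkey : ∀ τ, SameButCounters σ τ → ∀ q' m, Pointer E τ q' m → (key q').eval τ = f m)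
    (hc : (key 16).cost + (key q).cost ≤ c) :
    Computes (rankProgram key q) σ (E.k * (2 * c + 32) + 12) fun τ =>
      SameButCounters σ τ ∧ (Test.Holds τ (.natLt (.var 15) (.var 6)) ↔ rank E.k f a < E.r) := by
  refine (computes_countProgram (N := E.k) (p := fun m => f m < f a ∨ ¬ f a < f m ∧ m < a)
    (by norm_num) h.k fun m hm τ hs hτm => ?_).mono ?_ fun τ hτ => ⟨hτ.1, ?_⟩
  · have hqa : τ.nat q 0 = a := by rw [hs.1 q (by omega) (by omega), ha.1]
    rw [Test.holds_or]
    simp only [Test.Holds, NatExp.eval, hkey τ hs 16 m ⟨hτm, hm.trans_le hks⟩,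
      hkey τ hs q a ⟨hqa, ha.2⟩, hτm, hqa]
  · refine Nat.add_le_add_right (Nat.mul_le_mul_left _ ?_) _
    simp only [Test.or, Test.cost, NatExp.cost]
    omega
  · simp only [Test.Holds, NatExp.eval]
    rw [hτ.2, hτ.1.1 6 (by omega) (by omega), h.r, rank]

/-- The number of sample points in the box pinned by the sample points at the positions `e`. -/
noncomputable def Data.content (E : Data) (e : Fin 5 → ℕ) : ℕ := by
  classical
  exact ((Finset.range E.s).filter fun m => E.point m ∈ pinnedBox (E.point ∘ e)).card

/-- The sample suggests that the box pinned by the positions `e` contains a fraction of at least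
`1 - t / n - ε / 3` of all points. -/
def Data.Passes (E : Data) (e : Fin 5 → ℕ) : Prop :=
  (∀ l, e l < E.s) ∧ 0 < distSq (E.point (e 0)) (E.point (e 1)) ∧
    E.s * (3 * E.n - 3 * E.t - E.ε * E.n) ≤ E.content e * (3 * E.n)

/-- The memory state records a smallest pinned rectangle among those with positions in `P` that
pass the test. The scalar `20` tells if a rectangle was found, the real scalar `4` is its area. -/
def Data.Best (E : Data) (P : Set (Fin 5 → ℕ)) (σ : State) : Prop :=
  (∀ e ∈ P, E.Passes e → σ.nat 20 0 = 1 ∧ σ.real 4 0 ≤ pinnedArea (E.point ∘ e)) ∧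
    (σ.nat 20 0 = 0 ∨ σ.nat 20 0 = 1 ∧ ∃ e, E.Passes e ∧ σ.real 4 0 = pinnedArea (E.point ∘ e) ∧
      Outputs σ (pinnedRectangle (E.point ∘ e)))

theorem Data.Best.congr {E : Data} (P : Set (Fin 5 → ℕ)) (σ τ : State)
    (h1 : τ.nat 20 0 = σ.nat 20 0) (h2 : τ.real = σ.real) (h : E.Best P σ) : E.Best P τ := by
  simpa only [Data.Best, Outputs, h1, h2] using h

/-- Records the rectangle pinned by the positions in the scalars `10`, …, `14`. -/
def record : Program :=
  .seq (.setNat 20 (.const 0) (.const 1)) <|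
  .seq (.setReal 4 (.const 0) areaExp) <|
  .seq (.setReal 3 (.const 0) (.div (.sub (.mul (alongExp 12) dirFst) (.mul (acrossExp 10) dirSnd))
    distSqExp)) <|
  .seq (.setReal 3 (.const 1) (.div (.add (.mul (alongExp 12) dirSnd) (.mul (acrossExp 10) dirFst))
    distSqExp)) <|
  .seq (.setReal 3 (.const 2) (.mul widthExp dirFst)) <|
  .seq (.setReal 3 (.const 3) (.mul widthExp dirSnd)) <|
  .seq (.setReal 3 (.const 4) (.mul heightExp (.sub (sndExp 10) (sndExp 11)))) <|
  .seq (.setReal 3 (.const 5) (.mul heightExp dirFst)) .skip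

theorem computes_store {σ τ : State} {a i : ℕ} {e : RealExp} {v : ℝ} {P : Program} {T : ℕ}
    {Q : State → Prop} (hF : Frame 15 σ τ) (ha : 3 ≤ a)
    (he : ∀ ρ, Frame 15 σ ρ → e.eval ρ = v) (hc : e.cost ≤ 300)
    (h : Frame 15 σ (τ.setReal a i v) → Computes P (τ.setReal a i v) T Q) :
    Computes (.seq (.setReal a (.const i) e) P) τ (T + 302) Q := by
  have h0 := Computes.setReal (σ := τ) (a := a) (i := .const i) (e := e)
    (Q := fun ρ => ρ = τ.setReal a i v) (by rw [he τ hF]; rfl)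
  refine (h0.seq fun ρ hρ => hρ ▸ h (hF.trans (Frame.setReal ha _ _ _))).mono ?_ fun _ h => h
  simp only [NatExp.cost]
  omega

section Pinned

variable {E : Data} {σ : State} (h : E.Stored σ) {i j a b c : ℕ}
  (hi : Pointer E σ 10 i) (hj : Pointer E σ 11 j) (ha : Pointer E σ 12 a)
  (hb : Pointer E σ 13 b) (hc : Pointer E σ 14 c)

theorem Pointer.frame {q q' m : ℕ} {τ : State} (h : Pointer E σ q m) (hF : Frame q' σ τ)
    (hq : q < q') : Pointer E τ q m :=
  ⟨by rw [hF.1 q hq, h.1], h.2⟩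

include h hi hj ha hb hc

omit hc in
theorem widthExp_eval : widthExp.eval σ = pinnedWidth (E.point ∘ ![i, j, a, b, c]) := by
  simp [widthExp, RealExp.eval, alongExp_eval h hi hj ha, alongExp_eval h hi hj hb,
    distSqExp_eval h hi hj, pinnedWidth]

omit ha hb in
theorem heightExp_eval : heightExp.eval σ = pinnedHeight (E.point ∘ ![i, j, a, b, c]) := by
  simp [heightExp, RealExp.eval, acrossExp_eval h hi hj hi, acrossExp_eval h hi hj hc,
    distSqExp_eval h hi hj, pinnedHeight]

theorem areaExp_eval : areaExp.eval σ = pinnedArea (E.point ∘ ![i, j, a, b, c]) := by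
  simp only [areaExp, RealExp.eval, widthExp_eval h hi hj ha hb (c := c),
    heightExp_eval h hi hj hc (a := a) (b := b), distSqExp_eval h hi hj]
  rfl

theorem computes_record : Computes record σ 3000 fun τ => Frame 15 σ τ ∧ τ.nat 20 0 = 1 ∧
    τ.real 4 0 = pinnedArea (E.point ∘ ![i, j, a, b, c]) ∧
    Outputs τ (pinnedRectangle (E.point ∘ ![i, j, a, b, c])) := by
  have h0 := Computes.setNat (σ := σ) (a := 20) (i := .const 0) (e := .const 1)
    (Q := fun τ => τ = σ.setNat 20 0 1) rfl
  have hs : ∀ {ρ}, Frame 15 σ ρ → E.Stored ρ := fun hF => h.frame (by norm_num) hF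
  have pi : ∀ {ρ}, Frame 15 σ ρ → Pointer E ρ 10 i := fun hF => hi.frame hF (by norm_num)
  have pj : ∀ {ρ}, Frame 15 σ ρ → Pointer E ρ 11 j := fun hF => hj.frame hF (by norm_num)
  have pa : ∀ {ρ}, Frame 15 σ ρ → Pointer E ρ 12 a := fun hF => ha.frame hF (by norm_num)
  have pb : ∀ {ρ}, Frame 15 σ ρ → Pointer E ρ 13 b := fun hF => hb.frame hF (by norm_num)
  have pc : ∀ {ρ}, Frame 15 σ ρ → Pointer E ρ 14 c := fun hF => hc.frame hF (by norm_num)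
  have e1 : ∀ {ρ}, Frame 15 σ ρ → dirFst.eval ρ = E.point j 0 - E.point i 0 := fun hF => by
    simp only [dirFst, RealExp.eval, fstExp_eval (hs hF) (pi hF), fstExp_eval (hs hF) (pj hF)]
  have e2 : ∀ {ρ}, Frame 15 σ ρ → dirSnd.eval ρ = E.point j 1 - E.point i 1 := fun hF => by
    simp only [dirSnd, RealExp.eval, sndExp_eval (hs hF) (pi hF), sndExp_eval (hs hF) (pj hF)]
  refine h0.seq (T' := 2997) fun τ hτ => ?_
  subst hτ
  refine computes_store (v := pinnedArea (E.point ∘ ![i, j, a, b, c]))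
    (Frame.setNat (by norm_num) _ _ _) (by norm_num)
    (fun ρ hF => areaExp_eval (hs hF) (pi hF) (pj hF) (pa hF) (pb hF) (pc hF)) (by decide)
    fun hF => ?_
  refine computes_store (v := (pinnedRectangle (E.point ∘ ![i, j, a, b, c])).vertex 0)
    hF (by norm_num) (fun ρ hF => ?_) (by decide) fun hF => ?_
  · simp only [RealExp.eval, alongExp_eval (hs hF) (pi hF) (pj hF) (pa hF),
      acrossExp_eval (hs hF) (pi hF) (pj hF) (pi hF), distSqExp_eval (hs hF) (pi hF) (pj hF),
      e1 hF, e2 hF]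
    simp [pinnedRectangle]
  refine computes_store (v := (pinnedRectangle (E.point ∘ ![i, j, a, b, c])).vertex 1)
    hF (by norm_num) (fun ρ hF => ?_) (by decide) fun hF => ?_
  · simp only [RealExp.eval, alongExp_eval (hs hF) (pi hF) (pj hF) (pa hF),
      acrossExp_eval (hs hF) (pi hF) (pj hF) (pi hF), distSqExp_eval (hs hF) (pi hF) (pj hF),
      e1 hF, e2 hF]
    simp [pinnedRectangle]
  refine computes_store (v := (pinnedRectangle (E.point ∘ ![i, j, a, b, c])).edge₁ 0)
    hF (by norm_num) (fun ρ hF => ?_) (by decide) fun hF => ?_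
  · simp only [RealExp.eval, widthExp_eval (hs hF) (pi hF) (pj hF) (pa hF) (pb hF) (c := c),
      e1 hF]
    simp [pinnedRectangle]
  refine computes_store (v := (pinnedRectangle (E.point ∘ ![i, j, a, b, c])).edge₁ 1)
    hF (by norm_num) (fun ρ hF => ?_) (by decide) fun hF => ?_
  · simp only [RealExp.eval, widthExp_eval (hs hF) (pi hF) (pj hF) (pa hF) (pb hF) (c := c),
      e2 hF]
    simp [pinnedRectangle]
  refine computes_store (v := (pinnedRectangle (E.point ∘ ![i, j, a, b, c])).edge₂ 0)
    hF (by norm_num) (fun ρ hF => ?_) (by decide) fun hF => ?_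
  · simp only [RealExp.eval, heightExp_eval (hs hF) (pi hF) (pj hF) (pc hF)
      (a := a) (b := b),
      sndExp_eval (hs hF) (pi hF), sndExp_eval (hs hF) (pj hF)]
    simp [pinnedRectangle]
  refine computes_store (v := (pinnedRectangle (E.point ∘ ![i, j, a, b, c])).edge₂ 1)
    hF (by norm_num) (fun ρ hF => ?_) (by decide) fun hF => ?_
  · simp only [RealExp.eval, heightExp_eval (hs hF) (pi hF) (pj hF) (pc hF)
      (a := a) (b := b),
      e1 hF]
    simp [pinnedRectangle]
  refine (Computes.skip ⟨hF, ?_, ?_, ?_⟩).mono (by norm_num) fun _ h => h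
  · simp [State.setNat_nat]
  · simp [State.setReal_real]
  · simp [Outputs, State.setReal_real]

end Pinned

end RealRAM

namespace RealRAM

/-- The sample point given by the scalar `16` lies in the box pinned by the positions in the scalars
`10`, …, `14`. -/
def insideTest : Test :=
  .and (.not (.realLt (alongExp 16) (alongExp 12))) <|
  .and (.not (.realLt (alongExp 13) (alongExp 16))) <|
  .and (.not (.realLt (acrossExp 16) (acrossExp 10))) (.not (.realLt (acrossExp 14) (acrossExp 16)))

/-- The count in the scalar `15` suggests that the box contains sufficiently many points. -/
def contentTest : Test :=
  .not (.realLt (.mul (.ofNat (.var 15)) (.mul (.ofNat (.const 3)) (.ofNat (.var 0))))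
    (.mul (.ofNat (.var 5)) (.sub (.sub (.mul (.ofNat (.const 3)) (.ofNat (.var 0)))
      (.mul (.ofNat (.const 3)) (.ofNat (.var 1)))) (.mul (.var 0) (.ofNat (.var 0))))))

/-- No rectangle was recorded so far, or the present one is smaller. -/
def improvesTest : Test :=
  .not (.and (.natLt (.const 0) (.var 20)) (.not (.realLt areaExp (.var 4))))

/-- Examines the rectangle pinned by the positions in the scalars `10`, …, `14`. -/
def examine : Program :=
  .seq (countProgram 5 insideTest) (.ite contentTest (.ite improvesTest record .skip) .skip)

section Examine

variable {E : Data} {σ : State} (h : E.Stored σ) {i j a b c : ℕ}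
  (hi : Pointer E σ 10 i) (hj : Pointer E σ 11 j) (ha : Pointer E σ 12 a)
  (hb : Pointer E σ 13 b) (hc : Pointer E σ 14 c)

include h hi hj ha hb hc

theorem computes_examine (hD : 0 < distSq (E.point i) (E.point j)) {P : Set (Fin 5 → ℕ)}
    (hP : E.Best P σ) : Computes examine σ (E.s * 300 + 4000) fun τ =>
      Frame 15 σ τ ∧ E.Best (P ∪ {![i, j, a, b, c]}) τ := by
  classical
  have count := computes_countProgram (bound := 5) (test := insideTest) (N := E.s)
    (p := fun m => E.point m ∈ pinnedBox (E.point ∘ ![i, j, a, b, c])) (by norm_num) h.s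
    fun m hm τ hs hτm => by
      have hF : Frame 15 σ τ := hs.frame le_rfl
      have h' := h.frame (by norm_num) hF
      have hi' := hi.frame hF (by norm_num)
      have hj' := hj.frame hF (by norm_num)
      have hm' : Pointer E τ 16 m := ⟨hτm, hm⟩
      simp only [insideTest, Test.Holds, alongExp_eval h' hi' hj' hm',
        alongExp_eval h' hi' hj' (ha.frame hF (by norm_num)),
        alongExp_eval h' hi' hj' (hb.frame hF (by norm_num)), acrossExp_eval h' hi' hj' hm',
        acrossExp_eval h' hi' hj' hi', acrossExp_eval h' hi' hj' (hc.frame hF (by norm_num)),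
        not_lt]
      rfl
  have hcost : insideTest.cost = 243 := by decide
  refine (count.seq (T' := 3988) fun τ ⟨hs, hτ⟩ => ?_).mono (by rw [hcost]; omega) fun _ h => h
  have hF : Frame 15 σ τ := hs.frame le_rfl
  have h' := h.frame (by norm_num) hF
  have hP' := hP.congr P σ τ (by rw [hs.1 20 (by norm_num) (by norm_num)]) hs.2
  have hi' := hi.frame hF (by norm_num)
  have hj' := hj.frame hF (by norm_num)
  have ha' := ha.frame hF (by norm_num)
  have hb' := hb.frame hF (by norm_num)
  have hc' := hc.frame hF (by norm_num)
  have hcontent : contentTest.Holds τ ↔ E.Passes ![i, j, a, b, c] := by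
    have hτ' : τ.nat 15 0 = E.content ![i, j, a, b, c] := by rw [hτ, Data.content]
    simp only [contentTest, Test.Holds, RealExp.eval, NatExp.eval, hτ', h'.n, h'.t, h'.s, h'.ε,
      not_lt, Data.Passes, Nat.cast_ofNat]
    refine ⟨fun h => ⟨fun l => ?_, hD, h⟩, fun h => h.2.2⟩
    fin_cases l
    exacts [hi.2, hj.2, ha.2, hb.2, hc.2]
  have himpr : improvesTest.Holds τ ↔ τ.nat 20 0 = 0 ∨
      pinnedArea (E.point ∘ ![i, j, a, b, c]) < τ.real 4 0 := by
    simp only [improvesTest, Test.Holds, RealExp.eval, NatExp.eval,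
      areaExp_eval h' hi' hj' ha' hb' hc']
    rw [not_and_or, not_not, not_lt, Nat.le_zero]
  refine (Computes.ite (T := 3800) (fun hcon => ?_) fun hcon => ?_).mono (by decide) fun _ h => h
  · refine (Computes.ite (T := 3000) (fun himp => ?_) fun himp => ?_).mono (by decide)
      fun _ h => h
    · refine (computes_record h' hi' hj' ha' hb' hc').mono le_rfl fun ρ ⟨hF', h1, h2, h3⟩ => ?_
      refine ⟨hF.trans hF', ?_, Or.inr ⟨h1, _, hcontent.1 hcon, h2, h3⟩⟩
      rintro e (he | rfl) hpass
      · refine ⟨h1, ?_⟩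
        obtain ⟨h4, h5⟩ := hP'.1 e he hpass
        rcases himpr.1 himp with h6 | h6
        · omega
        · rw [h2]; exact h6.le.trans h5
      · exact ⟨h1, h2.le⟩
    · refine (Computes.skip ⟨hF, ?_, hP'.2⟩).mono (by norm_num) fun _ h => h
      rw [himpr, not_or, not_lt] at himp
      rintro e (he | rfl) hpass
      · exact hP'.1 e he hpass
      · rcases hP'.2 with h4 | h4
        · exact absurd h4 himp.1
        · exact ⟨h4.1, himp.2⟩
  · refine (Computes.skip ⟨hF, ?_, hP'.2⟩).mono (by norm_num) fun _ h => h
    rintro e (he | rfl) hpass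
    · exact hP'.1 e he hpass
    · exact absurd (hcontent.2 hpass) hcon

end Examine

/-- Success of the rank test. -/
def rankTest : Test := .natLt (.var 15) (.var 6)

/-- Tries all positions for the side opposite to the side through the scalars `10` and `11`. -/
def topLoop : Program :=
  guardedLoop 14 (rankProgram (fun q => negExp (acrossExp q)) 14) rankTest examine

/-- Tries all positions for one of the adjacent sides. -/
def rightLoop : Program :=
  guardedLoop 13 (rankProgram (fun q => negExp (alongExp q)) 13) rankTest topLoop

/-- Tries all positions for the other adjacent side. -/
def leftLoop : Program := guardedLoop 12 (rankProgram alongExp 12) rankTest rightLoop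

/-- Tries all second positions on the first side. -/
def tipLoop : Program :=
  guardedLoop 11 .skip (.realLt (.ofNat (.const 0)) distSqExp) leftLoop

/-- Tries all rectangles that are pinned by points of the net and leave out few points of the net
on three of their sides. -/
def search : Program := guardedLoop 10 .skip (.natLt (.const 0) (.const 1)) tipLoop

/-- The quintuples of positions in the net that pin a rectangle for which fewer than `r` points of
the net come before the pinning point on each of the last three sides. -/
def Data.Eligible (E : Data) : Set (Fin 5 → ℕ) :=
  {e | (∀ l, e l < E.k) ∧ 0 < distSq (E.point (e 0)) (E.point (e 1)) ∧
    rank E.k (fun m => along (E.point (e 0)) (E.point (e 1)) (E.point m)) (e 2) < E.r ∧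
    rank E.k (fun m => -along (E.point (e 0)) (E.point (e 1)) (E.point m)) (e 3) < E.r ∧
    rank E.k (fun m => -across (E.point (e 0)) (E.point (e 1)) (E.point m)) (e 4) < E.r}

section Search

variable {E : Data} (hks : E.k ≤ E.s) (hk : 1 ≤ E.k) (hr : 1 ≤ E.r)

include hks in
theorem pointer_of_lt {q m : ℕ} {σ : State} (h : σ.nat q 0 = m) (hm : m < E.k) :
    Pointer E σ q m := ⟨h, hm.trans_le hks⟩

include hks hk

theorem computes_topLoop {σ : State} (h : E.Stored σ) {i j a b : ℕ} (hi : Pointer E σ 10 i)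
    (hj : Pointer E σ 11 j) (ha : Pointer E σ 12 a) (hb : Pointer E σ 13 b)
    (hD : 0 < distSq (E.point i) (E.point j)) {P : Set (Fin 5 → ℕ)} (hP : E.Best P σ) :
    Computes topLoop σ (5000 * (E.k ^ 2 + E.r * E.s)) fun τ => Frame 14 σ τ ∧
      E.Best (P ∪ {e | ∃ c < E.k,
        rank E.k (fun m => -across (E.point i) (E.point j) (E.point m)) c < E.r ∧
        e ∈ ({![i, j, a, b, c]} : Set (Fin 5 → ℕ))}) τ := by
  refine (computes_guardedLoop (r := E.r) (cpre := E.k * 160 + 12) (cin := E.s * 300 + 4000)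
    Data.Best.congr (by norm_num) (by norm_num) h.k (card_rank_lt_le _ _ _)
    (fun m hm τ hF hτm => ?_) (fun m hm hg P τ hF hτm hP => ?_) hP).mono ?_ fun _ h => h
  · refine computes_rankProgram (c := 64) (h.frame (by norm_num) hF) hks (by norm_num)
      (pointer_of_lt hks hτm hm) (fun τ' hs q m hq => ?_) (by decide)
    have hF' := hF.trans (hs.frame (by norm_num))
    rw [negExp_eval, acrossExp_eval (h.frame (by norm_num) hF') (hi.frame hF' (by norm_num))
      (hj.frame hF' (by norm_num)) hq]
  · exact computes_examine (h.frame (by norm_num) hF) (hi.frame hF (by norm_num))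
      (hj.frame hF (by norm_num)) (ha.frame hF (by norm_num)) (hb.frame hF (by norm_num))
      (pointer_of_lt hks hτm hm) hD hP
  · have hc : rankTest.cost = 5 := by decide
    rw [hc]
    have hs : 1 ≤ E.s := hk.trans hks
    nlinarith [Nat.mul_le_mul_left E.r hs]

include hr

theorem computes_rightLoop {σ : State} (h : E.Stored σ) {i j a : ℕ} (hi : Pointer E σ 10 i)
    (hj : Pointer E σ 11 j) (ha : Pointer E σ 12 a)
    (hD : 0 < distSq (E.point i) (E.point j)) {P : Set (Fin 5 → ℕ)} (hP : E.Best P σ) :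
    Computes rightLoop σ (6000 * (E.r * E.k ^ 2 + E.r ^ 2 * E.s)) fun τ => Frame 13 σ τ ∧
      E.Best (P ∪ {e | ∃ b < E.k,
        rank E.k (fun m => -along (E.point i) (E.point j) (E.point m)) b < E.r ∧
        e ∈ {e | ∃ c < E.k,
          rank E.k (fun m => -across (E.point i) (E.point j) (E.point m)) c < E.r ∧
          e ∈ ({![i, j, a, b, c]} : Set (Fin 5 → ℕ))}}) τ := by
  refine (computes_guardedLoop (r := E.r) (cpre := E.k * 160 + 12)
    (cin := 5000 * (E.k ^ 2 + E.r * E.s))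
    Data.Best.congr (by norm_num) (by norm_num) h.k (card_rank_lt_le _ _ _)
    (fun m hm τ hF hτm => ?_) (fun m hm hg P τ hF hτm hP => ?_) hP).mono ?_ fun _ h => h
  · refine computes_rankProgram (c := 64) (h.frame (by norm_num) hF) hks (by norm_num)
      (pointer_of_lt hks hτm hm) (fun τ' hs q m hq => ?_) (by decide)
    have hF' := hF.trans (hs.frame (by norm_num))
    rw [negExp_eval, alongExp_eval (h.frame (by norm_num) hF') (hi.frame hF' (by norm_num))
      (hj.frame hF' (by norm_num)) hq]
  · exact computes_topLoop hks hk (h.frame (by norm_num) hF) (hi.frame hF (by norm_num))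
      (hj.frame hF (by norm_num)) (ha.frame hF (by norm_num)) (pointer_of_lt hks hτm hm) hD hP
  · have hc : rankTest.cost = 5 := by decide
    rw [hc]
    have hk2 : E.k ^ 2 ≤ E.r * E.k ^ 2 := Nat.le_mul_of_pos_left _ hr
    nlinarith

theorem computes_leftLoop {σ : State} (h : E.Stored σ) {i j : ℕ} (hi : Pointer E σ 10 i)
    (hj : Pointer E σ 11 j)
    (hD : 0 < distSq (E.point i) (E.point j)) {P : Set (Fin 5 → ℕ)} (hP : E.Best P σ) :
    Computes leftLoop σ (7000 * (E.r ^ 2 * E.k ^ 2 + E.r ^ 3 * E.s)) fun τ => Frame 12 σ τ ∧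
      E.Best (P ∪ {e | ∃ a < E.k,
        rank E.k (fun m => along (E.point i) (E.point j) (E.point m)) a < E.r ∧
        e ∈ {e | ∃ b < E.k,
        rank E.k (fun m => -along (E.point i) (E.point j) (E.point m)) b < E.r ∧
        e ∈ {e | ∃ c < E.k,
          rank E.k (fun m => -across (E.point i) (E.point j) (E.point m)) c < E.r ∧
          e ∈ ({![i, j, a, b, c]} : Set (Fin 5 → ℕ))}}}) τ := by
  refine (computes_guardedLoop (r := E.r) (cpre := E.k * 160 + 12)
    (cin := 6000 * (E.r * E.k ^ 2 + E.r ^ 2 * E.s))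
    Data.Best.congr (by norm_num) (by norm_num) h.k (card_rank_lt_le _ _ _)
    (fun m hm τ hF hτm => ?_) (fun m hm hg P τ hF hτm hP => ?_) hP).mono ?_ fun _ h => h
  · refine computes_rankProgram (c := 64) (h.frame (by norm_num) hF) hks (by norm_num)
      (pointer_of_lt hks hτm hm) (fun τ' hs q m hq => ?_) (by decide)
    have hF' := hF.trans (hs.frame (by norm_num))
    rw [alongExp_eval (h.frame (by norm_num) hF') (hi.frame hF' (by norm_num))
      (hj.frame hF' (by norm_num)) hq]
  · exact computes_rightLoop hks hk hr (h.frame (by norm_num) hF) (hi.frame hF (by norm_num))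
      (hj.frame hF (by norm_num)) (pointer_of_lt hks hτm hm) hD hP
  · have hc : rankTest.cost = 5 := by decide
    rw [hc]
    have hk2 : E.k ^ 2 ≤ E.r ^ 2 * E.k ^ 2 := Nat.le_mul_of_pos_left _ (by positivity)
    have hk1 : E.k * (14 + (E.k * 160 + 12) + 5) + 9 ≤ 200 * E.k ^ 2 := by nlinarith
    have hmul : E.r * (6000 * (E.r * E.k ^ 2 + E.r ^ 2 * E.s)) =
        6000 * (E.r ^ 2 * E.k ^ 2) + 6000 * (E.r ^ 3 * E.s) := by ring
    omega

theorem computes_tipLoop {σ : State} (h : E.Stored σ) {i : ℕ} (hi : Pointer E σ 10 i)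
    {P : Set (Fin 5 → ℕ)} (hP : E.Best P σ) :
    Computes tipLoop σ (8000 * (E.k * (E.r ^ 2 * E.k ^ 2 + E.r ^ 3 * E.s))) fun τ =>
      Frame 11 σ τ ∧ E.Best (P ∪ {e | ∃ j < E.k, 0 < distSq (E.point i) (E.point j) ∧
      e ∈ {e | ∃ a < E.k,
        rank E.k (fun m => along (E.point i) (E.point j) (E.point m)) a < E.r ∧
        e ∈ {e | ∃ b < E.k,
        rank E.k (fun m => -along (E.point i) (E.point j) (E.point m)) b < E.r ∧
        e ∈ {e | ∃ c < E.k,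
          rank E.k (fun m => -across (E.point i) (E.point j) (E.point m)) c < E.r ∧
          e ∈ ({![i, j, a, b, c]} : Set (Fin 5 → ℕ))}}}}) τ := by
  refine (computes_guardedLoop (r := E.k) (cpre := 1)
    (cin := 7000 * (E.r ^ 2 * E.k ^ 2 + E.r ^ 3 * E.s))
    Data.Best.congr (by norm_num) (by norm_num) h.k
    ((Finset.card_filter_le _ _).trans_eq (Finset.card_range _))
    (fun m hm τ hF hτm => ?_) (fun m hm hg P τ hF hτm hP => ?_) hP).mono ?_ fun _ h => h
  · refine Computes.skip ⟨SameButCounters.refl _, ?_⟩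
    simp only [Test.Holds, distSqExp_eval (h.frame (by norm_num) hF) (hi.frame hF (by norm_num))
      (pointer_of_lt hks hτm hm), RealExp.eval, NatExp.eval, Nat.cast_zero]
  · exact computes_leftLoop hks hk hr (h.frame (by norm_num) hF) (hi.frame hF (by norm_num))
      (pointer_of_lt hks hτm hm) hg hP
  · have hc : (Test.realLt (.ofNat (.const 0)) distSqExp).cost = 42 := by decide
    rw [hc]
    have hU : 1 ≤ E.r ^ 2 * E.k ^ 2 + E.r ^ 3 * E.s :=
      Nat.one_le_iff_ne_zero.2 (by positivity)
    generalize E.r ^ 2 * E.k ^ 2 + E.r ^ 3 * E.s = U at hU ⊢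
    nlinarith [Nat.mul_le_mul_left E.k hU]

theorem computes_search {σ : State} (h : E.Stored σ) (h0 : σ.nat 20 0 = 0) :
    Computes search σ (9000 * (E.k ^ 2 * (E.r ^ 2 * E.k ^ 2 + E.r ^ 3 * E.s))) fun τ =>
      E.Best E.Eligible τ := by
  refine (computes_guardedLoop (r := E.k) (cpre := 1) (guard := fun _ => True) (P := ∅)
    (cin := 8000 * (E.k * (E.r ^ 2 * E.k ^ 2 + E.r ^ 3 * E.s)))
    Data.Best.congr (by norm_num) (by norm_num) h.k
    ((Finset.card_filter_le _ _).trans_eq (Finset.card_range _))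
    (fun m hm τ hF hτm => ?_) (fun m hm hg P τ hF hτm hP =>
      computes_tipLoop hks hk hr (h.frame (by norm_num) hF) (pointer_of_lt hks hτm hm) hP)
    ⟨fun e he => absurd he (Set.notMem_empty e), Or.inl h0⟩).mono ?_ fun τ ⟨_, hτ⟩ => ⟨?_, hτ.2⟩
  · refine Computes.skip ⟨SameButCounters.refl _, ?_⟩
    simp [Test.Holds, NatExp.eval]
  · have hc : (Test.natLt (.const 0) (.const 1)).cost = 3 := by decide
    rw [hc]
    have hU : 1 ≤ E.r ^ 2 * E.k ^ 2 + E.r ^ 3 * E.s :=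
      Nat.one_le_iff_ne_zero.2 (by positivity)
    generalize E.r ^ 2 * E.k ^ 2 + E.r ^ 3 * E.s = U at hU ⊢
    nlinarith [Nat.mul_le_mul (Nat.le_self_pow two_ne_zero E.k) hU]
  · rintro e ⟨he, hD, h2, h3, h4⟩ hpass
    refine hτ.1 e (Or.inr ⟨e 0, he 0, trivial, e 1, he 1, hD, e 2, he 2, h2, e 3, he 3, h3,
      e 4, he 4, h4, ?_⟩) hpass
    ext l
    fin_cases l <;> rfl

end Search

end RealRAM

namespace RealRAM

/-! ### Parameters and random draws -/

/-- Computes in the scalar `3` the least `l` with `n ≤ 2 ^ l`, where `n` is the scalar `0`. -/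
def clogProgram : Program :=
  .seq (.setNat 2 (.const 0) (.const 1)) <| .seq (.setNat 3 (.const 0) (.const 0)) <|
    .loop (.natLt (.var 2) (.var 0)) <|
      .seq (.setNat 2 (.const 0) (.add (.var 2) (.var 2))) (increment 3)

theorem computes_clogProgram (σ : State) :
    Computes clogProgram σ (20 * Nat.clog 2 (σ.nat 0 0) + 12) fun τ =>
      Frame 2 σ τ ∧ τ.nat 3 0 = Nat.clog 2 (σ.nat 0 0) := by
  set n := σ.nat 0 0 with hn
  have h1 := Computes.setNat (σ := σ) (a := 2) (i := .const 0) (e := .const 1)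
    (Q := fun τ => τ = σ.setNat 2 0 1) rfl
  have h2 := Computes.setNat (σ := σ.setNat 2 0 1) (a := 3) (i := .const 0) (e := .const 0)
    (Q := fun τ => τ = (σ.setNat 2 0 1).setNat 3 0 0) rfl
  have key := Computes.loop (b := .natLt (.var 2) (.var 0))
    (P := .seq (.setNat 2 (.const 0) (.add (.var 2) (.var 2))) (increment 3))
    (N := Nat.clog 2 n) (c := fun _ => 1 + 1 + 5 + 6)
    (I := fun m τ => Frame 2 σ τ ∧ τ.nat 2 0 = 2 ^ m ∧ τ.nat 3 0 = m)
    (σ := (σ.setNat 2 0 1).setNat 3 0 0)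
    (fun m hm τ ⟨hF, hp, hl⟩ => by
      refine ⟨?_, ?_⟩
      · simp only [Test.Holds, NatExp.eval, hp]
        rw [hF.1 0 (by norm_num), ← hn]
        exact (Nat.lt_clog_iff_pow_lt one_lt_two).1 hm
      · refine (Computes.setNat (Q := fun ρ => ρ = τ.setNat 2 0 (2 ^ (m + 1))) ?_).seq
          fun ρ hρ => computes_increment ?_
        · simp only [NatExp.eval, hp, pow_succ, mul_two]
        · subst hρ
          refine ⟨hF.trans ((Frame.setNat le_rfl _ _ _).trans
            (Frame.setNat (by norm_num) _ _ _)), ?_, ?_⟩ <;> simp [State.setNat_nat, hl])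
    (fun τ ⟨hF, hp, hl⟩ => by
      simp only [Test.Holds, NatExp.eval, hp]
      rw [hF.1 0 (by norm_num), ← hn, not_lt]
      exact Nat.le_pow_clog one_lt_two n)
    ⟨(Frame.setNat le_rfl _ _ _).trans (Frame.setNat (by norm_num) _ _ _),
      by simp [State.setNat_nat], by simp [State.setNat_nat]⟩
  refine (h1.seq fun τ hτ => hτ ▸ h2.seq fun τ hτ => hτ ▸ key).mono ?_
    fun τ h => ⟨h.1, h.2.2⟩
  simp only [Finset.sum_const, Finset.card_range, smul_eq_mul, NatExp.cost, Test.cost]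
  omega

/-- Computes in the scalar `v` the least natural number `m` with `β ≤ m α`. -/
def ceilProgram (v : ℕ) (α β : RealExp) : Program :=
  .seq (.setNat v (.const 0) (.const 0)) <|
    .loop (.realLt (.mul (.ofNat (.var v)) α) β) (increment v)

theorem computes_ceilProgram {v : ℕ} {α β : RealExp} {σ : State} {A B : ℝ} (hA : 0 < A)
    (hα : ∀ τ, Frame v σ τ → α.eval τ = A) (hβ : ∀ τ, Frame v σ τ → β.eval τ = B)
    (hc : α.cost + β.cost ≤ 50) :
    Computes (ceilProgram v α β) σ (65 * ⌈B / A⌉₊ + 60) fun τ =>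
      Frame v σ τ ∧ τ.nat v 0 = ⌈B / A⌉₊ := by
  have h1 := Computes.setNat (σ := σ) (a := v) (i := .const 0) (e := .const 0)
    (Q := fun τ => τ = σ.setNat v 0 0) rfl
  have test : ∀ {τ : State}, Frame v σ τ →
      (Test.Holds τ (.realLt (.mul (.ofNat (.var v)) α) β) ↔ τ.nat v 0 < ⌈B / A⌉₊) := by
    intro τ hF
    rw [Nat.lt_ceil, lt_div_iff₀ hA]
    simp only [Test.Holds, RealExp.eval, NatExp.eval, hα τ hF, hβ τ hF]
  have key := Computes.loop (b := .realLt (.mul (.ofNat (.var v)) α) β) (P := increment v)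
    (N := ⌈B / A⌉₊) (c := fun _ => 6) (I := fun m τ => Frame v σ τ ∧ τ.nat v 0 = m)
    (σ := σ.setNat v 0 0)
    (fun m hm τ ⟨hF, hl⟩ => by
      refine ⟨(test hF).2 (hl ▸ hm), computes_increment ⟨?_, ?_⟩⟩
      · exact hF.trans (Frame.setNat le_rfl _ _ _)
      · simp [State.setNat_nat, hl])
    (fun τ ⟨hF, hl⟩ => by rw [test hF, hl]; exact lt_irrefl _)
    ⟨Frame.setNat le_rfl _ _ _, by simp [State.setNat_nat]⟩
  refine (h1.seq fun τ hτ => hτ ▸ key).mono ?_ fun τ h => h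
  simp only [Finset.sum_const, Finset.card_range, smul_eq_mul, NatExp.cost, Test.cost,
    RealExp.cost]
  nlinarith [Nat.mul_le_mul_left ⌈B / A⌉₊ hc]

theorem runs_draw {a : ℕ} {i e : NatExp} {σ : State} {N : ℕ} [NeZero N] (h : e.eval σ + 1 = N) :
    Runs (.draw a i e) σ (1 + i.cost + e.cost)
      ((PMF.uniformOfFintype (Fin N)).map fun l : Fin N => σ.setNat a (i.eval σ) (l : ℕ)) := by
  subst h
  exact .draw a i e σ

theorem uniform_fin_succ_fun (N d : ℕ) [NeZero N] :
    PMF.uniformOfFintype (Fin (d + 1) → Fin N) =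
      (PMF.uniformOfFintype (Fin N)).bind fun a =>
        (PMF.uniformOfFintype (Fin d → Fin N)).map fun f =>
          (Fin.cons a f : Fin (d + 1) → Fin N) := by
  ext f
  have hN : (N : ENNReal) ≠ 0 := by exact_mod_cast NeZero.ne N
  rw [PMF.bind_apply, tsum_fintype, Finset.sum_eq_single (f 0)]
  · rw [PMF.map_apply, tsum_fintype, Finset.sum_eq_single (Fin.tail f)]
    · rw [if_pos (Fin.cons_self_tail f).symm]
      simp only [PMF.uniformOfFintype_apply, Fintype.card_fun, Fintype.card_fin, Nat.cast_pow]
      rw [pow_succ', ENNReal.mul_inv (Or.inl hN) (Or.inl (ENNReal.natCast_ne_top N))]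
    · intro g _ hg
      rw [if_neg]
      intro h
      have := congrArg Fin.tail h
      rw [Fin.tail_cons] at this
      exact hg this.symm
    · simp
  · intro a _ ha
    rw [PMF.map_apply, tsum_fintype, Finset.sum_eq_zero, mul_zero]
    intro g _
    rw [if_neg]
    exact fun h => ha (congrFun h 0).symm
  · simp

/-- Draws into the array `7` as many indices of points as the scalar `5` says. -/
def drawProgram : Program :=
  forLoop 8 5 (.draw 7 (.var 8) (.sub (.var 0) (.const 1)))

theorem runs_drawProgram {N s : ℕ} [NeZero N] {σ : State} (hN : σ.nat 0 0 = N)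
    (hs : σ.nat 5 0 = s) :
    ∃ F : (Fin s → Fin N) → State,
      Runs drawProgram σ (20 * s + 9) ((PMF.uniformOfFintype (Fin s → Fin N)).map F) ∧
      ∀ f, Frame 7 σ (F f) ∧ ∀ i : Fin s, (F f).nat 7 i = f i := by
  suffices H : ∀ d c : ℕ, ∀ σ : State, σ.nat 0 0 = N ∧ σ.nat 5 0 = c + d ∧ σ.nat 8 0 = c →
      ∃ F : (Fin d → Fin N) → State,
      Runs (.loop (.natLt (.var 8) (.var 5))
        (.seq (.draw 7 (.var 8) (.sub (.var 0) (.const 1))) (increment 8))) σ (20 * d + 6)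
        ((PMF.uniformOfFintype (Fin d → Fin N)).map F) ∧
      ∀ f, Frame 7 σ (F f) ∧ (∀ m < c, (F f).nat 7 m = σ.nat 7 m) ∧
        ∀ i : Fin d, (F f).nat 7 (c + i) = f i by
    have h0 := Runs.setNat 8 (.const 0) (.const 0) σ
    obtain ⟨F, hF, hF'⟩ := H s 0 (σ.setNat 8 0 0)
      ⟨by simpa [State.setNat_nat] using hN, by simpa [State.setNat_nat] using hs,
        by simp [State.setNat_nat]⟩
    refine ⟨F, (h0.seq_pure hF).mono (by simp only [NatExp.cost]; omega), fun f => ⟨?_, ?_⟩⟩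
    · exact (Frame.setNat (by norm_num) _ _ _).trans (hF' f).1
    · simpa using (hF' f).2.2
  intro d
  induction d with
  | zero =>
    rintro c σ ⟨h1, h2, h3⟩
    refine ⟨fun _ => σ, ?_, fun f => ⟨Frame.refl _ _, fun _ _ => rfl, fun i => i.elim0⟩⟩
    rw [show (fun _ : Fin 0 → Fin N => σ) = Function.const _ σ from rfl, PMF.map_const]
    exact (Runs.loop_false (by simp [Test.Holds, NatExp.eval, h2, h3])).mono (by decide)
  | succ d ih =>
    rintro c σ ⟨h1, h2, h3⟩
    set step : Fin N → State := fun a => (σ.setNat 7 c a).setNat 8 0 (c + 1) with hstep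
    have hstep' : ∀ a, (step a).nat 0 0 = N ∧ (step a).nat 5 0 = c + 1 + d ∧
        (step a).nat 8 0 = c + 1 := fun a => by
      refine ⟨?_, ?_, ?_⟩ <;> simp [hstep, State.setNat_nat, h1, h2]
      omega
    choose! F hF using ih (c + 1)
    have hN1 : 0 < N := NeZero.pos N
    have body : Runs (.seq (.draw 7 (.var 8) (.sub (.var 0) (.const 1))) (increment 8)) σ
        (1 + 2 + 4 + 6) ((PMF.uniformOfFintype (Fin N)).map step) := by
      have hd := runs_draw (a := 7) (i := .var 8) (e := .sub (.var 0) (.const 1)) (σ := σ)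
        (N := N) (by simp only [NatExp.eval, h1]; omega)
      have := Runs.seq (Q := increment 8) (T' := 6)
        (ν := fun τ => PMF.pure (τ.setNat 8 0 (τ.nat 8 0 + 1))) hd
        fun τ _ => Runs.setNat 8 (.const 0) (.add (.var 8) (.const 1)) τ
      have hlaw : ((PMF.uniformOfFintype (Fin N)).map fun l : Fin N =>
          σ.setNat 7 ((NatExp.var 8).eval σ) (l : ℕ)).bind
            (fun τ => PMF.pure (τ.setNat 8 0 (τ.nat 8 0 + 1))) =
          (PMF.uniformOfFintype (Fin N)).map step := by
        rw [PMF.bind_map, ← PMF.bind_pure_comp]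
        congr 1
        funext a
        simp [hstep, State.setNat_nat, NatExp.eval, h3]
      rwa [hlaw] at this
    have loop := Runs.loop_true (b := .natLt (.var 8) (.var 5)) (T' := 20 * d + 6)
      (ν := fun τ => (PMF.uniformOfFintype (Fin d → Fin N)).map (F τ))
      (by simp [Test.Holds, NatExp.eval, h2, h3]) body
      (fun τ hτ => by
        rw [PMF.support_map] at hτ
        obtain ⟨a, -, rfl⟩ := hτ
        exact (hF _ (hstep' a)).1)
    refine ⟨fun f => F (step (f 0)) (Fin.tail f), ?_, fun f => ?_⟩
    · rw [PMF.bind_map] at loop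
      rw [uniform_fin_succ_fun, PMF.map_bind]
      simp only [PMF.map_comp]
      refine loop.mono ?_
      simp only [Test.cost, NatExp.cost]
      omega
    · obtain ⟨-, h⟩ := hF _ (hstep' (f 0))
      obtain ⟨h4, h5, h6⟩ := h (Fin.tail f)
      refine ⟨?_, fun m hm => ?_, fun i => ?_⟩
      · exact ((Frame.setNat le_rfl _ _ _).trans (Frame.setNat (by norm_num) _ _ _)).trans h4
      · rw [h5 m (by omega)]
        simp [hstep, State.setNat_nat, hm.ne]
      · refine Fin.cases ?_ (fun i => ?_) i
        · rw [Fin.val_zero, add_zero, h5 c (by omega)]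
          simp [hstep, State.setNat_nat]
        · have := h6 i
          rw [Fin.val_succ, ← add_assoc, add_right_comm, this]
          rfl

end RealRAM

namespace RealRAM

/-! ### The algorithm -/

/-- The number of points in the net. -/
noncomputable def netSize (n : ℕ) (ε : ℝ) : ℕ := ⌈84 * (Nat.clog 2 n : ℝ) / ε⌉₊

/-- The number of points in the sample. -/
noncomputable def sampleSize (n : ℕ) (ε : ℝ) : ℕ := ⌈1008 * (Nat.clog 2 n : ℝ) / (ε * ε)⌉₊

/-- The bound on the number of points of the net left out on one side of a rectangle. -/
noncomputable def rankBound (n t : ℕ) (ε : ℝ) : ℕ :=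
  ⌈4 * (netSize n ε : ℝ) * (6 * t + ε * n) / (6 * n)⌉₊

/-- Computes `netSize`, `sampleSize` and `rankBound`. -/
def setup : Program :=
  .seq clogProgram <|
  .seq (ceilProgram 4 (.var 0) (.mul (.ofNat (.const 84)) (.ofNat (.var 3)))) <|
  .seq (ceilProgram 5 (.mul (.var 0) (.var 0)) (.mul (.ofNat (.const 1008)) (.ofNat (.var 3)))) <|
  ceilProgram 6 (.mul (.ofNat (.const 6)) (.ofNat (.var 0)))
    (.mul (.mul (.ofNat (.const 4)) (.ofNat (.var 4)))
      (.add (.mul (.ofNat (.const 6)) (.ofNat (.var 1))) (.mul (.var 0) (.ofNat (.var 0)))))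

/-- The algorithm: for small `n` or large `ε` the initial memory already holds a suitable output,
namely a point; otherwise draw a sample and search. -/
def algorithm : Program :=
  .ite (.and (.not (.natLt (.var 0) (.const 4))) (.realLt (.var 0) (.ofNat (.const 1))))
    (.seq setup (.seq drawProgram (.seq (.setNat 20 (.const 0) (.const 0)) search))) .skip

/-- The data of the search after the sample `f` was drawn. -/
noncomputable def sampleData (n t : ℕ) (ε : ℝ) (p : Fin n → Plane)
    (f : Fin (sampleSize n ε) → Fin n) : Data where
  n := n
  t := t
  k := netSize n ε
  s := sampleSize n ε
  r := rankBound n t ε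
  ε := ε
  point m := if h : m < sampleSize n ε then p (f ⟨m, h⟩) else 0

/-- A bound for the number of steps of the search, up to a constant factor. -/
noncomputable def work (n t : ℕ) (ε : ℝ) : ℕ :=
  netSize n ε ^ 2 *
    (rankBound n t ε ^ 2 * netSize n ε ^ 2 + rankBound n t ε ^ 3 * sampleSize n ε)

section Parameters

variable {n t : ℕ} {ε : ℝ} (hn : 4 ≤ n) (hε : 0 < ε) (hε1 : ε < 1)

include hn in
theorem two_le_clog : 2 ≤ Nat.clog 2 n := by
  have h : Nat.clog 2 4 = 2 := by simpa using Nat.clog_pow 2 2 one_lt_two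
  exact h ▸ Nat.clog_mono_right 2 hn

include hn hε

theorem one_le_netSize : 1 ≤ netSize n ε := by
  have := two_le_clog hn
  exact Nat.one_le_iff_ne_zero.2 (Nat.ceil_pos.2 (by positivity)).ne'

theorem one_le_rankBound : 1 ≤ rankBound n t ε := by
  have := one_le_netSize hn hε
  exact Nat.one_le_iff_ne_zero.2 (Nat.ceil_pos.2 (by positivity)).ne'

include hε1

omit hn in
theorem netSize_le_sampleSize : netSize n ε ≤ sampleSize n ε := by
  refine Nat.ceil_le_ceil ?_
  have : ε * ε ≤ ε := by nlinarith
  gcongr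
  norm_num

omit hn in
theorem clog_le_netSize : Nat.clog 2 n ≤ netSize n ε := by
  rw [← Nat.cast_le (α := ℝ)]
  refine le_trans ?_ (Nat.le_ceil _)
  rw [le_div_iff₀ hε]
  have : (0 : ℝ) ≤ Nat.clog 2 n := by positivity
  nlinarith

end Parameters

theorem computes_setup {n t : ℕ} {ε : ℝ} (hn : 4 ≤ n) (hε : 0 < ε) (p : Fin n → Plane) :
    Computes setup (input n t ε p)
      (20 * Nat.clog 2 n + 65 * netSize n ε + 65 * sampleSize n ε + 65 * rankBound n t ε + 192)
      fun τ => Frame 2 (input n t ε p) τ ∧ τ.nat 4 0 = netSize n ε ∧ τ.nat 5 0 = sampleSize n ε ∧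
        τ.nat 6 0 = rankBound n t ε := by
  set σ := input n t ε p with hσ
  have h0 : σ.nat 0 0 = n := by simp [hσ, input]
  have h1 : σ.nat 1 0 = t := by simp [hσ, input]
  have hr : σ.real 0 0 = ε := by simp [hσ, input]
  refine ((computes_clogProgram σ).seq
    (T' := 65 * netSize n ε + 60 + (65 * sampleSize n ε + 60 + (65 * rankBound n t ε + 60)))
    fun τ₁ ⟨hF₁, hL⟩ => ?_).mono (by rw [h0]; omega) fun _ h => h
  rw [h0] at hL
  refine (computes_ceilProgram (A := ε) (B := 84 * (Nat.clog 2 n : ℝ)) hε (fun τ hF => ?_)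
    (fun τ hF => ?_) (by decide)).seq fun τ₂ ⟨hF₂, hk⟩ => ?_
  · simp only [RealExp.eval, NatExp.eval]
    rw [hF.2 0 (by norm_num), hF₁.2 0 (by norm_num), hr]
  · simp only [RealExp.eval, NatExp.eval]
    rw [hF.1 3 (by norm_num), hL]
    norm_num
  refine (computes_ceilProgram (A := ε * ε) (B := 1008 * (Nat.clog 2 n : ℝ)) (mul_pos hε hε)
    (fun τ hF => ?_) (fun τ hF => ?_) (by decide)).seq fun τ₃ ⟨hF₃, hs⟩ => ?_
  · simp only [RealExp.eval, NatExp.eval]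
    rw [hF.2 0 (by norm_num), hF₂.2 0 (by norm_num), hF₁.2 0 (by norm_num), hr]
  · simp only [RealExp.eval, NatExp.eval]
    rw [hF.1 3 (by norm_num), hF₂.1 3 (by norm_num), hL]
    norm_num
  refine (computes_ceilProgram (A := 6 * (n : ℝ))
    (B := 4 * (netSize n ε : ℝ) * (6 * t + ε * n)) (by positivity)
    (fun τ hF => ?_) (fun τ hF => ?_) (by decide)).mono le_rfl fun τ₄ ⟨hF₄, hr⟩ => ?_
  · simp only [RealExp.eval, NatExp.eval]
    rw [hF.1 0 (by norm_num), hF₃.1 0 (by norm_num), hF₂.1 0 (by norm_num),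
      hF₁.1 0 (by norm_num), h0]
    norm_num
  · simp only [RealExp.eval, NatExp.eval]
    rw [hF.1 4 (by norm_num), hF.1 1 (by norm_num), hF.1 0 (by norm_num), hF.2 0 (by norm_num),
      hF₃.1 4 (by norm_num), hF₃.1 1 (by norm_num), hF₃.1 0 (by norm_num), hF₃.2 0 (by norm_num),
      hF₂.1 1 (by norm_num), hF₂.1 0 (by norm_num), hF₂.2 0 (by norm_num), hk,
      hF₁.1 1 (by norm_num), hF₁.1 0 (by norm_num), hF₁.2 0 (by norm_num), h0, h1, hr]
    norm_num [netSize]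
  · refine ⟨((hF₁.trans (hF₂.anti (by norm_num))).trans (hF₃.anti (by norm_num))).trans
      (hF₄.anti (by norm_num)), ?_, ?_, hr⟩
    · rw [hF₄.1 4 (by norm_num), hF₃.1 4 (by norm_num), hk, netSize]
    · rw [hF₄.1 5 (by norm_num), hs, sampleSize]

/-- The final memory state of the algorithm is a function of a uniformly random sample, and it
records the result of the search. -/
theorem runs_algorithm {n t : ℕ} {ε : ℝ} [NeZero n] (hn : 4 ≤ n) (hε : 0 < ε) (hε1 : ε < 1)
    (p : Fin n → Plane) :
    ∃ G : (Fin (sampleSize n ε) → Fin n) → State,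
      Runs algorithm (input n t ε p) (10000 * work n t ε)
        ((PMF.uniformOfFintype (Fin (sampleSize n ε) → Fin n)).map G) ∧
      ∀ f, (sampleData n t ε p f).Best (sampleData n t ε p f).Eligible (G f) := by
  have hks := netSize_le_sampleSize (n := n) hε hε1
  have hk := one_le_netSize hn hε
  have hr : 1 ≤ rankBound n t ε := one_le_rankBound hn hε
  obtain ⟨τ, hrun, hF, hτk, hτs, hτr⟩ := computes_setup (t := t) hn hε p
  have h0 : τ.nat 0 0 = n := by rw [hF.1 0 (by norm_num)]; simp [input]
  have h1 : τ.nat 1 0 = t := by rw [hF.1 1 (by norm_num)]; simp [input]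
  obtain ⟨F, hdraw, hF'⟩ := runs_drawProgram h0 hτs
  have stored : ∀ f, (sampleData n t ε p f).Stored ((F f).setNat 20 0 0) := fun f => by
    obtain ⟨hFf, hi⟩ := hF' f
    have hFf : Frame 7 τ ((F f).setNat 20 0 0) := hFf.trans (Frame.setNat (by norm_num) _ _ _)
    have hi : ∀ i, ((F f).setNat 20 0 0).nat 7 i = (F f).nat 7 i := fun i => by
      simp [State.setNat_nat]
    have hreal : ∀ a < 3, ((F f).setNat 20 0 0).real a = (input n t ε p).real a := fun a ha => by
      rw [hFf.2 a ha, hF.2 a ha]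
    refine ⟨?_, ?_, ?_, ?_, ?_, ?_, ?_, ?_⟩
    · rw [hFf.1 0 (by norm_num), h0]; rfl
    · rw [hFf.1 1 (by norm_num), h1]; rfl
    · rw [hFf.1 4 (by norm_num), hτk]; rfl
    · rw [hFf.1 5 (by norm_num), hτs]; rfl
    · rw [hFf.1 6 (by norm_num), hτr]; rfl
    · rw [hreal 0 (by norm_num)]; simp [input, sampleData]
    · intro m hm
      change m < sampleSize n ε at hm
      have := (hF' f).2 ⟨m, hm⟩
      simp only at this
      rw [hreal 1 (by norm_num), hi, this]
      simp [input, sampleData, hm]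
    · intro m hm
      change m < sampleSize n ε at hm
      have := (hF' f).2 ⟨m, hm⟩
      simp only at this
      rw [hreal 2 (by norm_num), hi, this]
      simp [input, sampleData, hm]
  have hsupp : ∀ ρ ∈ ((PMF.uniformOfFintype (Fin (sampleSize n ε) → Fin n)).map F).support,
      ∃ ρ', Runs (.seq (.setNat 20 (.const 0) (.const 0)) search) ρ (3 + 9000 * work n t ε)
        (PMF.pure ρ') ∧
        ∀ f, F f = ρ → (sampleData n t ε p f).Best (sampleData n t ε p f).Eligible ρ' := by
    intro ρ hρ
    rw [PMF.support_map] at hρ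
    obtain ⟨f, -, rfl⟩ := hρ
    obtain ⟨ρ', hρ', hbest⟩ := (Computes.setNat (σ := F f) (a := 20) (i := .const 0)
      (e := .const 0) (Q := fun ρ => ρ = (F f).setNat 20 0 0) rfl).seq fun ρ hρ => hρ ▸
        computes_search (E := sampleData n t ε p f) hks hk hr (stored f)
          (by simp [State.setNat_nat])
    refine ⟨ρ', hρ', fun f' hf' => ?_⟩
    -- the sample can be read off from the memory
    have : f' = f := by
      funext i
      apply Fin.ext
      rw [← (hF' f').2 i, ← (hF' f).2 i, hf']
    exact this ▸ hbest
  choose! H hH using hsupp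
  refine ⟨H ∘ F, ?_, fun f => (hH (F f) ?_).2 f rfl⟩
  · have hseq := hrun.seq_pure (Runs.seq (ν := fun ρ => PMF.pure (H ρ)) hdraw
      fun ρ hρ => (hH ρ hρ).1)
    have hlaw : ((PMF.uniformOfFintype (Fin (sampleSize n ε) → Fin n)).map F).bind
        (fun ρ => PMF.pure (H ρ)) =
        (PMF.uniformOfFintype (Fin (sampleSize n ε) → Fin n)).map (H ∘ F) := by
      rw [PMF.bind_map, ← PMF.bind_pure_comp]
      rfl
    rw [hlaw] at hseq
    refine (Runs.ite_true ?_ hseq).mono ?_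
    · simp only [Test.Holds, NatExp.eval, RealExp.eval]
      simp [input, hε1, hn]
    · have hc : (Test.and (.not (.natLt (.var 0) (.const 4)))
          (.realLt (.var 0) (.ofNat (.const 1)))).cost = 11 := by decide
      have hL := clog_le_netSize (n := n) hε hε1
      have hs : sampleSize n ε ≤ work n t ε := by
        have h1 : 1 ≤ netSize n ε ^ 2 := Nat.one_le_pow _ _ hk
        have h2 : 1 ≤ rankBound n t ε ^ 3 := Nat.one_le_pow _ _ hr
        calc sampleSize n ε = 1 * (1 * sampleSize n ε) := by ring
          _ ≤ netSize n ε ^ 2 * (rankBound n t ε ^ 3 * sampleSize n ε) := by gcongr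
          _ ≤ work n t ε := Nat.mul_le_mul_left _ (Nat.le_add_left _ _)
      have hr' : rankBound n t ε ≤ work n t ε := by
        have h1 : 1 ≤ netSize n ε ^ 2 := Nat.one_le_pow _ _ hk
        calc rankBound n t ε ≤ rankBound n t ε ^ 2 := Nat.le_self_pow two_ne_zero _
          _ = 1 * (rankBound n t ε ^ 2 * 1) := by ring
          _ ≤ netSize n ε ^ 2 * (rankBound n t ε ^ 2 * netSize n ε ^ 2) := by gcongr
          _ ≤ work n t ε := Nat.mul_le_mul_left _ (Nat.le_add_right _ _)
      rw [hc]
      omega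
  · rw [PMF.support_map]
    exact ⟨f, by simp, rfl⟩

end RealRAM

/-! ### Correctness on typical samples -/

open Finset Classical in
theorem Rectangle.enclosed_eq_card {n : ℕ} {X : Finset Plane} {p : Fin n → Plane}
    (hp : p.Injective) (hX : Set.range p = X) (R : Rectangle) :
    R.enclosed X = (univ.filter fun q => p q ∈ R.region).card := by
  rw [Rectangle.enclosed, ← hX, ← card_image_of_injective _ hp, ← Set.ncard_coe_finset]
  congr 1
  ext z
  simp only [Set.mem_inter_iff, Set.mem_range, coe_image, coe_filter, mem_univ, true_and,
    Set.mem_image, Set.mem_ofPred_eq]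
  constructor
  · rintro ⟨⟨q, rfl⟩, h⟩
    exact ⟨q, h, rfl⟩
  · rintro ⟨q, h, rfl⟩
    exact ⟨⟨q, rfl⟩, h⟩

namespace RealRAM

section Correctness

variable {n t : ℕ} {ε : ℝ} {p : Fin n → Plane} {f : Fin (sampleSize n ε) → Fin n}

theorem sampleData_point {m : ℕ} (hm : m < sampleSize n ε) :
    (sampleData n t ε p f).point m = p (f ⟨m, hm⟩) := by
  simp [sampleData, hm]

open Finset Classical in
theorem content_eq {e : Fin 5 → ℕ} (he : ∀ l, e l < sampleSize n ε) :
    (sampleData n t ε p f).content e =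
      (univ.filter fun i => p (f i) ∈ pinnedBox (p ∘ fun l => f ⟨e l, he l⟩)).card := by
  have hpt : (sampleData n t ε p f).point ∘ e = p ∘ fun l => f ⟨e l, he l⟩ :=
    funext fun l => sampleData_point (he l)
  rw [Data.content, hpt, ← card_map Fin.valEmbedding]
  congr 1
  ext m
  simp only [mem_filter, mem_range, mem_map, mem_univ, true_and, Fin.valEmbedding_apply]
  constructor
  · rintro ⟨hm, h⟩
    exact ⟨⟨m, hm⟩, by rwa [sampleData_point hm] at h, rfl⟩
  · rintro ⟨i, h, rfl⟩
    exact ⟨i.2, by rwa [sampleData_point i.2]⟩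

/-- The positions of the net in the sample. -/
noncomputable def net (n : ℕ) (ε : ℝ) : Finset (Fin (sampleSize n ε)) :=
  Finset.univ.filter fun i => i.val < netSize n ε

theorem card_net (hε : 0 < ε) (hε1 : ε < 1) : (net n ε).card = netSize n ε := by
  have h := netSize_le_sampleSize (n := n) hε hε1
  rw [net, Fin.card_filter_val_lt, min_eq_right h]

open Finset Classical in
/-- On a typical sample the bounding rectangle of minimum area of the net points in `Y` is eligible,
and it passes the test. -/
theorem exists_eligible (hε : 0 < ε) (hε1 : ε < 1) (hn : 0 < n)
    {R : Rectangle} {Y : Finset (Fin n)} (hY : ∀ q ∈ Y, p q ∈ R.region)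
    (hYcard : n ≤ Y.card + t) (hp : p.Injective)
    (hf : Typical p Y (net n ε) (t / n) (ε / 6) f) :
    ∃ e ∈ (sampleData n t ε p f).Eligible, (sampleData n t ε p f).Passes e ∧
      pinnedArea ((sampleData n t ε p f).point ∘ e) ≤ R.area := by
  set E := sampleData n t ε p f with hE
  have hks := netSize_le_sampleSize (n := n) hε hε1
  have hN : (0 : ℝ) < n := by exact_mod_cast hn
  -- the positions in the net of the points in `Y`
  set Z : Finset ℕ := ((net n ε).filter fun i => f i ∈ Y).image Fin.val with hZ
  have hZk : ∀ m ∈ Z, m < netSize n ε := by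
    intro m hm
    simp only [hZ, net, mem_image, mem_filter, mem_univ, true_and] at hm
    obtain ⟨i, ⟨hi, -⟩, rfl⟩ := hm
    exact hi
  have hZs : ∀ m ∈ Z, m < sampleSize n ε := fun m hm => (hZk m hm).trans_le hks
  have hZR : ∀ z ∈ Z.image E.point, z ∈ R.region := by
    intro z hz
    simp only [hZ, mem_image, mem_filter] at hz
    obtain ⟨_, ⟨i, ⟨-, hi⟩, rfl⟩, rfl⟩ := hz
    rw [hE, sampleData_point i.2]
    exact hY _ hi
  have hmem : ∀ i ∈ net n ε, f i ∈ Y → i.val ∈ Z := fun i hi hiY =>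
    mem_image.2 ⟨i, mem_filter.2 ⟨hi, hiY⟩, rfl⟩
  have hnt : (Z.image E.point).Nontrivial := by
    obtain ⟨i, hi, hiY, -⟩ := hf.several ⟨0, hn⟩
    obtain ⟨j, hj, hjY, hji⟩ := hf.several (f i)
    refine ⟨E.point i, mem_image_of_mem _ (hmem i hi hiY), E.point j,
      mem_image_of_mem _ (hmem j hj hjY), fun h => hji ?_⟩
    rw [hE, sampleData_point i.2, sampleData_point j.2] at h
    exact (hp h).symm
  have hZne : Z.Nonempty := hnt.nonempty.of_image
  obtain ⟨e', he', hne, hbox, harea⟩ := exists_pinned_area_le hnt hZR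
  choose g hgZ hg using fun l => mem_image.1 (he' l)
  -- few net points are outside of `Y`, so few come before the first point in `Y`
  have hout : ((range (netSize n ε)).filter fun m => m ∉ Z).card < rankBound n t ε := by
    have h1 : ((range (netSize n ε)).filter fun m => m ∉ Z) ⊆
        ((net n ε).filter fun i => f i ∉ Y).image Fin.val := by
      intro m hm
      rw [mem_filter, mem_range] at hm
      have hi : (⟨m, hm.1.trans_le hks⟩ : Fin (sampleSize n ε)) ∈ net n ε := by
        simpa [net] using hm.1
      exact mem_image.2 ⟨_, mem_filter.2 ⟨hi, fun h => hm.2 (hmem _ hi h)⟩, rfl⟩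
    have h2 := hf.few
    rw [card_net hε hε1] at h2
    have h3 : (4 * netSize n ε * (t / n + ε / 6) : ℝ) ≤ rankBound n t ε := by
      refine le_trans (le_of_eq ?_) (Nat.le_ceil _)
      field_simp
    have h4 := (card_le_card h1).trans card_image_le
    rw [← Nat.cast_lt (α := ℝ)]
    exact ((Nat.cast_le.2 h4).trans_lt h2).trans_le h3
  set i := g 0
  set j := g 1
  have hi : E.point i = e' 0 := hg 0
  have hj : E.point j = e' 1 := hg 1
  obtain ⟨a, ha, hamin, harank⟩ :=
    exists_rank_le (N := netSize n ε) (fun m => along (E.point i) (E.point j) (E.point m)) hZne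
  obtain ⟨b, hb, hbmin, hbrank⟩ :=
    exists_rank_le (N := netSize n ε) (fun m => -along (E.point i) (E.point j) (E.point m)) hZne
  obtain ⟨c, hc, hcmin, hcrank⟩ :=
    exists_rank_le (N := netSize n ε) (fun m => -across (E.point i) (E.point j) (E.point m)) hZne
  have inBox : ∀ m ∈ Z, E.point m ∈ pinnedBox e' := fun m hm =>
    hbox (by simpa using mem_image_of_mem E.point hm)
  have ea : along (e' 0) (e' 1) (E.point a) = along (e' 0) (e' 1) (e' 2) := by
    have := hamin (g 2) (hgZ 2)
    simp only [hi, hj, hg] at this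
    exact le_antisymm this (inBox a ha).1
  have eb : along (e' 0) (e' 1) (E.point b) = along (e' 0) (e' 1) (e' 3) := by
    have := hbmin (g 3) (hgZ 3)
    simp only [hi, hj, hg, neg_le_neg_iff] at this
    exact le_antisymm (inBox b hb).2.1 this
  have ec : across (e' 0) (e' 1) (E.point c) = across (e' 0) (e' 1) (e' 4) := by
    have := hcmin (g 4) (hgZ 4)
    simp only [hi, hj, hg, neg_le_neg_iff] at this
    exact le_antisymm (inBox c hc).2.2.2 this
  set e : Fin 5 → ℕ := ![i, j, a, b, c] with he
  have heZ : ∀ l, e l ∈ Z := by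
    intro l
    fin_cases l
    exacts [hgZ 0, hgZ 1, ha, hb, hc]
  have hes : ∀ l, e l < sampleSize n ε := fun l => hZs _ (heZ l)
  have hboxe : pinnedBox (E.point ∘ e) = pinnedBox e' := by
    simp only [pinnedBox, Function.comp_apply, he, Matrix.cons_val, hi, hj, ea, eb, ec]
  have hareae : pinnedArea (E.point ∘ e) = pinnedArea e' := by
    simp only [pinnedArea, pinnedWidth, pinnedHeight, Function.comp_apply, he, Matrix.cons_val,
      hi, hj, ea, eb, ec]
  have hD : 0 < distSq (E.point (e 0)) (E.point (e 1)) := by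
    have : E.point (e 0) = e' 0 := hi
    rw [this, show E.point (e 1) = e' 1 from hj]
    exact distSq_pos hne
  refine ⟨e, ⟨fun l => hZk _ (heZ l), hD, harank.trans_lt hout, hbrank.trans_lt hout,
    hcrank.trans_lt hout⟩, ⟨hes, hD, ?_⟩, hareae ▸ harea⟩
  have hpe : (p ∘ fun l => f ⟨e l, hes l⟩) = E.point ∘ e :=
    (funext fun l => sampleData_point (hes l)).symm
  have hhit := hf.hits (fun l => f ⟨e l, hes l⟩) fun i hi hiY => by
    rw [hpe, hboxe, ← sampleData_point (t := t) (p := p) i.2]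
    exact inBox _ (hmem i hi hiY)
  have hest := (abs_lt.1 (hf.estimates fun l => f ⟨e l, hes l⟩)).1
  rw [hE, content_eq hes]
  set B := pinnedBox (p ∘ fun l => f ⟨e l, hes l⟩)
  have hsplit : (Y.filter fun q => p q ∈ B).card + (Y.filter fun q => p q ∉ B).card = Y.card :=
    card_filter_add_card_filter_not _
  have hle : (Y.filter fun q => p q ∈ B).card ≤ (univ.filter fun q => p q ∈ B).card :=
    card_le_card (filter_subset_filter _ (subset_univ _))
  have hlow : (n : ℝ) - t - ε / 6 * n ≤ (univ.filter fun q => p q ∈ B).card := by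
    have h1 : (n : ℝ) ≤ (univ.filter fun q => p q ∈ B).card +
        (Y.filter fun q => p q ∉ B).card + t := by
      exact_mod_cast (by omega : n ≤ (univ.filter fun q => p q ∈ B).card +
        (Y.filter fun q => p q ∉ B).card + t)
    linarith
  have hmul := mul_le_mul_of_nonneg_right hlow (Nat.cast_nonneg (α := ℝ) (sampleSize n ε))
  change (sampleSize n ε : ℝ) * (3 * n - 3 * t - ε * n) ≤ _ * (3 * (n : ℝ))
  linarith

open Finset Classical in
/-- On a typical sample, rectangles that pass the test contain many of the points. -/
theorem enclosed_of_passes {X : Finset Plane} (hε : 0 < ε) (hε1 : ε < 1) (hn : 4 ≤ n)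
    (ht : 2 * t ≤ n) (hp : p.Injective) (hX : Set.range p = X) {Y : Finset (Fin n)}
    (hf : Typical p Y (net n ε) (t / n) (ε / 6) f) {e : Fin 5 → ℕ}
    (he : (sampleData n t ε p f).Passes e) :
    (pinnedRectangle ((sampleData n t ε p f).point ∘ e)).area =
        pinnedArea ((sampleData n t ε p f).point ∘ e) ∧
      ((n : ℝ) - t) * (1 - ε) ≤
        (pinnedRectangle ((sampleData n t ε p f).point ∘ e)).enclosed X := by
  obtain ⟨hes, hD, hcount⟩ := he
  have hpe : (p ∘ fun l => f ⟨e l, hes l⟩) = (sampleData n t ε p f).point ∘ e :=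
    (funext fun l => sampleData_point (hes l)).symm
  have hs : (0 : ℝ) < sampleSize n ε := by
    exact_mod_cast (one_le_netSize hn hε).trans (netSize_le_sampleSize hε hε1)
  have hN : (4 : ℝ) ≤ n := by exact_mod_cast hn
  have ht' : 2 * (t : ℝ) ≤ n := by exact_mod_cast ht
  have hest := (abs_lt.1 (hf.estimates fun l => f ⟨e l, hes l⟩)).2
  rw [content_eq hes] at hcount
  change (sampleSize n ε : ℝ) * (3 * n - 3 * t - ε * n) ≤ _ * (3 * (n : ℝ)) at hcount
  -- at least one sample point is in the box
  have hpos : 0 < (univ.filter fun i =>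
      p (f i) ∈ pinnedBox (p ∘ fun l => f ⟨e l, hes l⟩)).card := by
    rw [← Nat.cast_pos (α := ℝ)]
    have : 0 < (sampleSize n ε : ℝ) * (3 * n - 3 * t - ε * n) := mul_pos hs (by nlinarith)
    by_contra! hc
    nlinarith
  obtain ⟨i, hi⟩ := card_pos.1 hpos
  rw [mem_filter, hpe] at hi
  obtain ⟨harea, hreg⟩ := pinnedRectangle_of_mem (e := (sampleData n t ε p f).point ∘ e) hD hi.2
  refine ⟨harea, ?_⟩
  rw [Rectangle.enclosed_eq_card hp hX, hreg, ← hpe]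
  set B := pinnedBox (p ∘ fun l => f ⟨e l, hes l⟩)
  have h1 : (sampleSize n ε : ℝ) * (n - t - ε / 2 * n) ≤
      (univ.filter fun q => p q ∈ B).card * sampleSize n ε := by nlinarith
  rw [mul_comm, mul_le_mul_iff_left₀ hs] at h1
  refine le_trans ?_ h1
  nlinarith

theorem exists_output {X : Finset Plane} (hε : 0 < ε) (hε1 : ε < 1) (hn : 4 ≤ n)
    (ht : 2 * t ≤ n) (hp : p.Injective) (hX : Set.range p = X) (hcard : X.card = n)
    (hcol : NoThreeCollinear X) {R : Rectangle} (hRopt : R.area ≤ optArea X t)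
    {Y : Finset (Fin n)} (hY : ∀ q ∈ Y, p q ∈ R.region) (hYcard : n ≤ Y.card + t)
    (hf : Typical p Y (net n ε) (t / n) (ε / 6) f) {σ : State}
    (hσ : (sampleData n t ε p f).Best (sampleData n t ε p f).Eligible σ) :
    ∃ R : Rectangle, Outputs σ R ∧ R.area ≤ optArea X t ∧
      ((n : ℝ) - t) * (1 - ε) ≤ R.enclosed X ∧ (R.enclosed X : ℝ) ≤ (n : ℝ) - t + 1 := by
  obtain ⟨e, heE, heP, hearea⟩ := exists_eligible hε hε1 (by omega) hY hYcard hp hf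
  obtain ⟨h1, h2⟩ := hσ.1 e heE heP
  obtain ⟨-, e', he', h3, h4⟩ := hσ.2.resolve_left (by omega)
  obtain ⟨h5, h6⟩ := enclosed_of_passes hε hε1 hn ht hp hX hf he'
  have hopt := (h5.trans h3.symm).le.trans (h2.trans (hearea.trans hRopt))
  refine ⟨_, h4, hopt, h6, ?_⟩
  have := enclosed_le_of_area_le hcol (by omega) hopt
  rw [hcard] at this
  have h7 : ((pinnedRectangle ((sampleData n t ε p f).point ∘ e')).enclosed X : ℝ) + t ≤
      n + 1 := by exact_mod_cast this
  linarith

end Correctness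

end RealRAM

namespace RealRAM

/-! ### Running time and success probability -/

section Bounds

variable {n t : ℕ} {ε : ℝ}

theorem log_le_clog (hn : 0 < n) : Real.log n ≤ Nat.clog 2 n := by
  have hN : (0 : ℝ) < n := by exact_mod_cast hn
  have h1 : (n : ℝ) ≤ 2 ^ Nat.clog 2 n := by exact_mod_cast Nat.le_pow_clog one_lt_two n
  have h2 := Real.log_le_log hN h1
  rw [Real.log_pow] at h2
  have h3 := Real.log_two_lt_d9
  have h4 : (0 : ℝ) ≤ Nat.clog 2 n := Nat.cast_nonneg _
  nlinarith

theorem clog_le_log (hn : 4 ≤ n) : (Nat.clog 2 n : ℝ) ≤ 3 * Real.log n := by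
  have hN : (4 : ℝ) ≤ n := by exact_mod_cast hn
  have h2 := two_le_clog hn
  obtain ⟨l, hl⟩ : ∃ l, Nat.clog 2 n = l + 1 := ⟨Nat.clog 2 n - 1, by omega⟩
  have h1 : (2 : ℝ) ^ l ≤ n := by
    exact_mod_cast ((Nat.lt_clog_iff_pow_lt one_lt_two).1 (by omega)).le
  have h3 := Real.log_le_log (by positivity) h1
  rw [Real.log_pow] at h3
  have h4 := Real.log_two_gt_d9
  have h5 : (1 : ℝ) ≤ l := by exact_mod_cast (by omega : 1 ≤ l)
  rw [hl]
  push_cast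
  nlinarith

theorem one_le_log (hn : 4 ≤ n) : 1 ≤ Real.log n := by
  have h := clog_le_log hn
  have hN : (4 : ℝ) ≤ n := by exact_mod_cast hn
  have h1 : Real.log 4 ≤ Real.log n := Real.log_le_log (by norm_num) hN
  have h2 : Real.log 4 = 2 * Real.log 2 := by
    rw [show (4 : ℝ) = 2 ^ 2 by norm_num, Real.log_pow]; norm_num
  linarith [Real.log_two_gt_d9]

/-- The exponent of `1 / ε` in the cost of the search is smaller than the one allowed, which makes
up for its larger exponent of the logarithm, unless `1 / ε` is bounded by a power of `log n`; in the
latter case the search takes only linear time. -/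
theorem log_pow_div_le {τ : ℝ} (hn : 4 ≤ n) (hε : 0 < ε) (hτ : 0 ≤ τ) (hτ2 : τ ≤ 2) :
    Real.log n ^ 6 * τ ^ 3 / ε ^ 7 ≤
      8 * (Nat.factorial 20 : ℝ) * ((Real.log n / ε ^ 2) ^ 4 * τ ^ 3 + n) := by
  set l := Real.log n with hl
  have hl1 : 1 ≤ l := one_le_log hn
  have hN : (4 : ℝ) ≤ n := by exact_mod_cast hn
  have hfac : (1 : ℝ) ≤ Nat.factorial 20 := by exact_mod_cast Nat.factorial_pos 20
  have hA : 0 ≤ (l / ε ^ 2) ^ 4 * τ ^ 3 := by positivity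
  by_cases h : l ^ 2 * ε ≤ 1
  · have h1 : l ^ 6 * τ ^ 3 / ε ^ 7 = (l / ε ^ 2) ^ 4 * τ ^ 3 * (l ^ 2 * ε) := by
      field_simp
    rw [h1]
    calc (l / ε ^ 2) ^ 4 * τ ^ 3 * (l ^ 2 * ε) ≤ (l / ε ^ 2) ^ 4 * τ ^ 3 * 1 := by gcongr
      _ ≤ 1 * ((l / ε ^ 2) ^ 4 * τ ^ 3 + n) := by linarith
      _ ≤ _ := by gcongr; linarith
  · push Not at h
    have h1 : 1 / ε ≤ l ^ 2 := by rw [div_le_iff₀ hε]; exact h.le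
    have h2 : l ^ 20 / (Nat.factorial 20 : ℝ) ≤ n := by
      have := Real.pow_div_factorial_le_exp l (by linarith) 20
      rwa [hl, Real.exp_log (by linarith)] at this
    rw [div_le_iff₀ (by linarith)] at h2
    calc l ^ 6 * τ ^ 3 / ε ^ 7 = l ^ 6 * τ ^ 3 * (1 / ε) ^ 7 := by field_simp
      _ ≤ l ^ 6 * 2 ^ 3 * (l ^ 2) ^ 7 := by gcongr
      _ = 8 * l ^ 20 := by ring
      _ ≤ 8 * (n * (Nat.factorial 20 : ℝ)) := by gcongr
      _ = 8 * (Nat.factorial 20 : ℝ) * (0 + n) := by ring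
      _ ≤ _ := by gcongr

/-- A constant for the running time of the search. -/
def workConstant : ℝ := 253 ^ 4 * 1013 ^ 2 + 253 ^ 2 * 1013 ^ 3 * 3025

theorem work_le (hn : 4 ≤ n) (hε : 0 < ε) (hε1 : ε < 1) :
    (work n t ε : ℝ) ≤ workConstant * (Real.log n ^ 6 * ((t : ℝ) / n + ε) ^ 3 / ε ^ 7) := by
  set l := Real.log n with hl
  set τ := (t : ℝ) / n + ε with hτ
  have hN : (4 : ℝ) ≤ n := by exact_mod_cast hn
  have hl1 : 1 ≤ l := one_le_log hn
  have hL := clog_le_log hn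
  have ht0 : (0 : ℝ) ≤ t / n := by positivity
  have hετ : ε ≤ τ := by linarith
  have hτ0 : 0 < τ := by linarith
  have hlε : 1 ≤ l / ε := by rw [one_le_div hε]; linarith
  have hlε2 : 1 ≤ l / ε ^ 2 := by rw [one_le_div (by positivity)]; nlinarith
  have hlτε : 1 ≤ l * τ / ε := by rw [one_le_div hε]; nlinarith
  have hk : (netSize n ε : ℝ) ≤ 253 * (l / ε) := by
    have h1 := Nat.ceil_lt_add_one (a := 84 * (Nat.clog 2 n : ℝ) / ε) (by positivity)
    have h2 : 84 * (Nat.clog 2 n : ℝ) / ε ≤ 84 * (3 * l) / ε := by gcongr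
    have h3 : 84 * (3 * l) / ε = 252 * (l / ε) := by ring
    unfold netSize
    linarith
  have hs : (sampleSize n ε : ℝ) ≤ 3025 * (l / ε ^ 2) := by
    have h1 := Nat.ceil_lt_add_one (a := 1008 * (Nat.clog 2 n : ℝ) / (ε * ε)) (by positivity)
    have h2 : 1008 * (Nat.clog 2 n : ℝ) / (ε * ε) ≤ 1008 * (3 * l) / (ε * ε) := by gcongr
    have h3 : 1008 * (3 * l) / (ε * ε) = 3024 * (l / ε ^ 2) := by ring
    unfold sampleSize
    linarith
  have hr : (rankBound n t ε : ℝ) ≤ 1013 * (l * τ / ε) := by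
    have h1 := Nat.ceil_lt_add_one (a := 4 * (netSize n ε : ℝ) * (6 * t + ε * n) / (6 * n))
      (by positivity)
    have h2 : 4 * (netSize n ε : ℝ) * (6 * t + ε * n) / (6 * n) =
        4 * netSize n ε * (t / n + ε / 6) := by field_simp
    have h3 : 4 * (netSize n ε : ℝ) * (t / n + ε / 6) ≤ 4 * (253 * (l / ε)) * τ := by
      gcongr
      linarith
    have h4 : 4 * (253 * (l / ε)) * τ = 1012 * (l * τ / ε) := by ring
    unfold rankBound
    linarith
  have h1 : ((work n t ε : ℕ) : ℝ) ≤ (253 * (l / ε)) ^ 2 * ((1013 * (l * τ / ε)) ^ 2 *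
      (253 * (l / ε)) ^ 2 + (1013 * (l * τ / ε)) ^ 3 * (3025 * (l / ε ^ 2))) := by
    rw [work]
    push_cast
    gcongr
  refine h1.trans ?_
  have h2 : l ^ 6 * τ ^ 2 / ε ^ 6 ≤ l ^ 6 * τ ^ 3 / ε ^ 7 := by
    have h3 : l ^ 6 * τ ^ 3 / ε ^ 7 = l ^ 6 * τ ^ 2 / ε ^ 6 * (τ / ε) := by field_simp
    rw [h3]
    exact le_mul_of_one_le_right (by positivity) ((one_le_div hε).2 hετ)
  have h3 : (253 * (l / ε)) ^ 2 * ((1013 * (l * τ / ε)) ^ 2 * (253 * (l / ε)) ^ 2 +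
      (1013 * (l * τ / ε)) ^ 3 * (3025 * (l / ε ^ 2))) =
      253 ^ 4 * 1013 ^ 2 * (l ^ 6 * τ ^ 2 / ε ^ 6) +
        253 ^ 2 * 1013 ^ 3 * 3025 * (l ^ 6 * τ ^ 3 / ε ^ 7) := by
    field_simp
  rw [h3, workConstant, add_mul]
  gcongr

open Finset Classical in
/-- A bound `c` for the fraction of bad outcomes `f` of a uniform draw gives a lower bound for the
probability that `G f` lies in `S`. -/
theorem le_toOuterMeasure_map {Ω α : Type*} [Fintype Ω] [Nonempty Ω] {G : Ω → α} {S : Set α}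
    {c : ℝ} (good : Ω → Prop) (hgood : ∀ f, good f → G f ∈ S)
    (hc : ((univ.filter fun f => ¬ good f).card : ℝ) ≤ c * Fintype.card Ω) :
    ENNReal.ofReal (1 - c) ≤ ((PMF.uniformOfFintype Ω).map G).toOuterMeasure S := by
  have hcard : (0 : ℝ) < Fintype.card Ω := by exact_mod_cast Fintype.card_pos
  have hsum : ((univ.filter fun f => good f).card : ℝ) + (univ.filter fun f => ¬ good f).card =
      Fintype.card Ω := by
    exact_mod_cast (card_filter_add_card_filter_not (s := (univ : Finset Ω)) good).trans card_univ
  have hS : (univ.filter fun f => good f).card ≤ Fintype.card (G ⁻¹' S) := by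
    rw [← Set.toFinset_card]
    exact card_le_card fun f hf => by simpa using hgood f (mem_filter.1 hf).2
  rw [PMF.toOuterMeasure_map_apply, PMF.toOuterMeasure_uniformOfFintype_apply]
  calc ENNReal.ofReal (1 - c)
      ≤ ENNReal.ofReal (Fintype.card (G ⁻¹' S) / Fintype.card Ω) := by
        refine ENNReal.ofReal_le_ofReal ?_
        rw [le_div_iff₀ hcard]
        have : ((univ.filter fun f => good f).card : ℝ) ≤ Fintype.card (G ⁻¹' S) := by
          exact_mod_cast hS
        linarith
    _ = _ := by
        rw [ENNReal.ofReal_div_of_pos hcard, ENNReal.ofReal_natCast, ENNReal.ofReal_natCast]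

/-- The success probability of the algorithm on the main branch. -/
theorem le_probability [NeZero n] {X : Finset Plane} {p : Fin n → Plane} (hε : 0 < ε)
    (hε1 : ε < 1) (hn : 4 ≤ n) (ht : 2 * t ≤ n) (hcard : X.card = n) (hX : Set.range p = X)
    (hcol : NoThreeCollinear X) {G : (Fin (sampleSize n ε) → Fin n) → State}
    (hG : ∀ f, (sampleData n t ε p f).Best (sampleData n t ε p f).Eligible (G f)) :
    ENNReal.ofReal (1 - 3 / (n : ℝ)) ≤
      ((PMF.uniformOfFintype (Fin (sampleSize n ε) → Fin n)).map G).toOuterMeasure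
        {σ | ∃ R : Rectangle, Outputs σ R ∧ R.area ≤ optArea X t ∧
          ((n : ℝ) - (t : ℝ)) * (1 - ε) ≤ (R.enclosed X : ℝ) ∧
          (R.enclosed X : ℝ) ≤ (n : ℝ) - (t : ℝ) + 1} := by
  classical
  have hN : (4 : ℝ) ≤ n := by exact_mod_cast hn
  have htR : 2 * (t : ℝ) ≤ n := by exact_mod_cast ht
  have hp : p.Injective := by
    rw [← Set.ncard_coe_finset, ← hX, ← Set.image_univ] at hcard
    have := Set.injOn_of_ncard_image_eq (f := p) (s := Set.univ) (by
      rw [hcard, Set.ncard_univ, Nat.card_eq_fintype_card, Fintype.card_fin])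
    exact Set.injOn_univ.1 this
  obtain ⟨R, hR, hRopt⟩ := exists_area_le_optArea (X := X) (t := t) (by omega)
  rw [hcard, Rectangle.enclosed_eq_card hp hX] at hR
  set Y := Finset.univ.filter fun q => p q ∈ R.region with hY
  have hYR : (n : ℝ) ≤ Y.card + t := by
    rw [hY]
    exact_mod_cast hR
  refine le_toOuterMeasure_map (Typical p Y (net n ε) (t / n) (ε / 6)) (fun f hf =>
    exists_output hε hε1 hn ht hp hX hcard hcol hRopt (fun q hq => (Finset.mem_filter.1 hq).2)
      (by convert hR) hf (hG f)) ?_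
  have hlog := log_le_clog (n := n) (by omega)
  rw [Fintype.card_fun, Fintype.card_fin, Fintype.card_fin, Nat.cast_pow]
  refine card_not_typical_le (by omega) p (by linarith) (by linarith) (by positivity) ?_
    (fun q => ?_) ?_ ?_
  · rw [div_mul_cancel₀ _ (by linarith)]
    have h1 := Finset.card_add_card_compl Y
    rw [Fintype.card_fin] at h1
    have h2 : (Y.card : ℝ) + Yᶜ.card = n := by exact_mod_cast h1
    linarith
  · have h1 : (Y.card : ℝ) ≤ (Y.erase q).card + 1 := by
      exact_mod_cast Nat.sub_le_iff_le_add.1 (Finset.pred_card_le_card_erase (s := Y) (a := q))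
    nlinarith
  · rw [card_net hε hε1]
    have h1 := Nat.le_ceil (84 * (Nat.clog 2 n : ℝ) / ε)
    rw [div_le_iff₀ hε] at h1
    unfold netSize
    linarith
  · have h1 := Nat.le_ceil (1008 * (Nat.clog 2 n : ℝ) / (ε * ε))
    rw [div_le_iff₀ (by positivity)] at h1
    unfold sampleSize
    linarith

end Bounds

/-- Without any run of the search, the output is a rectangle that is a point. -/
theorem exists_output_input {n t : ℕ} {ε : ℝ} {X : Finset Plane} (p : Fin n → Plane)
    (ht : 2 * t ≤ n) (hε : 1 ≤ ε) :
    ∃ R : Rectangle, Outputs (input n t ε p) R ∧ R.area ≤ optArea X t ∧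
      ((n : ℝ) - t) * (1 - ε) ≤ R.enclosed X ∧ (R.enclosed X : ℝ) ≤ (n : ℝ) - t + 1 := by
  have hnt : (t : ℝ) ≤ n := by exact_mod_cast (by omega : t ≤ n)
  refine ⟨⟨0, 0, 0, by simp⟩, ?_, ?_, ?_, ?_⟩
  · simp [Outputs, input]
  · rw [Rectangle.area, norm_zero, zero_mul]
    exact optArea_nonneg X t
  · have h1 : ((n : ℝ) - t) * (1 - ε) ≤ 0 :=
      mul_nonpos_of_nonneg_of_nonpos (by linarith) (by linarith)
    exact h1.trans (Nat.cast_nonneg _)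
  · have h1 : Rectangle.enclosed ⟨0, 0, 0, by simp⟩ X ≤ 1 := by
      rw [Rectangle.enclosed]
      refine (Set.ncard_le_ncard (t := {0}) ?_ (Set.finite_singleton 0)).trans
        (Set.ncard_singleton _).le
      rintro _ ⟨-, a, -, b, -, rfl⟩
      simp
    have h2 : (Rectangle.enclosed ⟨0, 0, 0, by simp⟩ X : ℝ) ≤ 1 := by exact_mod_cast h1
    linarith

end RealRAM

theorem theorem2 :
    ∃ (P : RealRAM.Program) (C : ℝ) (poly : MvPolynomial (Fin 3) ℝ),
      ∀ (n t : ℕ) (ε : ℝ) (X : Finset Plane) (p : Fin n → Plane),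
        0 < n → 2 * t ≤ n → 0 < ε →
        X.card = n → Set.range p = (X : Set Plane) → NoThreeCollinear X →
        ∃ (T : ℕ) (μ : PMF RealRAM.State),
          RealRAM.Runs P (RealRAM.input n t ε p) T μ ∧
          ENNReal.ofReal (1 - 3 / (n : ℝ)) ≤
            μ.toOuterMeasure
              {σ | ∃ R : Rectangle, RealRAM.Outputs σ R ∧
                R.area ≤ optArea X t ∧
                ((n : ℝ) - (t : ℝ)) * (1 - ε) ≤ (R.enclosed X : ℝ) ∧
                (R.enclosed X : ℝ) ≤ (n : ℝ) - (t : ℝ) + 1} ∧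
          (T : ℝ) ≤
            C * ((Real.log n / ε ^ 2) ^ 4 * ((t : ℝ) / (n : ℝ) + ε) ^ 3 + (n : ℝ)) ∧
          (T : ℝ) ≤ C * (n : ℝ) + MvPolynomial.eval ![Real.log n, (t : ℝ), 1 / ε] poly := by
  classical
  set C : ℝ := 10000 * RealRAM.workConstant * (8 * (Nat.factorial 20 : ℝ)) with hC
  have hfac : (1 : ℝ) ≤ Nat.factorial 20 := by exact_mod_cast Nat.factorial_pos 20
  have hC1 : 100 ≤ C := by
    rw [hC, RealRAM.workConstant]
    nlinarith
  refine ⟨RealRAM.algorithm, C, MvPolynomial.C C * MvPolynomial.X 0 ^ 4 *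
    MvPolynomial.X 2 ^ 8 * (MvPolynomial.X 1 + 1) ^ 3, ?_⟩
  intro n t ε X p hn ht hε hcard hX hcol
  have hN : (1 : ℝ) ≤ n := by exact_mod_cast hn
  have hlog : 0 ≤ Real.log n := Real.log_nonneg hN
  simp only [map_mul, map_pow, map_add, map_one, MvPolynomial.eval_C, MvPolynomial.eval_X,
    Matrix.cons_val]
  by_cases hbr : 4 ≤ n ∧ ε < 1
  · obtain ⟨hn4, hε1⟩ := hbr
    have : NeZero n := ⟨hn.ne'⟩
    obtain ⟨G, hrun, hG⟩ := RealRAM.runs_algorithm (t := t) hn4 hε hε1 p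
    have hτ2 : (t : ℝ) / n + ε ≤ 2 := by
      have : (t : ℝ) / n ≤ 1 := by
        rw [div_le_one (by linarith)]
        exact_mod_cast (by omega : t ≤ n)
      linarith
    have hτ0 : 0 ≤ (t : ℝ) / n + ε := by positivity
    have htime : ((10000 * RealRAM.work n t ε : ℕ) : ℝ) ≤
        C * ((Real.log n / ε ^ 2) ^ 4 * ((t : ℝ) / (n : ℝ) + ε) ^ 3 + (n : ℝ)) := by
      have h1 := RealRAM.work_le (t := t) hn4 hε hε1
      have h2 := RealRAM.log_pow_div_le (n := n) hn4 hε hτ0 hτ2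
      have h3 : 0 ≤ RealRAM.workConstant := by rw [RealRAM.workConstant]; norm_num
      push_cast
      rw [hC, mul_assoc, mul_assoc]
      refine mul_le_mul_of_nonneg_left (h1.trans ?_) (by norm_num)
      exact mul_le_mul_of_nonneg_left h2 h3
    refine ⟨_, _, hrun, RealRAM.le_probability hε hε1 hn4 ht hcard hX hcol hG, htime,
      htime.trans ?_⟩
    have hτ : (t : ℝ) / n + ε ≤ t + 1 := by
      have : (t : ℝ) / n ≤ t := div_le_self (Nat.cast_nonneg _) hN
      linarith
    have h4 : (Real.log n / ε ^ 2) ^ 4 * ((t : ℝ) / n + ε) ^ 3 ≤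
        (Real.log n / ε ^ 2) ^ 4 * ((t : ℝ) + 1) ^ 3 := by gcongr
    have h5 : C * Real.log n ^ 4 * (1 / ε) ^ 8 * ((t : ℝ) + 1) ^ 3 =
        C * ((Real.log n / ε ^ 2) ^ 4 * ((t : ℝ) + 1) ^ 3) := by
      field_simp
    rw [h5, ← mul_add]
    exact mul_le_mul_of_nonneg_left (by linarith) (by linarith)
  · have htest : ¬ RealRAM.Test.Holds (RealRAM.input n t ε p)
        (.and (.not (.natLt (.var 0) (.const 4))) (.realLt (.var 0) (.ofNat (.const 1)))) := by
      simpa [RealRAM.Test.Holds, RealRAM.NatExp.eval, RealRAM.RealExp.eval, RealRAM.input]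
        using hbr
    have h0 : 0 ≤ (Real.log n / ε ^ 2) ^ 4 * ((t : ℝ) / n + ε) ^ 3 := by positivity
    refine ⟨_, _, RealRAM.Runs.ite_false htest (RealRAM.Runs.skip _), ?_, ?_, ?_⟩
    · by_cases hn4 : 4 ≤ n
      · have hε1 : 1 ≤ ε := not_lt.1 fun h => hbr ⟨hn4, h⟩
        rw [(PMF.toOuterMeasure_apply_eq_one_iff _ _).2, ENNReal.ofReal_le_one]
        swap
        · rw [PMF.support_pure, Set.singleton_subset_iff]
          exact RealRAM.exists_output_input (X := X) p ht hε1
        have : 0 ≤ 3 / (n : ℝ) := by positivity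
        linarith
      · have hn3 : (n : ℝ) ≤ 3 := by exact_mod_cast (by omega : n ≤ 3)
        have : 1 ≤ 3 / (n : ℝ) := (one_le_div (by linarith)).2 hn3
        rw [ENNReal.ofReal_of_nonpos (by linarith)]
        exact zero_le
    · have : (1 + RealRAM.Test.cost (.and (.not (.natLt (.var 0) (.const 4)))
          (.realLt (.var 0) (.ofNat (.const 1)))) + 1 : ℕ) = 13 := by decide
      rw [this]
      push_cast
      nlinarith
    · have : (1 + RealRAM.Test.cost (.and (.not (.natLt (.var 0) (.const 4)))
          (.realLt (.var 0) (.ofNat (.const 1)))) + 1 : ℕ) = 13 := by decide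
      rw [this]
      push_cast
      have h1 : 0 ≤ C * Real.log n ^ 4 * (1 / ε) ^ 8 * ((t : ℝ) + 1) ^ 3 := by positivity
      nlinarith
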